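/- Let $\rho$ run over the zeros of the Riemann zeta function $\zeta(s)$, and write $\gamma=\operatorname{Im}\rho$. Assume the Riemann Hypothesis, that all zeros with $\gamma>0$ are simple, and that for every $\epsilon>0$ $$J_{-1}(T)=\sum_{0<\gamma\le T}\frac{1}{|\zeta'(\rho)|^2}\ll_\epsilon T^{1+\epsilon}\qquad (T\to\infty).$$ For an integer $k\ge 2$, call a positive integer $k$-free if it is not divisible by $p^k$ for any prime $p$, and for real $x\geq 1$ put $$M_k(x)=\#\{1\le n\le x:\ n \text{ is } k\text{-free}\}-\frac{x}{\zeta(k)}.$$ Then, for every integer $k\ge 2$, the series $$\beta_k=\sum_{\gamma>0}\frac{2\,|\zeta(\rho/k)|^2}{|\rho\,\zeta'(\rho)|^2}$$ converges, and $$\int_1^X\left(\frac{M_k(x)}{x^{1/(2k)}}\right)^2\frac{dx}{x}\sim\beta_k\log X\qquad (X\to\infty).$$ -/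

import Mathlib

namespace KFree

/-- The zeros `ρ` of the Riemann zeta function with imaginary part `γ > 0`. -/
def upperZeros : Set ℂ := {ρ | riemannZeta ρ = 0 ∧ 0 < ρ.im}

/-- `J_{-1}(T) = ∑_{0 < γ ≤ T} 1 / |ζ'(ρ)|²`. The index set is finite for every `T`, so the sum is a
finite sum; it is meant for simple zeros (a multiple zero would contribute the junk value `0`). -/
noncomputable def J (T : ℝ) : ℝ :=
  ∑' ρ : {ρ : ℂ // ρ ∈ upperZeros ∧ ρ.im ≤ T}, 1 / ‖deriv riemannZeta ρ‖ ^ 2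

/-- `n` is `k`-free: it is not divisible by the `k`-th power of any prime. -/
def IsKFree (k n : ℕ) : Prop := ∀ p : ℕ, p.Prime → ¬ p ^ k ∣ n

open Classical in
/-- The number of `k`-free integers `1 ≤ n ≤ x`. -/
noncomputable def count (k : ℕ) (x : ℝ) : ℕ :=
  ((Finset.Icc 1 ⌊x⌋₊).filter (IsKFree k)).card

/-- The error term `M_k(x) = ∑_{n ≤ x} μ_k(n) - x / ζ(k)`; here `ζ(k)` is a real number,
being `∑ n⁻ᵏ` for `k ≥ 2`. -/
noncomputable def M (k : ℕ) (x : ℝ) : ℝ := (count k x : ℝ) - x / (riemannZeta (k : ℂ)).re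

/-- The summand `2 |ζ(ρ/k)|² / |ρ ζ'(ρ)|²` of `β_k`. -/
noncomputable def betaTerm (k : ℕ) (ρ : ℂ) : ℝ :=
  2 * ‖riemannZeta (ρ / k)‖ ^ 2 / ‖ρ * deriv riemannZeta ρ‖ ^ 2

/-- `β_k`, the sum of `betaTerm k ρ` over the zeros with `γ > 0`. -/
noncomputable def beta (k : ℕ) : ℝ := ∑' ρ : upperZeros, betaTerm k ρ

end KFree

/-! ### Fourier analysis on vertical lines: Plancherel, shifting the line, interpolation in mean
square. -/

namespace KFree

open MeasureTheory Filter Topology Complex FourierTransform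
open scoped ENNReal Real ContDiff

/-! Put `x = exp (k y)` and normalise: `M_k(exp (k y)) * exp (-y / 2)`. The claim becomes that the
mean square of this function over `[0, Y]` tends to the sum of `|r_ρ|²` over all zeros off the real
axis, with `r_ρ = ζ(ρ/k) / (ρ ζ'(ρ))` (`zetaRes`). Conjugate zeros contribute equally, so that sum
is `β_k`.

The Dirichlet series of the `k`-free integers is `ζ(s)/ζ(ks)`. Hence the Laplace transform of
`M_k(exp (k y))` is `ζ(w/k)/(w ζ(w)) - 1/(ζ(k)(w - k))`. Its poles in `re w > -2` are simple: one at
`0` with residue `1`, and one at each nontrivial zero `ρ` with residue `r_ρ`. Heuristically the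
normalised error is the almost periodic function `∑ r_ρ exp (iγy)`, whose mean square is `∑ |r_ρ|²`.
The proof needs no pointwise explicit formula: it shows that finite partial sums approximate the
error in mean square.

Convergence (`summable_zetaRes`). Under RH, `ρ/k` lies on `re = 1/(2k)`, where convexity gives `ζ`
an exponent strictly below `1/2`. The bound on `J` then makes `∑ |r_ρ|² (1+|γ|)^η` finite for some
`η > 0`.

Approximation (`integral_normErr_sub_zeroTrig_le`). Remove the polar parts at `0` and at a finite
set `A` of zeros. By Plancherel (`lintegral_le_lineNorm`), the mean square of what remains, weighted
by `exp (-2σy)`, is at most the `L²` norm of its transform on `re w = σ`. The transform splits into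
three parts. The first is the full transform minus `exp (w²)/w` and `∑ r_ρ exp ((w-ρ)²)/(w-ρ)`. It
is holomorphic in `re w > -2`, so its norms on inner lines are controlled by those on `re w = -1`
and `re w = k + 1` (`lineNorm_le`); the functional equation handles the left edge. The second is a
finite sum of entire corrections of size `O(1/|im w|)`. The third is the smoothed sum over zeros
outside `A`. Cauchy–Schwarz and the local count of zeros bound its norm by `C/(σ - 1/2)` times the
tail of the weighted series (`exists_lineNorm_poleSum_le`). With `σ = 1/2 + 1/Y`, the mean square
error over `[0, Y]` is `O_A(1/Y)` plus a constant times that tail. Finite trigonometric sums have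
the expected mean square, so the limit follows by letting `A` grow.

Interpolation between the edges requires a priori polynomial growth in the strip. This comes from
dividing out zeros and applying Borel–Carathéodory (`norm_quotient_le`).

Finally, asymptotic equivalence requires `β_k ≠ 0`, hence the existence of a nontrivial zero
(`zeros_nonempty`). Without one, the same method would make `M_2 - 1` square integrable for `dx/x`,
which its sawtooth shape forbids. -/

/-- Plancherel's theorem for functions in `L¹ ∩ L²`. -/
lemma lintegral_enorm_fourier_sq {h : ℝ → ℂ} (h1 : Integrable h) (h2 : MemLp h 2) :
    ∫⁻ x, ‖𝓕 h x‖ₑ ^ 2 = ∫⁻ x, ‖h x‖ₑ ^ 2 := by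
  set u : Lp ℂ 2 (volume : Measure ℝ) := h2.toLp h with hu
  have hu_ae : u =ᵐ[volume] h := h2.coeFn_toLp
  have hcont : Continuous (𝓕 h) := by
    have := VectorFourier.fourierIntegral_continuous (L := innerₗ ℝ)
      Real.continuous_fourierChar continuous_inner h1
    exact this
  -- The `L²` transform is an extension by density. It is identified with the integral by testing
  -- against smooth compactly supported functions: the transform is moved onto the test function and
  -- then back onto `h` by Fubini.
  have key : ∀ᵐ x : ℝ, (𝓕 u : Lp ℂ 2 (volume : Measure ℝ)) x = 𝓕 h x := by
    apply ae_eq_of_integral_contDiff_smul_eq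
      ((Lp.memLp (𝓕 u)).locallyIntegrable (by norm_num)) hcont.locallyIntegrable
    intro g g_smooth g_cpt
    have hg₁ : HasCompactSupport (Complex.ofRealCLM ∘ g) := g_cpt.comp_left rfl
    have hg₂ : ContDiff ℝ ∞ (Complex.ofRealCLM ∘ g) := by fun_prop
    set φ := hg₁.toSchwartzMap hg₂ with hφ
    have e1 : ∫ x, g x • (𝓕 u : Lp ℂ 2 (volume : Measure ℝ)) x
        = Lp.toTemperedDistribution (𝓕 u) φ := by
      simp [hφ]
    rw [e1, ← Lp.fourier_toTemperedDistribution_eq, TemperedDistribution.fourier_apply,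
      Lp.toTemperedDistribution_apply]
    have e2 : ∫ x, (𝓕 φ) x • u x = ∫ x, (𝓕 (φ : ℝ → ℂ)) x • h x := by
      apply integral_congr_ae
      filter_upwards [hu_ae] with x hx
      rw [hx, SchwartzMap.fourier_coe]
    rw [e2]
    have e3 := VectorFourier.integral_fourierIntegral_smul_eq_flip (L := innerₗ ℝ)
      Real.continuous_fourierChar continuous_inner (φ.integrable (μ := volume)) h1
    have e4 : ∫ x, (𝓕 (φ : ℝ → ℂ)) x • h x = ∫ x, φ x • 𝓕 h x := by
      simpa using! e3
    rw [e4]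
    simp [hφ]
  have hn : ‖(𝓕 u : Lp ℂ 2 (volume : Measure ℝ))‖ₑ = ‖u‖ₑ := by
    rw [← ofReal_norm, ← ofReal_norm, Lp.norm_fourier_eq]
  rw [Lp.enorm_def, Lp.enorm_def, eLpNorm_congr_ae key, eLpNorm_congr_ae hu_ae] at hn
  have h2' : ∀ f : ℝ → ℂ, eLpNorm f 2 volume ^ 2 = ∫⁻ x, ‖f x‖ₑ ^ 2 := by
    intro f
    have := eLpNorm_nnreal_pow_eq_lintegral (f := f) (μ := volume) (p := 2) (by norm_num)
    simpa using this
  rw [← h2', ← h2', hn]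

/-- A holomorphic function decaying like `(1 + (im w) ^ 2)⁻¹` in a vertical strip has the same
integral over both edges. -/
lemma integral_vertical_line_eq {Φ : ℂ → ℂ} {a b C : ℝ} (hab : a ≤ b)
    (hd : ∀ w : ℂ, a ≤ w.re → w.re ≤ b → DifferentiableAt ℂ Φ w)
    (hC : ∀ w : ℂ, a ≤ w.re → w.re ≤ b → ‖Φ w‖ ≤ C / (1 + w.im ^ 2)) :
    ∫ t : ℝ, Φ (a + t * I) = ∫ t : ℝ, Φ (b + t * I) := by
  have hint : ∀ σ : ℝ, a ≤ σ → σ ≤ b → Integrable (fun t : ℝ ↦ Φ (σ + t * I)) := by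
    intro σ h1 h2
    refine Integrable.mono' ((integrable_inv_one_add_sq).const_mul C) ?_ ?_
    · refine Continuous.aestronglyMeasurable ?_
      rw [continuous_iff_continuousAt]
      intro t
      have : ContinuousAt Φ (σ + t * I) := (hd _ (by simpa using h1) (by simpa using h2)).continuousAt
      exact ContinuousAt.comp (f := fun t : ℝ ↦ (σ + t * I : ℂ)) this (by fun_prop)
    · filter_upwards with t
      have := hC (σ + t * I) (by simpa using h1) (by simpa using h2)
      simpa [div_eq_mul_inv] using this
  have hrect : ∀ T : ℝ, (∫ x : ℝ in a..b, Φ (x + (-T : ℝ) * I)) - (∫ x : ℝ in a..b, Φ (x + T * I)) +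
      I • (∫ y : ℝ in (-T)..T, Φ (b + y * I)) - I • (∫ y : ℝ in (-T)..T, Φ (a + y * I)) = 0 := by
    intro T
    have := Complex.integral_boundary_rect_eq_zero_of_differentiableOn Φ ⟨a, -T⟩ ⟨b, T⟩ ?_
    · simpa using this
    · intro w hw
      rw [mem_reProdIm] at hw
      simp only [Set.uIcc_of_le hab, Set.mem_Icc] at hw
      exact (hd w hw.1.1 hw.1.2).differentiableWithinAt
  have hC0 : 0 ≤ C := by
    have := (norm_nonneg _).trans (hC a (by simp) (by simpa using hab))
    simpa using this
  -- The sign carried by `s` treats the upper and the lower horizontal side together.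
  have hh : ∀ s : ℝ → ℝ, (∀ T, s T ^ 2 = T ^ 2) →
      Tendsto (fun T : ℝ ↦ ∫ x : ℝ in a..b, Φ (x + s T * I)) atTop (𝓝 0) := by
    intro s hs
    have hb : ∀ T : ℝ, ‖∫ x : ℝ in a..b, Φ (x + s T * I)‖ ≤ C / (1 + T ^ 2) * |b - a| := by
      intro T
      apply intervalIntegral.norm_integral_le_of_norm_le_const
      intro x hx
      rw [Set.uIoc_of_le hab] at hx
      have := hC (x + s T * I) (by simpa using hx.1.le) (by simpa using hx.2)
      simpa [hs] using this
    refine squeeze_zero_norm hb ?_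
    have : Tendsto (fun T : ℝ ↦ 1 + T ^ 2) atTop atTop :=
      tendsto_atTop_add_const_left _ _ (tendsto_pow_atTop (by norm_num))
    simpa using (this.const_div_atTop C).mul_const |b - a|
  have l1 := (intervalIntegral_tendsto_integral (hint b hab le_rfl) tendsto_neg_atTop_atBot tendsto_id)
  have l2 := (intervalIntegral_tendsto_integral (hint a le_rfl hab) tendsto_neg_atTop_atBot tendsto_id)
  have l3 := hh (fun T ↦ -T) (by simp)
  have l4 := hh (fun T ↦ T) (by simp)
  have l5 := ((l3.sub l4).add (l1.const_smul I)).sub (l2.const_smul I)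
  have l6 : Tendsto (fun _ : ℝ ↦ (0 : ℂ)) atTop (𝓝 (0 - 0 + I • (∫ t : ℝ, Φ (b + t * I)) -
      I • (∫ t : ℝ, Φ (a + t * I)))) := by
    refine l5.congr fun T ↦ ?_
    simpa using hrect T
  have := tendsto_nhds_unique l6 tendsto_const_nhds
  simp only [sub_zero, zero_add, smul_eq_mul, ← mul_sub] at this
  rcases mul_eq_zero.mp this with h | h
  · exact absurd h I_ne_zero
  · exact (sub_eq_zero.mp h).symm

/-- By `1 + |v| ≤ exp |v|` and completing the square. Two extra powers of `1 + |v|` pay for the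
factor `1 + v ^ 2`, so a Gaussian turns polynomial growth into integrable decay. -/
lemma pow_mul_exp_neg_mul_sq_le (n : ℕ) {ε : ℝ} (hε : 0 < ε) (v : ℝ) :
    (1 + |v|) ^ n * Real.exp (-(ε * v ^ 2)) ≤ Real.exp ((n + 2) ^ 2 / (4 * ε)) / (1 + v ^ 2) := by
  rw [le_div_iff₀ (by positivity)]
  have h1 : (1 + v ^ 2) ≤ (1 + |v|) ^ 2 := by nlinarith [abs_nonneg v, sq_abs v]
  have h2 : (1 + |v|) ^ (n + 2) ≤ Real.exp ((n + 2) * |v|) := by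
    have : 1 + |v| ≤ Real.exp |v| := by linarith [Real.add_one_le_exp |v|]
    calc (1 + |v|) ^ (n + 2) ≤ Real.exp |v| ^ (n + 2) := by gcongr
      _ = _ := by rw [← Real.exp_nat_mul]; push_cast; ring_nf
  have h3 : (n + 2) * |v| ≤ (n + 2) ^ 2 / (4 * ε) + ε * v ^ 2 := by
    have e : (n + 2) ^ 2 / (4 * ε) + ε * v ^ 2 - (n + 2) * |v|
        = ((n + 2) - 2 * ε * |v|) ^ 2 / (4 * ε) := by
      field_simp
      rw [← sq_abs v]
      ring
    have : 0 ≤ ((n + 2) - 2 * ε * |v|) ^ 2 / (4 * ε) := by positivity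
    linarith
  calc (1 + |v|) ^ n * Real.exp (-(ε * v ^ 2)) * (1 + v ^ 2)
      ≤ (1 + |v|) ^ n * Real.exp (-(ε * v ^ 2)) * (1 + |v|) ^ 2 := by gcongr
    _ = (1 + |v|) ^ (n + 2) * Real.exp (-(ε * v ^ 2)) := by ring
    _ ≤ Real.exp ((n + 2) ^ 2 / (4 * ε) + ε * v ^ 2) * Real.exp (-(ε * v ^ 2)) := by
        gcongr
        exact h2.trans (Real.exp_le_exp.mpr h3)
    _ = _ := by rw [← Real.exp_add]; ring_nf

/-- The Gaussian regularization of `G` on the vertical line `re w = σ`, normalized at `re w = b`. -/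
noncomputable def gaussReg (G : ℂ → ℂ) (b c σ t : ℝ) : ℂ :=
  G (σ + 2 * π * t * I) * cexp ((σ - b + 2 * π * t * I) ^ 2 / (4 * π ^ 2 * c))

/-- `G` is holomorphic and of polynomial growth in the closed strip `a ≤ re w ≤ b`. -/
structure StripFunction (G : ℂ → ℂ) (a b : ℝ) : Prop where
  diff : ∀ w : ℂ, a ≤ w.re → w.re ≤ b → DifferentiableAt ℂ G w
  growth : ∃ (C : ℝ) (n : ℕ), ∀ w : ℂ, a ≤ w.re → w.re ≤ b → ‖G w‖ ≤ C * (1 + |w.im|) ^ n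

lemma norm_cexp_regularizer (x v c : ℝ) :
    ‖cexp ((x + v * I) ^ 2 / (4 * π ^ 2 * c))‖
      = Real.exp (x ^ 2 / (4 * π ^ 2 * c)) * Real.exp (-(1 / (4 * π ^ 2 * c) * v ^ 2)) := by
  rw [Complex.norm_exp, ← Real.exp_add]
  congr 1
  have : ((x + v * I : ℂ) ^ 2 / (4 * π ^ 2 * c))
      = (((x ^ 2 - v ^ 2) / (4 * π ^ 2 * c) : ℝ) : ℂ) + ((2 * x * v / (4 * π ^ 2 * c) : ℝ) : ℂ) * I := by
    push_cast
    linear_combination (v ^ 2 / (4 * π ^ 2 * c) : ℂ) * I_sq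
  rw [this, Complex.add_re, Complex.ofReal_re, Complex.re_ofReal_mul, I_re]
  ring

namespace StripFunction

variable {G : ℂ → ℂ} {a b : ℝ}

lemma norm_mul_regularizer_le (hG : StripFunction G a b) {c : ℝ} (hc : 0 < c) :
    ∃ C, 0 ≤ C ∧ ∀ w : ℂ, a ≤ w.re → w.re ≤ b →
      ‖G w * cexp ((w - b) ^ 2 / (4 * π ^ 2 * c))‖ ≤ C / (1 + w.im ^ 2) := by
  obtain ⟨C, n, hC⟩ := hG.growth
  set ε : ℝ := 1 / (4 * π ^ 2 * c) with hε
  have hε0 : 0 < ε := by positivity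
  refine ⟨|C| * Real.exp ((b - a) ^ 2 * ε) * Real.exp ((n + 2) ^ 2 / (4 * ε)), by positivity, ?_⟩
  intro w h1 h2
  have hw : w - b = ((w.re - b : ℝ) : ℂ) + w.im * I := by
    apply Complex.ext <;> simp
  rw [norm_mul, hw, norm_cexp_regularizer, ← hε]
  have h3 : (w.re - b) ^ 2 / (4 * π ^ 2 * c) ≤ (b - a) ^ 2 * ε := by
    rw [hε, mul_one_div]
    gcongr ?_ / _
    nlinarith
  calc ‖G w‖ * (Real.exp ((w.re - b) ^ 2 / (4 * π ^ 2 * c)) * Real.exp (-(ε * w.im ^ 2)))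
      ≤ (|C| * (1 + |w.im|) ^ n) * (Real.exp ((b - a) ^ 2 * ε) * Real.exp (-(ε * w.im ^ 2))) := by
        gcongr
        exact (hC w h1 h2).trans (by gcongr; exact le_abs_self C)
    _ = |C| * Real.exp ((b - a) ^ 2 * ε) * ((1 + |w.im|) ^ n * Real.exp (-(ε * w.im ^ 2))) := by ring
    _ ≤ |C| * Real.exp ((b - a) ^ 2 * ε) * (Real.exp ((n + 2) ^ 2 / (4 * ε)) / (1 + w.im ^ 2)) := by
        gcongr
        exact pow_mul_exp_neg_mul_sq_le n hε0 w.im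
    _ = _ := by ring

lemma continuous_line (hG : StripFunction G a b) {σ : ℝ} (h1 : a ≤ σ) (h2 : σ ≤ b) :
    Continuous fun t : ℝ ↦ G (σ + 2 * π * t * I) := by
  rw [continuous_iff_continuousAt]
  intro t
  have : ContinuousAt G (σ + 2 * π * t * I) :=
    (hG.diff _ (by simpa using h1) (by simpa using h2)).continuousAt
  exact ContinuousAt.comp (f := fun t : ℝ ↦ (σ + 2 * π * t * I : ℂ)) this (by fun_prop)

lemma continuous_gaussReg (hG : StripFunction G a b) {σ c : ℝ} (h1 : a ≤ σ) (h2 : σ ≤ b) :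
    Continuous (gaussReg G b c σ) := by
  unfold gaussReg
  exact (hG.continuous_line h1 h2).mul (by fun_prop)

lemma norm_gaussReg_le (hG : StripFunction G a b) {c : ℝ} (hc : 0 < c) :
    ∃ C, 0 ≤ C ∧ ∀ σ t : ℝ, a ≤ σ → σ ≤ b → ‖gaussReg G b c σ t‖ ≤ C * (1 + t ^ 2)⁻¹ := by
  obtain ⟨C, hC0, hC⟩ := hG.norm_mul_regularizer_le hc
  refine ⟨C, hC0, fun σ t h1 h2 ↦ ?_⟩
  have := hC (σ + 2 * π * t * I) (by simpa using h1) (by simpa using h2)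
  have e : gaussReg G b c σ t = G (σ + 2 * π * t * I) *
      cexp ((σ + 2 * π * t * I - b) ^ 2 / (4 * π ^ 2 * c)) := by
    unfold gaussReg; ring_nf
  rw [e]
  refine this.trans ?_
  have him : (σ + 2 * π * t * I : ℂ).im = 2 * π * t := by simp
  rw [div_eq_mul_inv, him, mul_pow]
  refine mul_le_mul_of_nonneg_left (inv_anti₀ (by positivity) ?_) hC0
  have : 1 ≤ (2 * π) ^ 2 := by nlinarith [Real.pi_gt_three]
  nlinarith [sq_nonneg t]

lemma integrable_gaussReg (hG : StripFunction G a b) {σ c : ℝ} (hc : 0 < c) (h1 : a ≤ σ)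
    (h2 : σ ≤ b) : Integrable (gaussReg G b c σ) := by
  obtain ⟨C, hC0, hC⟩ := hG.norm_gaussReg_le hc
  refine Integrable.mono' (integrable_inv_one_add_sq.const_mul C)
    (hG.continuous_gaussReg h1 h2).aestronglyMeasurable ?_
  filter_upwards with t using hC σ t h1 h2

lemma memLp_gaussReg (hG : StripFunction G a b) {σ c : ℝ} (hc : 0 < c) (h1 : a ≤ σ)
    (h2 : σ ≤ b) : MemLp (gaussReg G b c σ) 2 := by
  obtain ⟨C, hC0, hC⟩ := hG.norm_gaussReg_le hc
  rw [memLp_two_iff_integrable_sq_norm (hG.continuous_gaussReg h1 h2).aestronglyMeasurable]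
  refine Integrable.mono' (integrable_inv_one_add_sq.const_mul (C * C)) ?_ ?_
  · exact ((hG.continuous_gaussReg h1 h2).norm.pow 2).aestronglyMeasurable
  · filter_upwards with t
    rw [Real.norm_eq_abs, abs_of_nonneg (by positivity), sq]
    have h3 := hC σ t h1 h2
    have h4 : (1 + t ^ 2)⁻¹ ≤ 1 := inv_le_one_of_one_le₀ (by nlinarith [sq_nonneg t])
    calc ‖gaussReg G b c σ t‖ * ‖gaussReg G b c σ t‖
        ≤ (C * (1 + t ^ 2)⁻¹) * (C * 1) := by
          gcongr
          exact h3.trans (by gcongr)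
      _ = _ := by ring

/-- The inverse Fourier transforms of the regularized function on the different vertical lines
differ only by the expected exponential factor. -/
lemma fourierInv_gaussReg (hG : StripFunction G a b) {σ c : ℝ} (hc : 0 < c) (h1 : a ≤ σ)
    (h2 : σ ≤ b) (y : ℝ) :
    𝓕⁻ (gaussReg G b c σ) y = cexp ((b - σ) * y) * 𝓕⁻ (gaussReg G b c b) y := by
  obtain ⟨C, hC0, hC⟩ := hG.norm_mul_regularizer_le hc
  -- With the factor `exp (w y)`, the inverse transforms on all lines become integrals of one
  -- holomorphic function, up to `exp (-σ y)`, and Cauchy's theorem applies.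
  set Φ : ℂ → ℂ := fun w ↦ G w * cexp ((w - b) ^ 2 / (4 * π ^ 2 * c)) * cexp (w * y) with hΦ
  have hshift : ∫ t : ℝ, Φ (σ + t * I) = ∫ t : ℝ, Φ (b + t * I) := by
    obtain ⟨K, hK⟩ : ∃ K, ∀ x ∈ Set.Icc a b, ‖Real.exp (x * y)‖ ≤ K :=
      isCompact_Icc.exists_bound_of_continuousOn (f := fun x : ℝ ↦ Real.exp (x * y)) (by fun_prop)
    refine integral_vertical_line_eq (C := C * K) h2 (fun w hw1 hw2 ↦ ?_) (fun w hw1 hw2 ↦ ?_)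
    · exact ((hG.diff w (h1.trans hw1) hw2).mul (by fun_prop)).mul (by fun_prop)
    · rw [hΦ]
      simp only
      rw [norm_mul, Complex.norm_exp]
      have e1 := hC w (h1.trans hw1) hw2
      have e2 := hK w.re ⟨h1.trans hw1, hw2⟩
      have e3 : (w * y).re = w.re * y := by simp
      rw [Real.norm_eq_abs, abs_of_pos (Real.exp_pos _)] at e2
      rw [e3, mul_div_right_comm]
      gcongr
  have hline : ∀ s : ℝ, 𝓕⁻ (gaussReg G b c s) y
      = cexp (-(s * y)) * ∫ t : ℝ, Φ (s + (2 * π * t : ℝ) * I) := by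
    intro s
    rw [Real.fourierInv_eq', ← integral_const_mul]
    congr 1
    ext t
    rw [hΦ]
    simp only [gaussReg, smul_eq_mul, RCLike.inner_apply, conj_trivial]
    push_cast
    rw [show ((s : ℂ) - b + 2 * π * t * I) = s + 2 * π * t * I - b by ring]
    have : cexp (2 * π * (y * t) * I) = cexp (-(s * y)) * cexp ((s + 2 * π * t * I) * y) := by
      rw [← Complex.exp_add]; ring_nf
    rw [this]
    ring
  rw [hline σ, hline b, Measure.integral_comp_mul_left (fun t : ℝ ↦ Φ (σ + t * I)) (2 * π),
    Measure.integral_comp_mul_left (fun t : ℝ ↦ Φ (b + t * I)) (2 * π), hshift, ← mul_assoc,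
    ← Complex.exp_add]
  ring_nf

/-- Plancherel on the line `σ`, written on the right edge: a single function of `y` describes every
line, and only the exponential weight depends on `σ`. Comparing line norms thus reduces to comparing
weights. -/
lemma lintegral_enorm_fourierInv_gaussReg (hG : StripFunction G a b) {σ c : ℝ} (hc : 0 < c)
    (h1 : a ≤ σ) (h2 : σ ≤ b) :
    ∫⁻ y : ℝ, ‖cexp ((b - σ) * y) * 𝓕⁻ (gaussReg G b c b) y‖ₑ ^ 2
      = ∫⁻ t, ‖gaussReg G b c σ t‖ₑ ^ 2 := by
  rw [← lintegral_enorm_fourier_sq (hG.integrable_gaussReg hc h1 h2) (hG.memLp_gaussReg hc h1 h2),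
    ← lintegral_neg_eq_self (fun x ↦ ‖𝓕 (gaussReg G b c σ) x‖ₑ ^ 2)]
  congr 1
  ext y
  rw [← hG.fourierInv_gaussReg hc h1 h2, Real.fourierInv_eq_fourier_neg]

lemma continuous_fourierInv_gaussReg (hG : StripFunction G a b) {c : ℝ} (hc : 0 < c)
    (hab : a ≤ b) : Continuous fun y : ℝ ↦ 𝓕⁻ (gaussReg G b c b) y := by
  have h9 : Continuous (𝓕 (gaussReg G b c b)) :=
    VectorFourier.fourierIntegral_continuous (L := innerₗ ℝ)
      Real.continuous_fourierChar continuous_inner (hG.integrable_gaussReg hc hab le_rfl)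
  simp_rw [Real.fourierInv_eq_fourier_neg]
  exact h9.comp continuous_neg

/-- The squared `L²` norm on a vertical line. -/
noncomputable def _root_.KFree.lineNorm (G : ℂ → ℂ) (σ : ℝ) : ℝ≥0∞ :=
  ∫⁻ t : ℝ, ‖G (σ + 2 * π * t * I)‖ₑ ^ 2

lemma enorm_gaussReg_le (G : ℂ → ℂ) (b : ℝ) {c : ℝ} (hc : 0 < c) (σ t : ℝ) :
    ‖gaussReg G b c σ t‖ₑ ^ 2 ≤ ENNReal.ofReal (Real.exp ((σ - b) ^ 2 / (4 * π ^ 2 * c))) ^ 2 *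
      ‖G (σ + 2 * π * t * I)‖ₑ ^ 2 := by
  rw [← mul_pow]
  gcongr
  rw [gaussReg, enorm_mul, mul_comm]
  gcongr
  rw [← ofReal_norm]
  apply ENNReal.ofReal_le_ofReal
  have := norm_cexp_regularizer (σ - b) (2 * π * t) c
  push_cast at this
  rw [this]
  exact mul_le_of_le_one_right (by positivity) (Real.exp_le_one_iff.mpr (by
    rw [neg_nonpos]; positivity))

lemma lintegral_enorm_gaussReg_le (G : ℂ → ℂ) (b : ℝ) {c : ℝ} (hc : 0 < c) (σ : ℝ) :
    ∫⁻ t, ‖gaussReg G b c σ t‖ₑ ^ 2 ≤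
      ENNReal.ofReal (Real.exp ((σ - b) ^ 2 / (4 * π ^ 2 * c))) ^ 2 * lineNorm G σ := by
  rw [lineNorm, ← lintegral_const_mul' _ _ (by finiteness)]
  exact lintegral_mono fun t ↦ enorm_gaussReg_le G b hc σ t

lemma tendsto_gaussReg (G : ℂ → ℂ) (b σ t : ℝ) :
    Tendsto (fun n : ℕ ↦ gaussReg G b (n + 1) σ t) atTop (𝓝 (G (σ + 2 * π * t * I))) := by
  unfold gaussReg
  have h : Tendsto (fun n : ℕ ↦ (σ - b + 2 * π * t * I : ℂ) ^ 2 / (4 * π ^ 2) *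
      (((1 / ((n : ℝ) + 1) : ℝ) : ℂ))) atTop (𝓝 ((σ - b + 2 * π * t * I : ℂ) ^ 2 / (4 * π ^ 2) *
      ((0 : ℝ) : ℂ))) :=
    ((Complex.continuous_ofReal.tendsto 0).comp
      (tendsto_one_div_add_atTop_nhds_zero_nat (𝕜 := ℝ))).const_mul _
  have h2 := ((Complex.continuous_exp.tendsto _).comp h).const_mul (G (σ + 2 * π * t * I))
  simp only [ofReal_zero, mul_zero, Complex.exp_zero, mul_one] at h2
  refine h2.congr fun n ↦ ?_
  simp only [Function.comp]
  congr 2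
  push_cast
  field_simp

lemma tendsto_const_mul_of_regularizer (x : ℝ) (L : ℝ≥0∞) :
    Tendsto (fun n : ℕ ↦ ENNReal.ofReal (Real.exp (x ^ 2 / (4 * π ^ 2 * ((n : ℝ) + 1)))) ^ 2 * L)
      atTop (𝓝 L) := by
  have h : Tendsto (fun n : ℕ ↦ x ^ 2 / (4 * π ^ 2) * (1 / ((n : ℝ) + 1))) atTop
      (𝓝 (x ^ 2 / (4 * π ^ 2) * 0)) :=
    (tendsto_one_div_add_atTop_nhds_zero_nat (𝕜 := ℝ)).const_mul _
  have h2 := ENNReal.tendsto_ofReal ((Real.continuous_exp.tendsto _).comp h)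
  have h3 := (ENNReal.continuous_pow 2).tendsto _ |>.comp h2
  simp only [mul_zero, Real.exp_zero, ENNReal.ofReal_one, one_pow] at h3
  have h4 := ENNReal.Tendsto.mul_const (b := L) h3 (Or.inl one_ne_zero)
  rw [one_mul] at h4
  refine h4.congr fun n ↦ ?_
  simp only [Function.comp]
  congr 4
  field_simp

/-- The `L²` norm on an inner line is controlled by the `L²` norms on the edges of the strip. -/
theorem lineNorm_le (hG : StripFunction G a b) {σ : ℝ} (h1 : a ≤ σ) (h2 : σ ≤ b) :
    lineNorm G σ ≤ lineNorm G a + lineNorm G b := by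
  have hab := h1.trans h2
  have step : ∀ n : ℕ, ∫⁻ t, ‖gaussReg G b (n + 1) σ t‖ₑ ^ 2 ≤
      ENNReal.ofReal (Real.exp ((a - b) ^ 2 / (4 * π ^ 2 * ((n : ℝ) + 1)))) ^ 2 * lineNorm G a +
      ENNReal.ofReal (Real.exp ((b - b) ^ 2 / (4 * π ^ 2 * ((n : ℝ) + 1)))) ^ 2 * lineNorm G b := by
    intro n
    have hc : (0 : ℝ) < (n : ℝ) + 1 := by positivity
    refine le_trans ?_ (add_le_add (lintegral_enorm_gaussReg_le G b hc a)
      (lintegral_enorm_gaussReg_le G b hc b))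
    rw [← hG.lintegral_enorm_fourierInv_gaussReg hc h1 h2,
      ← hG.lintegral_enorm_fourierInv_gaussReg hc le_rfl hab,
      ← hG.lintegral_enorm_fourierInv_gaussReg hc hab le_rfl]
    have hm : Measurable fun y : ℝ ↦ ‖cexp ((b - a) * y) * 𝓕⁻ (gaussReg G b (n + 1) b) y‖ₑ ^ 2 := by
      have := hG.continuous_fourierInv_gaussReg hc hab
      exact (Continuous.enorm (by fun_prop)).measurable.pow_const 2
    rw [← lintegral_add_left hm]
    refine lintegral_mono fun y ↦ ?_
    simp only [enorm_mul, mul_pow, ← add_mul]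
    gcongr
    have e : ∀ s : ℝ, ‖cexp ((b - s) * y)‖ₑ = ENNReal.ofReal (Real.exp ((b - s) * y)) := by
      intro s
      rw [← ofReal_norm, Complex.norm_exp]
      simp
    rw [e, e, e]
    -- The weight of the line `σ` is below that of `a` for `y ≥ 0` and below that of `b` for `y ≤
    -- 0`.
    rcases le_total 0 y with hy | hy
    · refine le_add_right ?_
      gcongr
    · refine le_add_left ?_
      gcongr ENNReal.ofReal (Real.exp ?_) ^ 2
      nlinarith
  -- Fatou's lemma removes the Gaussian as `c → ∞`, without assuming that any of the line norms is
  -- finite.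
  have hF : lineNorm G σ ≤ liminf (fun n : ℕ ↦ ∫⁻ t, ‖gaussReg G b (n + 1) σ t‖ₑ ^ 2) atTop := by
    refine le_trans (le_of_eq ?_) (lintegral_liminf_le fun n ↦
      (hG.continuous_gaussReg h1 h2).enorm.measurable.pow_const 2)
    refine lintegral_congr fun t ↦ ?_
    have := ((ENNReal.continuous_pow 2).tendsto _).comp ((continuous_enorm.tendsto _).comp
      (tendsto_gaussReg G b σ t))
    exact this.liminf_eq.symm
  refine hF.trans ?_
  have hlim := (tendsto_const_mul_of_regularizer (a - b) (lineNorm G a)).add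
    (tendsto_const_mul_of_regularizer (b - b) (lineNorm G b))
  rw [← hlim.liminf_eq]
  exact liminf_le_liminf (Eventually.of_forall step)

/-- Moving the Fourier transform from `h` to a modulated Gaussian exhibits the regularised inverse
transform as the convolution of `h` with a Gaussian approximate identity. -/
lemma integral_gaussian_smul_eq_fourierInv_gaussReg {h : ℝ → ℂ} {b c : ℝ} (hf : Integrable h)
    (hFh : ∀ t, 𝓕 h t = G (b + 2 * π * t * I)) (hc : 0 < c) (y : ℝ) :
    ∫ w : ℝ, ((π * c : ℂ) ^ (Module.finrank ℝ ℝ / 2 : ℂ) *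
      cexp (-π ^ 2 * c * ‖y - w‖ ^ 2)) • h w = 𝓕⁻ (gaussReg G b c b) y := by
  have J : Integrable (fun w : ℝ ↦ cexp (- c⁻¹ * ‖w‖ ^ 2 + 2 * π * I * inner ℝ y w)) :=
    GaussianFourier.integrable_cexp_neg_mul_sq_norm_add (by simpa using hc) _ _
  have h5 := (VectorFourier.integral_fourierIntegral_smul_eq_flip (L := innerₗ ℝ)
    Real.continuous_fourierChar continuous_inner J hf)
  have h6 : ∫ w : ℝ, 𝓕 (fun w : ℝ ↦ cexp (- c⁻¹ * ‖w‖ ^ 2 + 2 * π * I * inner ℝ y w)) w • h w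
      = ∫ w : ℝ, cexp (- c⁻¹ * ‖w‖ ^ 2 + 2 * π * I * inner ℝ y w) • 𝓕 h w := by
    simpa using! h5
  have h7 : 𝓕⁻ (gaussReg G b c b) y
      = ∫ w : ℝ, cexp (- c⁻¹ * ‖w‖ ^ 2 + 2 * π * I * inner ℝ y w) • 𝓕 h w := by
    rw [Real.fourierInv_eq']
    congr 1
    ext w
    rw [hFh]
    simp only [gaussReg, smul_eq_mul, RCLike.inner_apply, conj_trivial, Real.norm_eq_abs]
    have : cexp (-((c⁻¹ : ℝ) : ℂ) * ((|w| : ℝ) : ℂ) ^ 2 + 2 * π * I * ((w * y : ℝ) : ℂ))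
        = cexp (((2 * π * (y * w) : ℝ) : ℂ) * I) *
          cexp ((b - b + 2 * π * w * I) ^ 2 / (4 * π ^ 2 * c)) := by
      rw [← Complex.exp_add]
      congr 1
      have e1 : ((|w| : ℝ) : ℂ) ^ 2 = (w : ℂ) ^ 2 := by
        rw [← ofReal_pow, sq_abs, ofReal_pow]
      have e2 : (c : ℂ) ≠ 0 := by exact_mod_cast hc.ne'
      rw [e1]
      push_cast
      field_simp
      ring_nf
      simp only [I_sq]
      ring
    rw [this]
    ring
  rw [h7, ← h6]
  congr 1
  ext w
  rw [fourier_gaussian_innerProductSpace' (by simpa using hc)]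
  congr 2
  · simp
  · congr 1
    simp
    ring

/-- If `G` on the right edge of a strip is the Laplace transform of `f`, the left edge
bounds a weighted `L²` norm of `f`. -/
theorem lintegral_le_lineNorm (hG : StripFunction G a b) (hab : a ≤ b) {f : ℝ → ℂ}
    (hf : Integrable fun y : ℝ ↦ f y * cexp (-(b * y)))
    (hcont : ∀ᵐ y : ℝ, ContinuousAt f y)
    (htrans : ∀ t : ℝ, ∫ y : ℝ, f y * cexp (-((b + 2 * π * t * I) * y)) = G (b + 2 * π * t * I)) :
    ∫⁻ y : ℝ, ‖f y * cexp (-(a * y))‖ₑ ^ 2 ≤ lineNorm G a := by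
  set h : ℝ → ℂ := fun y ↦ f y * cexp (-(b * y)) with hh
  have hFh : ∀ t, 𝓕 h t = G (b + 2 * π * t * I) := by
    intro t
    rw [Real.fourier_eq', ← htrans]
    congr 1
    ext y
    simp only [hh, smul_eq_mul, RCLike.inner_apply, conj_trivial]
    have : cexp (-((b + 2 * π * t * I) * y)) = cexp (((-2 * π * (t * y) : ℝ) : ℂ) * I) * cexp (-(b * y)) := by
      rw [← Complex.exp_add]
      push_cast
      ring_nf
    rw [this]
    ring
  -- Gaussian means converge at every continuity point, hence almost everywhere. No integrability of
  -- `G` on the right edge is needed.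
  have hlim : ∀ᵐ y : ℝ, Tendsto (fun n : ℕ ↦ cexp ((b - a) * y) * 𝓕⁻ (gaussReg G b (n + 1) b) y)
      atTop (𝓝 (f y * cexp (-(a * y)))) := by
    filter_upwards [hcont] with y hy
    have hy' : ContinuousAt h y := hy.mul (by fun_prop)
    have h3 := (Real.tendsto_integral_gaussian_smul' hf hy').comp
      (tendsto_atTop_add_const_right _ (1 : ℝ) (tendsto_natCast_atTop_atTop (R := ℝ)))
    have h4 : Tendsto (fun n : ℕ ↦ 𝓕⁻ (gaussReg G b (n + 1) b) y) atTop (𝓝 (h y)) := by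
      refine h3.congr fun n ↦ ?_
      simp only [Function.comp]
      have := integral_gaussian_smul_eq_fourierInv_gaussReg hf hFh (c := (n : ℝ) + 1) (by positivity) y
      push_cast at this ⊢
      exact this
    have h8 := h4.const_mul (cexp ((b - a) * y))
    have e : cexp ((b - a) * y) * h y = f y * cexp (-(a * y)) := by
      rw [hh]
      simp only
      rw [mul_left_comm, ← Complex.exp_add]
      ring_nf
    rwa [e] at h8
  have hF : ∫⁻ y : ℝ, ‖f y * cexp (-(a * y))‖ₑ ^ 2 ≤ liminf (fun n : ℕ ↦
      ∫⁻ y : ℝ, ‖cexp ((b - a) * y) * 𝓕⁻ (gaussReg G b (n + 1) b) y‖ₑ ^ 2) atTop := by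
    have hmeas : ∀ n : ℕ, Measurable fun y : ℝ ↦
        ‖cexp ((b - a) * y) * 𝓕⁻ (gaussReg G b (n + 1) b) y‖ₑ ^ 2 := by
      intro n
      have hc : (0 : ℝ) < (n : ℝ) + 1 := by positivity
      have h10 := hG.continuous_fourierInv_gaussReg hc hab
      exact (Continuous.enorm (by fun_prop)).measurable.pow_const 2
    refine le_trans (le_of_eq ?_) (lintegral_liminf_le hmeas)
    refine lintegral_congr_ae ?_
    filter_upwards [hlim] with y hy
    have := ((ENNReal.continuous_pow 2).tendsto _).comp ((continuous_enorm.tendsto _).comp hy)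
    exact this.liminf_eq.symm
  refine hF.trans ?_
  rw [← (tendsto_const_mul_of_regularizer (a - b) (lineNorm G a)).liminf_eq]
  refine liminf_le_liminf (Eventually.of_forall fun n ↦ ?_)
  have hc : (0 : ℝ) < (n : ℝ) + 1 := by positivity
  rw [hG.lintegral_enorm_fourierInv_gaussReg hc le_rfl hab]
  exact lintegral_enorm_gaussReg_le G b hc a

end StripFunction

end KFree

namespace KFree

open MeasureTheory Filter Topology Complex Metric
open scoped ENNReal Real

/-! ### Phragmén–Lindelöf with polynomial bounds on the edges -/

/-- The base of the power weight in a vertical strip. -/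
noncomputable def stripBase (a b : ℝ) (z : ℂ) : ℂ := ((b - a + 1 : ℝ) : ℂ) ^ 2 - (z - a) ^ 2

lemma stripBase_re (a b : ℝ) (z : ℂ) :
    (stripBase a b z).re = (b - a + 1) ^ 2 - (z.re - a) ^ 2 + z.im ^ 2 := by
  simp [stripBase, sq]
  ring

lemma stripBase_im (a b : ℝ) (z : ℂ) :
    (stripBase a b z).im = -(2 * (z.re - a) * z.im) := by
  simp [stripBase, sq]
  ring

/-- The `+ 1` in the base leaves room for it to stay in the right half plane, so the principal
logarithm is holomorphic on the closed strip. -/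
lemma one_add_sq_le_stripBase_re {a b : ℝ} {z : ℂ} (h1 : a ≤ z.re) (h2 : z.re ≤ b) :
    1 + z.im ^ 2 ≤ (stripBase a b z).re := by
  rw [stripBase_re]
  nlinarith

/-- The function `w ^ (p w + q)` with a base `w` close to `|im z|`. -/
noncomputable def stripWeight (a b p q : ℝ) (z : ℂ) : ℂ :=
  cexp ((p * z + q) * (Complex.log (stripBase a b z) / 2))

lemma differentiableAt_stripWeight {a b : ℝ} (p q : ℝ) {z : ℂ} (h1 : a ≤ z.re) (h2 : z.re ≤ b) :
    DifferentiableAt ℂ (stripWeight a b p q) z := by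
  unfold stripWeight
  have h : stripBase a b z ∈ slitPlane := by
    left
    nlinarith [one_add_sq_le_stripBase_re h1 h2]
  have h' : DifferentiableAt ℂ (stripBase a b) z := by unfold stripBase; fun_prop
  have := h'.clog h
  fun_prop

lemma norm_stripWeight (a b p q : ℝ) (z : ℂ) :
    ‖stripWeight a b p q z‖ = Real.exp ((p * z.re + q) * (Real.log ‖stripBase a b z‖ / 2)
      - p * z.im * ((stripBase a b z).arg / 2)) := by
  rw [stripWeight, Complex.norm_exp]
  congr 1
  simp [Complex.mul_re, Complex.log_re, Complex.log_im]

/-- The imaginary part of the base is `O(|im z|)` and its real part at least `1 + (im z)²`, so its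
argument is `O(1/|im z|)`. The argument therefore affects the modulus of `stripWeight` only by a
bounded factor. -/
lemma abs_im_mul_arg_stripBase_le {a b : ℝ} {z : ℂ} (h1 : a ≤ z.re) (h2 : z.re ≤ b) :
    |z.im * (stripBase a b z).arg| ≤ π * (b - a) := by
  set Q := stripBase a b z
  have hre := one_add_sq_le_stripBase_re h1 h2
  have hre0 : 0 < Q.re := by nlinarith
  have hn : Q.re ≤ ‖Q‖ := Complex.re_le_norm Q
  rw [Complex.arg_of_re_nonneg hre0.le, abs_mul]
  have h3 : |Real.arcsin (Q.im / ‖Q‖)| ≤ π / 2 * |Q.im / ‖Q‖| := by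
    have hx : |Q.im / ‖Q‖| ≤ 1 := by
      rw [abs_div, abs_norm]
      exact div_le_one_of_le₀ (Complex.abs_im_le_norm Q) (norm_nonneg _)
    have key : ∀ x : ℝ, 0 ≤ x → x ≤ 1 → Real.arcsin x ≤ π / 2 * x := by
      intro x h0 h1
      have := Real.mul_le_sin (x := Real.arcsin x) (Real.arcsin_nonneg.mpr h0)
        (Real.arcsin_le_pi_div_two x)
      rw [Real.sin_arcsin (by linarith) h1] at this
      have hpi := Real.pi_pos
      calc Real.arcsin x = π / 2 * (2 / π * Real.arcsin x) := by field_simp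
        _ ≤ _ := by gcongr
    rcases le_total 0 (Q.im / ‖Q‖) with h | h
    · rw [abs_of_nonneg (Real.arcsin_nonneg.mpr h), abs_of_nonneg h]
      exact key _ h ((le_abs_self _).trans hx)
    · rw [abs_of_nonpos (Real.arcsin_nonpos.mpr h), abs_of_nonpos h, ← Real.arcsin_neg]
      exact key _ (by linarith) ((neg_le_abs _).trans hx)
  have h5' : 0 ≤ b - a := by linarith
  have h4 : |Q.im / ‖Q‖| ≤ 2 * (b - a) * |z.im| / (1 + z.im ^ 2) := by
    rw [abs_div, abs_norm]
    have : |Q.im| ≤ 2 * (b - a) * |z.im| := by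
      rw [stripBase_im, abs_neg, abs_mul, abs_of_nonneg (by linarith)]
      gcongr
    exact div_le_div₀ (by positivity) this (by positivity) (hre.trans hn)
  calc |z.im| * |Real.arcsin (Q.im / ‖Q‖)|
      ≤ |z.im| * (π / 2 * (2 * (b - a) * |z.im| / (1 + z.im ^ 2))) := by
        gcongr
        exact h3.trans (by gcongr)
    _ = π * (b - a) * (z.im ^ 2 / (1 + z.im ^ 2)) := by
        rw [← sq_abs z.im]; ring
    _ ≤ π * (b - a) * 1 := by
        gcongr
        exact div_le_one_of_le₀ (by linarith) (by positivity)
    _ = _ := mul_one _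

lemma abs_log_norm_stripBase_sub_le {a b : ℝ} {z : ℂ} (h1 : a ≤ z.re) (h2 : z.re ≤ b) :
    |Real.log ‖stripBase a b z‖ / 2 - Real.log (1 + |z.im|)| ≤ Real.log (2 * (b - a + 1)) := by
  have hre := one_add_sq_le_stripBase_re h1 h2
  have hn : (stripBase a b z).re ≤ ‖stripBase a b z‖ := Complex.re_le_norm _
  have hc : 1 ≤ b - a + 1 := by linarith
  have hlow : (1 + |z.im|) ^ 2 / 2 ≤ ‖stripBase a b z‖ := by
    have : (1 + |z.im|) ^ 2 / 2 ≤ 1 + z.im ^ 2 := by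
      rw [← sq_abs z.im]; nlinarith [sq_nonneg (1 - |z.im|)]
    linarith
  have hup : ‖stripBase a b z‖ ≤ (2 * (b - a + 1)) ^ 2 * (1 + |z.im|) ^ 2 := by
    have e1 : ‖z - a‖ ≤ (b - a) + |z.im| := by
      refine (Complex.norm_le_abs_re_add_abs_im _).trans ?_
      simp only [sub_re, ofReal_re, sub_im, ofReal_im, sub_zero]
      rw [abs_of_nonneg (by linarith)]
      linarith
    have e2 : ‖stripBase a b z‖ ≤ (b - a + 1) ^ 2 + ‖z - a‖ ^ 2 := by
      unfold stripBase
      refine (norm_sub_le _ _).trans ?_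
      rw [norm_pow, norm_pow, norm_real, Real.norm_eq_abs, abs_of_nonneg (by linarith)]
    have e3 : ‖z - a‖ ^ 2 ≤ ((b - a + 1) * (1 + |z.im|)) ^ 2 := by
      gcongr
      nlinarith [abs_nonneg z.im]
    have e4 : (b - a + 1) ^ 2 ≤ ((b - a + 1) * (1 + |z.im|)) ^ 2 := by
      gcongr
      nlinarith [abs_nonneg z.im]
    nlinarith [abs_nonneg z.im, sq_nonneg ((b - a + 1) * (1 + |z.im|))]
  have hpos : 0 < ‖stripBase a b z‖ := lt_of_lt_of_le (by positivity) hlow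
  have l1 := Real.log_le_log (by positivity) hlow
  have l2 := Real.log_le_log hpos hup
  rw [Real.log_div (by positivity) (by norm_num), Real.log_pow] at l1
  rw [Real.log_mul (by positivity) (by positivity), Real.log_pow, Real.log_pow] at l2
  have l3 : Real.log 2 ≤ Real.log (2 * (b - a + 1)) := Real.log_le_log (by norm_num) (by linarith)
  have l4 : 0 ≤ Real.log 2 := Real.log_nonneg (by norm_num)
  push_cast at l1 l2
  rw [abs_le]
  constructor <;> linarith

lemma exists_abs_affine_le (a b p q : ℝ) :
    ∃ L, 0 ≤ L ∧ ∀ x, a ≤ x → x ≤ b → |p * x + q| ≤ L := by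
  refine ⟨|p| * (|a| + |b|) + |q|, by positivity, fun x h1 h2 ↦ (abs_add_le _ _).trans ?_⟩
  rw [abs_mul]
  have : |x| ≤ |a| + |b| := by
    rw [abs_le]
    constructor
    · linarith [neg_abs_le a, abs_nonneg b]
    · linarith [le_abs_self b, abs_nonneg a]
  exact add_le_add (mul_le_mul_of_nonneg_left this (abs_nonneg p)) le_rfl

lemma norm_stripWeight_bounds (a b p q : ℝ) :
    ∃ C : ℝ, 0 < C ∧ ∀ z : ℂ, a ≤ z.re → z.re ≤ b →
      (1 + |z.im|) ^ (p * z.re + q) ≤ C * ‖stripWeight a b p q z‖ ∧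
      ‖stripWeight a b p q z‖ ≤ C * (1 + |z.im|) ^ (p * z.re + q) := by
  obtain ⟨L, hL0, hL⟩ := exists_abs_affine_le a b p q
  set B := L * Real.log (2 * (b - a + 1)) + |p| * (π * (b - a)) with hB
  refine ⟨Real.exp B, Real.exp_pos _, fun z h1 h2 ↦ ?_⟩
  have hlog := abs_log_norm_stripBase_sub_le h1 h2
  have harg := abs_im_mul_arg_stripBase_le h1 h2
  have hl := hL z.re h1 h2
  have hpos : 0 < 1 + |z.im| := by positivity
  have hkey : |((p * z.re + q) * (Real.log ‖stripBase a b z‖ / 2)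
      - p * z.im * ((stripBase a b z).arg / 2)) - Real.log (1 + |z.im|) * (p * z.re + q)| ≤ B := by
    have e : ((p * z.re + q) * (Real.log ‖stripBase a b z‖ / 2)
      - p * z.im * ((stripBase a b z).arg / 2)) - Real.log (1 + |z.im|) * (p * z.re + q)
      = (p * z.re + q) * (Real.log ‖stripBase a b z‖ / 2 - Real.log (1 + |z.im|))
        - p / 2 * (z.im * (stripBase a b z).arg) := by ring
    rw [e]
    refine (abs_sub _ _).trans ?_
    rw [abs_mul, abs_mul]
    have hp2 : |p / 2| ≤ |p| := by
      rw [abs_div, abs_two]; linarith [abs_nonneg p]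
    exact add_le_add (mul_le_mul hl hlog (abs_nonneg _) hL0)
      (mul_le_mul hp2 harg (abs_nonneg _) (abs_nonneg _))
  rw [norm_stripWeight, Real.rpow_def_of_pos hpos, ← Real.exp_add, ← Real.exp_add]
  rw [abs_le] at hkey
  constructor <;> apply Real.exp_le_exp.mpr <;> linarith

/-- **Phragmén–Lindelöf convexity**: polynomial bounds on the two edges of a strip interpolate. -/
theorem exists_norm_le_of_strip_edges {f : ℂ → ℂ} {a b α β A B : ℝ} (hab : a < b)
    (hd : ∀ z : ℂ, a ≤ z.re → z.re ≤ b → DifferentiableAt ℂ f z)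
    (hgrowth : ∀ z : ℂ, a ≤ z.re → z.re ≤ b → ‖f z‖ ≤ A * Real.exp (B * |z.im|))
    {C : ℝ} (ha : ∀ z : ℂ, z.re = a → ‖f z‖ ≤ C * (1 + |z.im|) ^ α)
    (hb : ∀ z : ℂ, z.re = b → ‖f z‖ ≤ C * (1 + |z.im|) ^ β) :
    ∃ C' : ℝ, ∀ z : ℂ, a ≤ z.re → z.re ≤ b →
      ‖f z‖ ≤ C' * (1 + |z.im|) ^ (α + (β - α) * (z.re - a) / (b - a)) := by
  have hba : 0 < b - a := by linarith
  -- `-(p x + q)` is the affine function equal to `α` at `a` and to `β` at `b`, so multiplying `f`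
  -- by the weight makes it bounded on both edges.
  set p := -(β - α) / (b - a) with hp
  set q := -α - p * a with hq
  have hpq : ∀ x : ℝ, α + (β - α) * (x - a) / (b - a) = -(p * x + q) := by
    intro x
    rw [hq, hp]
    field_simp
    ring
  have hpa : p * a + q = -α := by rw [hq]; ring
  have hpb : p * b + q = -β := by
    have := hpq b
    rw [mul_div_assoc, div_self hba.ne'] at this
    linarith
  obtain ⟨K, hK, hW⟩ := norm_stripWeight_bounds a b p q
  have hC : 0 ≤ C := by
    have := (norm_nonneg _).trans (ha a (by simp))
    simpa using this
  set g : ℂ → ℂ := fun z ↦ f z * stripWeight a b p q z with hg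
  have hgd : ∀ z : ℂ, a ≤ z.re → z.re ≤ b → DifferentiableAt ℂ g z := fun z h1 h2 ↦
    (hd z h1 h2).mul (differentiableAt_stripWeight p q h1 h2)
  have hedge : ∀ (γ : ℝ) (z : ℂ), a ≤ z.re → z.re ≤ b → p * z.re + q = -γ →
      ‖f z‖ ≤ C * (1 + |z.im|) ^ γ → ‖g z‖ ≤ C * K := by
    intro γ z h1 h2 h3 h4
    rw [hg]
    simp only
    rw [norm_mul]
    have h5 := (hW z h1 h2).2
    rw [h3] at h5
    have hpos : 0 < 1 + |z.im| := by positivity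
    calc ‖f z‖ * ‖stripWeight a b p q z‖
        ≤ (C * (1 + |z.im|) ^ γ) * (K * (1 + |z.im|) ^ (-γ)) := by gcongr
      _ = C * K * ((1 + |z.im|) ^ γ * (1 + |z.im|) ^ (-γ)) := by ring
      _ = C * K := by rw [← Real.rpow_add hpos]; simp
  have hmain : ∀ z : ℂ, a ≤ z.re → z.re ≤ b → ‖g z‖ ≤ C * K := by
    intro z hz1 hz2
    refine PhragmenLindelof.vertical_strip (a := a) (b := b) (f := g) ?_ ?_ ?_ ?_ hz1 hz2
    · have hcl : closure (re ⁻¹' Set.Ioo a b) ⊆ re ⁻¹' Set.Icc a b :=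
        closure_minimal (Set.preimage_mono Set.Ioo_subset_Icc_self)
          (isClosed_Icc.preimage continuous_re)
      exact DifferentiableOn.diffContOnCl fun w hw ↦
        (hgd w (hcl hw).1 (hcl hw).2).differentiableWithinAt
    · obtain ⟨L, hL, hL'⟩ := exists_abs_affine_le a b p q
      obtain ⟨m, hm⟩ : ∃ m, m = L + |B| := ⟨_, rfl⟩
      have hm0 : 0 ≤ m := by rw [hm]; positivity
      -- Growth of finite exponential type lies far below the admissible double exponential; half
      -- the critical rate `π / (b - a)` is already enough.
      refine ⟨π / (b - a) / 2, half_lt_self (by positivity), m * (2 * (b - a) / π), ?_⟩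
      refine Asymptotics.IsBigO.of_bound (|A| * K) ?_
      refine eventually_inf_principal.mpr (Eventually.of_forall fun w hw ↦ ?_)
      have h1 := hw.1.le
      have h2 := hw.2.le
      have hl : p * w.re + q ≤ L := (le_abs_self _).trans (hL' w.re h1 h2)
      have e1 : (1 + |w.im|) ^ (p * w.re + q) ≤ Real.exp (L * |w.im|) := by
        calc (1 + |w.im|) ^ (p * w.re + q) ≤ (1 + |w.im|) ^ L :=
              Real.rpow_le_rpow_of_exponent_le (by linarith [abs_nonneg w.im]) hl
          _ ≤ (Real.exp |w.im|) ^ L := by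
              gcongr
              linarith [Real.add_one_le_exp |w.im|]
          _ = _ := by rw [← Real.exp_mul, mul_comm]
      have e2 : ‖f w‖ ≤ |A| * Real.exp (|B| * |w.im|) := by
        refine (hgrowth w h1 h2).trans ?_
        gcongr
        · exact le_abs_self A
        · exact le_abs_self B
      rw [hg]
      simp only
      rw [norm_mul, Real.norm_eq_abs, Real.abs_exp]
      calc ‖f w‖ * ‖stripWeight a b p q w‖
          ≤ (|A| * Real.exp (|B| * |w.im|)) * (K * Real.exp (L * |w.im|)) := by
            gcongr
            exact (hW w h1 h2).2.trans (by gcongr)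
        _ = |A| * K * Real.exp (m * |w.im|) := by
            rw [hm, add_mul, Real.exp_add]; ring
        _ ≤ _ := by
            rw [mul_assoc m]
            refine mul_le_mul_of_nonneg_left (Real.exp_le_exp.mpr
              (mul_le_mul_of_nonneg_left ?_ hm0)) (by positivity)
            have hpi := Real.pi_pos
            calc |w.im| = 2 * (b - a) / π * (π / (b - a) / 2 * |w.im|) := by field_simp
              _ ≤ _ := by
                gcongr
                linarith [Real.add_one_le_exp (π / (b - a) / 2 * |w.im|)]
    · intro w hw
      exact hedge α w hw.ge (hw.trans_le hab.le) (by rw [hw, hpa]) (ha w hw)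
    · intro w hw
      exact hedge β w (hab.le.trans hw.ge) hw.le (by rw [hw, hpb]) (hb w hw)
  refine ⟨C * K * K, fun z h1 h2 ↦ ?_⟩
  have h3 := hmain z h1 h2
  have h4 := (hW z h1 h2).1
  have hpos : 0 < 1 + |z.im| := by positivity
  rw [hpq, Real.rpow_neg hpos.le, ← div_eq_mul_inv, le_div_iff₀ (by positivity)]
  calc ‖f z‖ * (1 + |z.im|) ^ (p * z.re + q) ≤ ‖f z‖ * (K * ‖stripWeight a b p q z‖) := by gcongr
    _ = ‖g z‖ * K := by rw [hg]; simp only; rw [norm_mul]; ring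
    _ ≤ C * K * K := by gcongr

end KFree

namespace KFree

open MeasureTheory Filter Topology Complex Metric
open scoped ENNReal Real

/-! ### Dividing out zeros of entire functions -/

lemma exists_eq_prod_mul {f : ℂ → ℂ} (hf : Differentiable ℂ f) (S : Finset ℂ)
    (hS : ∀ a ∈ S, f a = 0) :
    ∃ g : ℂ → ℂ, Differentiable ℂ g ∧ ∀ z, f z = (∏ a ∈ S, (z - a)) * g z := by
  classical
  induction S using Finset.induction_on with
  | empty => exact ⟨f, hf, by simp⟩
  | insert a S ha ih =>
    obtain ⟨g, hg, hfg⟩ := ih fun b hb ↦ hS b (Finset.mem_insert_of_mem hb)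
    have hga : g a = 0 := by
      have := hfg a
      rw [hS a (Finset.mem_insert_self a S)] at this
      rcases mul_eq_zero.mp this.symm with h | h
      · obtain ⟨b, hb, hab⟩ := Finset.prod_eq_zero_iff.mp h
        rw [sub_eq_zero] at hab
        exact absurd (hab ▸ hb) ha
      · exact h
    refine ⟨dslope g a, ?_, fun z ↦ ?_⟩
    · rw [← differentiableOn_univ] at hg ⊢
      exact (differentiableOn_dslope univ_mem).mpr hg
    · have := sub_smul_dslope g a z
      rw [hga, sub_zero, smul_eq_mul] at this
      rw [Finset.prod_insert ha, hfg z, ← this]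
      ring

/-- A zero of `g` at `a` would make `a` a double zero of `f`. For simple zeros, one factor each
removes them all. -/
lemma ne_zero_of_eq_prod_mul {f g : ℂ → ℂ} (hg : Differentiable ℂ g) {S : Finset ℂ}
    (h : ∀ z, f z = (∏ a ∈ S, (z - a)) * g z) {a : ℂ} (ha : a ∈ S) (hd : deriv f a ≠ 0) :
    g a ≠ 0 := by
  intro hga
  apply hd
  have hf : f = fun z ↦ (∏ a ∈ S, (z - a)) * g z := funext h
  have hP : DifferentiableAt ℂ (fun z ↦ ∏ a ∈ S, (z - a)) a := by fun_prop
  rw [hf, deriv_fun_mul hP (hg a), hga, Finset.prod_eq_zero ha (sub_self a)]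
  simp

lemma norm_le_of_sphere {g : ℂ → ℂ} (hg : Differentiable ℂ g) {c : ℂ} {ρ B : ℝ} (hρ : 0 < ρ)
    (h : ∀ z ∈ sphere c ρ, ‖g z‖ ≤ B) {z : ℂ} (hz : z ∈ closedBall c ρ) : ‖g z‖ ≤ B := by
  refine Complex.norm_le_of_forall_mem_frontier_norm_le (U := ball c ρ) isBounded_ball
    hg.diffContOnCl ?_ ?_
  · rwa [frontier_ball c hρ.ne']
  · rwa [closure_ball c hρ.ne']

lemma pow_le_prod_norm_sub {S : Finset ℂ} {z : ℂ} {δ : ℝ} (hδ : 0 ≤ δ)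
    (h : ∀ a ∈ S, δ ≤ ‖z - a‖) : δ ^ S.card ≤ ‖∏ a ∈ S, (z - a)‖ := by
  rw [norm_prod, ← Finset.prod_const]
  exact Finset.prod_le_prod (fun _ _ ↦ hδ) h

lemma prod_norm_sub_le_pow {S : Finset ℂ} {z : ℂ} {δ : ℝ}
    (h : ∀ a ∈ S, ‖z - a‖ ≤ δ) : ‖∏ a ∈ S, (z - a)‖ ≤ δ ^ S.card := by
  rw [norm_prod, ← Finset.prod_const]
  exact Finset.prod_le_prod (fun _ _ ↦ norm_nonneg _) h

/-- Maximum modulus: on the circle of radius `ρ` every factor `w - a` has modulus at least `δ`. -/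
lemma norm_mul_pow_le_of_eq_prod_mul {f g : ℂ → ℂ} (hg : Differentiable ℂ g) {S : Finset ℂ}
    (h : ∀ z, f z = (∏ a ∈ S, (z - a)) * g z) {c : ℂ} {ρ δ M : ℝ} (hρ : 0 < ρ) (hδ : 0 < δ)
    (hS : ∀ a ∈ S, ‖a - c‖ ≤ ρ - δ) (hM : ∀ z ∈ closedBall c ρ, ‖f z‖ ≤ M) {z : ℂ}
    (hz : z ∈ closedBall c ρ) : ‖g z‖ ≤ M / δ ^ S.card := by
  refine norm_le_of_sphere hg hρ (fun w hw ↦ ?_) hz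
  rw [le_div_iff₀ (by positivity)]
  have h1 := hM w (sphere_subset_closedBall hw)
  rw [h w, norm_mul, mul_comm] at h1
  refine le_trans ?_ h1
  gcongr
  refine pow_le_prod_norm_sub hδ.le fun a ha ↦ ?_
  rw [mem_sphere_iff_norm] at hw
  have h2 : ‖w - c‖ ≤ ‖w - a‖ + ‖a - c‖ := by
    simpa using norm_add_le (w - a) (a - c)
  linarith [hS a ha]

/-- An upper bound for the number of zeros in a disc. -/
theorem two_pow_card_mul_norm_le {f : ℂ → ℂ} (hf : Differentiable ℂ f) {c : ℂ} {r M : ℝ}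
    (hr : 0 < r) (hM : ∀ z ∈ closedBall c (3 * r), ‖f z‖ ≤ M) {S : Finset ℂ}
    (hS : ∀ a ∈ S, f a = 0) (hSr : ∀ a ∈ S, ‖a - c‖ ≤ r) : 2 ^ S.card * ‖f c‖ ≤ M := by
  obtain ⟨g, hg, hfg⟩ := exists_eq_prod_mul hf S hS
  -- On the circle of radius `3r` each factor is at least `2r`, and at the centre at most `r`; this
  -- gains a factor `2` per zero.
  have h1 := norm_mul_pow_le_of_eq_prod_mul hg hfg (c := c) (ρ := 3 * r) (δ := 2 * r)
    (by positivity) (by positivity) (fun a ha ↦ by linarith [hSr a ha]) hM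
    (mem_closedBall_self (by positivity))
  rw [hfg c, norm_mul]
  have h2 : ‖∏ a ∈ S, (c - a)‖ ≤ r ^ S.card :=
    prod_norm_sub_le_pow fun a ha ↦ by rw [norm_sub_rev]; exact hSr a ha
  rw [le_div_iff₀ (by positivity), mul_pow] at h1
  calc 2 ^ S.card * (‖∏ a ∈ S, (c - a)‖ * ‖g c‖) ≤ 2 ^ S.card * (r ^ S.card * ‖g c‖) := by gcongr
    _ = ‖g c‖ * (2 ^ S.card * r ^ S.card) := by ring
    _ ≤ M := h1

/-- On a disc free of zeros, `g = g(c) exp L` with `L` a primitive of `g'/g`. Since `re L ≤ Λ` and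
`L c = 0`, Borel–Carathéodory bounds `|L|`, hence `re L` from below. -/
lemma norm_lower_bound_of_zero_free {g : ℂ → ℂ} (hg : Differentiable ℂ g) {c : ℂ} {R Λ : ℝ}
    (hR : 0 < R) (hΛ : 0 < Λ) (hne : ∀ z ∈ ball c R, g z ≠ 0)
    (hup : ∀ z ∈ ball c R, ‖g z‖ ≤ ‖g c‖ * Real.exp Λ) {z : ℂ} (hz : z ∈ ball c R) :
    ‖g c‖ * Real.exp (-(2 * Λ * ‖z - c‖ / (R - ‖z - c‖))) ≤ ‖g z‖ := by
  have hcb : c ∈ ball c R := mem_ball_self hR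
  have hdq : DifferentiableOn ℂ (fun z ↦ deriv g z / g z) (ball c R) := by
    refine DifferentiableOn.div ?_ hg.differentiableOn hne
    exact (hg.differentiableOn (s := ball c R)).deriv isOpen_ball
  obtain ⟨L, hLc, hL⟩ := hdq.isExactOn_ball.with_val_at c 0
  have hconst : ∀ w ∈ ball c R, g w * cexp (-(L w)) = g c := by
    intro w hw
    have hder : ∀ x ∈ ball c R, HasDerivAt (fun x ↦ g x * cexp (-(L x))) 0 x := by
      intro x hx
      have h1 := (hg x).hasDerivAt.fun_mul ((hL x hx).fun_neg.cexp)
      refine h1.congr_deriv ?_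
      have e : deriv g x / g x * g x = deriv g x := div_mul_cancel₀ _ (hne x hx)
      linear_combination -(cexp (-(L x))) * e
    have hconv := (convex_ball c R).is_const_of_fderivWithin_eq_zero (𝕜 := ℂ)
      (f := fun x ↦ g x * cexp (-(L x)))
      (fun x hx ↦ (hder x hx).differentiableAt.differentiableWithinAt) (fun x hx ↦ by
        rw [fderivWithin_of_isOpen isOpen_ball hx]
        ext
        simpa using (hder x hx).deriv) hw hcb
    simpa [hLc] using hconv
  have hgw : ∀ w ∈ ball c R, ‖g w‖ = ‖g c‖ * Real.exp (L w).re := by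
    intro w hw
    rw [← hconst w hw, norm_mul, Complex.norm_exp, mul_assoc, ← Real.exp_add]
    simp
  have hgc : 0 < ‖g c‖ := norm_pos_iff.mpr (hne c hcb)
  have hBC := Complex.borelCaratheodory_zero (f := fun u ↦ L (c + u)) (M := Λ) (R := R)
    (z := z - c) hΛ ?_ ?_ hR ?_ ?_
  · rw [hgw z hz]
    gcongr
    simp only [add_sub_cancel] at hBC
    linarith [neg_abs_le (L z).re, Complex.abs_re_le_norm (L z)]
  · intro u hu
    have hu' : c + u ∈ ball c R := by simpa using hu
    exact ((hL _ hu').differentiableAt.comp u (by fun_prop)).differentiableWithinAt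
  · intro u hu
    have hu' : c + u ∈ ball c R := by simpa using hu
    have h1 := hup _ hu'
    rw [hgw _ hu'] at h1
    exact Real.exp_le_exp.mp (le_of_mul_le_mul_left h1 hgc)
  · rw [mem_ball_zero_iff]
    exact mem_ball_iff_norm.mp hz
  · simpa using hLc

/-- A holomorphic quotient of two entire functions is bounded in terms of bounds for the numerator
and the denominator, and of one value of the denominator. -/
theorem norm_quotient_le {f H Q : ℂ → ℂ} (hf : Differentiable ℂ f) (hH : Differentiable ℂ H)
    {c : ℂ} {r R M : ℝ} (hr : 0 ≤ r) (hrR : r < R)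
    (hfM : ∀ z ∈ closedBall c (2 * R), ‖f z‖ ≤ M) (hHM : ∀ z ∈ closedBall c (2 * R), ‖H z‖ ≤ M)
    {S : Finset ℂ} (hS : ∀ a ∈ S, f a = 0 ∧ H a = 0 ∧ deriv f a ≠ 0 ∧ a ∈ ball c R)
    (hS' : ∀ a ∈ ball c R, f a = 0 → a ∈ S) (hfc : f c ≠ 0)
    (hQc : ContinuousOn Q (ball c R)) (hQ : ∀ z ∈ ball c R, H z = Q z * f z)
    {z : ℂ} (hz : z ∈ closedBall c r) :
    ‖Q z‖ ≤ (2 * M / ‖f c‖) ^ (1 + 2 * r / (R - r)) := by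
  have hR : 0 < R := hr.trans_lt hrR
  -- The zeros of `f` in the smaller disc are divided out of both functions. Numerator and
  -- denominator pay the same power of `R`, so the number of zeros disappears from the final bound.
  obtain ⟨g, hg, hfg⟩ := exists_eq_prod_mul hf S fun a ha ↦ (hS a ha).1
  obtain ⟨h, hh, hHh⟩ := exists_eq_prod_mul hH S fun a ha ↦ (hS a ha).2.1
  have hSR : ∀ a ∈ S, ‖a - c‖ ≤ 2 * R - R := by
    intro a ha
    have := (hS a ha).2.2.2
    rw [mem_ball_iff_norm] at this
    linarith
  have hgM : ∀ z ∈ closedBall c (2 * R), ‖g z‖ ≤ M / R ^ S.card := fun z hz ↦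
    norm_mul_pow_le_of_eq_prod_mul hg hfg (by positivity) hR hSR hfM hz
  have hhM : ∀ z ∈ closedBall c (2 * R), ‖h z‖ ≤ M / R ^ S.card := fun z hz ↦
    norm_mul_pow_le_of_eq_prod_mul hh hHh (by positivity) hR hSR hHM hz
  have hsub : ball c R ⊆ closedBall c (2 * R) :=
    ball_subset_closedBall.trans (closedBall_subset_closedBall (by linarith))
  have hgne : ∀ z ∈ ball c R, g z ≠ 0 := by
    intro z hz hgz
    have hfz : f z = 0 := by rw [hfg z, hgz, mul_zero]
    have hzS := hS' z hz hfz
    exact ne_zero_of_eq_prod_mul hg hfg hzS (hS z hzS).2.2.1 hgz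
  have hcb : c ∈ ball c R := mem_ball_self hR
  have hfcpos : 0 < ‖f c‖ := norm_pos_iff.mpr hfc
  have hMf : ‖f c‖ ≤ M := hfM c (hsub hcb)
  have hMpos : 0 < M := hfcpos.trans_le hMf
  have hgc : ‖f c‖ / R ^ S.card ≤ ‖g c‖ := by
    rw [div_le_iff₀ (by positivity), hfg c, norm_mul, mul_comm]
    gcongr
    refine prod_norm_sub_le_pow fun a ha ↦ ?_
    rw [norm_sub_rev]
    linarith [hSR a ha]
  -- The factor `2` makes `Λ` strictly positive, as Borel–Carathéodory requires.
  set Λ := Real.log (2 * M / ‖f c‖) with hΛ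
  have hq : 1 < 2 * M / ‖f c‖ := by rw [one_lt_div hfcpos]; linarith
  have hΛpos : 0 < Λ := Real.log_pos hq
  have hexp : Real.exp Λ = 2 * M / ‖f c‖ := Real.exp_log (by linarith)
  have hup : ∀ z ∈ ball c R, ‖g z‖ ≤ ‖g c‖ * Real.exp Λ := by
    intro z hz
    rw [hexp]
    calc ‖g z‖ ≤ M / R ^ S.card := hgM z (hsub hz)
      _ ≤ 2 * M / R ^ S.card := by gcongr; linarith
      _ = ‖f c‖ / R ^ S.card * (2 * M / ‖f c‖) := by field_simp
      _ ≤ _ := by gcongr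
  have hQh : ∀ z ∈ ball c R, h z = Q z * g z := by
    -- The relation between `H`, `Q` and `f` says nothing about `Q` at zeros of `f`; continuity of
    -- `Q` and density of their complement supply it there.
    have hEq : Set.EqOn h (fun z ↦ Q z * g z) (ball c R) := by
      have hdense : ball c R ⊆ closure (ball c R \ (S : Set ℂ)) := by
        have h1 : Dense ((S : Set ℂ)ᶜ) := S.finite_toSet.countable.dense_compl ℂ
        exact h1.open_subset_closure_inter isOpen_ball
      refine Set.EqOn.of_subset_closure (s := ball c R \ (S : Set ℂ)) ?_
        hh.continuous.continuousOn (hQc.mul hg.continuous.continuousOn) Set.sdiff_subset hdense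
      intro w hw
      have h2 := hQ w hw.1
      rw [hHh w, hfg w] at h2
      have h3 : (∏ a ∈ S, (w - a)) ≠ 0 := Finset.prod_ne_zero_iff.mpr fun a ha h ↦ by
        rw [sub_eq_zero] at h
        exact hw.2 (h ▸ ha)
      apply mul_left_cancel₀ h3
      rw [h2]
      ring
    exact hEq
  have hzr : ‖z - c‖ ≤ r := mem_closedBall_iff_norm.mp hz
  have hzb : z ∈ ball c R := by rw [mem_ball_iff_norm]; linarith
  have hlow := norm_lower_bound_of_zero_free hg hR hΛpos hgne hup hzb
  have hfrac : 2 * Λ * ‖z - c‖ / (R - ‖z - c‖) ≤ Λ * (2 * r / (R - r)) := by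
    have e : Λ * (2 * r / (R - r)) = 2 * Λ * r / (R - r) := by ring
    rw [e]
    have : 0 < R - r := by linarith
    gcongr
  have hgz : 0 < ‖g z‖ := norm_pos_iff.mpr (hgne z hzb)
  have h5 : ‖Q z‖ * ‖g z‖ ≤ M / R ^ S.card := by
    rw [← norm_mul, ← hQh z hzb]
    exact hhM z (hsub hzb)
  rw [Real.rpow_add (by linarith), Real.rpow_one, Real.rpow_def_of_pos (by linarith), ← hΛ]
  have h6 : ‖f c‖ / R ^ S.card * Real.exp (-(Λ * (2 * r / (R - r)))) ≤ ‖g z‖ := by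
    refine le_trans ?_ hlow
    gcongr
  have h7 : ‖Q z‖ * (‖f c‖ / R ^ S.card * Real.exp (-(Λ * (2 * r / (R - r))))) ≤ M / R ^ S.card :=
    le_trans (by gcongr) h5
  rw [Real.exp_neg] at h7
  have hE := Real.exp_pos (Λ * (2 * r / (R - r)))
  have hRn : 0 < R ^ S.card := by positivity
  have h8 : ‖Q z‖ ≤ M / ‖f c‖ * Real.exp (Λ * (2 * r / (R - r))) := by
    rw [← mul_le_mul_iff_left₀ (show 0 < ‖f c‖ / R ^ S.card * (Real.exp (Λ * (2 * r / (R - r))))⁻¹ by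
      positivity)]
    refine h7.trans (le_of_eq ?_)
    field_simp
  refine h8.trans ?_
  gcongr
  linarith

end KFree

namespace KFree

open MeasureTheory Filter Topology Complex Metric
open scoped ENNReal Real

/-! ### The zeta function in the right half plane -/

/-- The fractional part on `(1, ∞)`, extended by zero. -/
noncomputable def fractTail : ℝ → ℂ := Set.indicator (Set.Ioi 1) fun x ↦ ((Int.fract x : ℝ) : ℂ)

lemma norm_fractTail_le (x : ℝ) : ‖fractTail x‖ ≤ 1 := by
  unfold fractTail
  refine (norm_indicator_le_norm_self _ _).trans ?_
  rw [norm_real, Real.norm_eq_abs, abs_of_nonneg (Int.fract_nonneg x)]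
  exact (Int.fract_lt_one x).le

lemma measurable_fractTail : Measurable fractTail :=
  (measurable_ofReal.comp measurable_fract).indicator measurableSet_Ioi

lemma mellin_fractTail (s : ℂ) :
    mellin fractTail (-s) = ∫ x in Set.Ioi (1 : ℝ), ((Int.fract x : ℝ) : ℂ) * (x : ℂ) ^ (-(s + 1)) := by
  rw [mellin]
  have h : ∀ x : ℝ, (x : ℂ) ^ (-s - 1) • fractTail x = Set.indicator (Set.Ioi 1)
      (fun x : ℝ ↦ ((Int.fract x : ℝ) : ℂ) * (x : ℂ) ^ (-(s + 1))) x := by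
    intro x
    unfold fractTail
    by_cases hx : x ∈ Set.Ioi (1 : ℝ)
    · rw [Set.indicator_of_mem hx, Set.indicator_of_mem hx, smul_eq_mul, mul_comm]
      ring_nf
    · rw [Set.indicator_of_notMem hx, Set.indicator_of_notMem hx, smul_zero]
  simp_rw [h]
  rw [setIntegral_indicator measurableSet_Ioi]
  congr 2
  ext x
  simp only [Set.mem_inter_iff, Set.mem_Ioi]
  exact ⟨fun h ↦ h.2, fun h ↦ ⟨by linarith, h⟩⟩

lemma norm_mellin_fractTail_le {s : ℂ} (hs : 0 < s.re) : ‖mellin fractTail (-s)‖ ≤ 1 / s.re := by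
  rw [mellin_fractTail]
  have hint : IntegrableOn (fun x : ℝ ↦ x ^ (-(s.re + 1))) (Set.Ioi 1) :=
    integrableOn_Ioi_rpow_of_lt (by linarith) one_pos
  have hval : ∫ x in Set.Ioi (1 : ℝ), x ^ (-(s.re + 1)) = 1 / s.re := by
    rw [integral_Ioi_rpow_of_lt (by linarith) one_pos]
    simp only [Real.one_rpow]
    rw [show -(s.re + 1) + 1 = -s.re by ring, neg_div_neg_eq]
  rw [← hval]
  refine norm_integral_le_of_norm_le hint ?_
  filter_upwards [ae_restrict_mem measurableSet_Ioi] with x hx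
  have hx0 : (0 : ℝ) < x := lt_trans one_pos hx
  rw [norm_mul, norm_real, Real.norm_eq_abs, abs_of_nonneg (Int.fract_nonneg x),
    norm_cpow_eq_rpow_re_of_pos hx0]
  simp only [neg_re, add_re, one_re]
  exact mul_le_of_le_one_left (by positivity) (Int.fract_lt_one x).le

lemma differentiableAt_mellin_fractTail {s : ℂ} (hs : 0 < s.re) :
    DifferentiableAt ℂ (fun s ↦ mellin fractTail (-s)) s := by
  have h : DifferentiableAt ℂ (mellin fractTail) (-s) := by
    refine mellin_differentiableAt_of_isBigO_rpow (a := 0) (b := -s.re - 1) ?_ ?_ (by simpa) ?_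
      (by simp)
    · refine LocallyIntegrable.locallyIntegrableOn ?_ _
      refine (locallyIntegrable_const (1 : ℝ)).mono measurable_fractTail.aestronglyMeasurable ?_
      filter_upwards with x
      simpa using norm_fractTail_le x
    · refine Asymptotics.IsBigO.of_bound 1 (Eventually.of_forall fun x ↦ ?_)
      simpa using norm_fractTail_le x
    · refine Asymptotics.IsBigO.of_bound 1 ?_
      have : ∀ᶠ x in 𝓝[>] (0 : ℝ), x < 1 := nhdsWithin_le_nhds (gt_mem_nhds one_pos)
      filter_upwards [this] with x hx
      rw [fractTail, Set.indicator_of_notMem (by simpa using hx.le), norm_zero]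
      positivity
  exact h.comp s differentiableAt_id.neg

/-- Partial summation gives `ζ(s) = s ∫ ⌊t⌋ t^(-s-1) dt`; splitting `⌊t⌋ = t - {t}` isolates the
pole, which the factor `s - 1` in `riemannZeta₁` removes. -/
lemma riemannZeta₁_eq_of_one_lt_re {s : ℂ} (hs : 1 < s.re) :
    riemannZeta₁ s = s - s * (s - 1) * mellin fractTail (-s) := by
  have hs1 : s ≠ 1 := by rintro rfl; simp at hs
  have hs1' : s - 1 ≠ 0 := sub_ne_zero.mpr hs1
  have h1 := LSeries_eq_mul_integral (1 : ℕ → ℂ) (r := 1) zero_le_one hs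
    (LSeriesSummable_one_iff.mpr hs) (by
      refine Asymptotics.IsBigO.of_bound 1 (Eventually.of_forall fun n ↦ ?_)
      simp)
  rw [LSeries_one_eq_riemannZeta hs, riemannZeta_eq_inv_sub_mul hs1] at h1
  have hre : (-s).re < -1 := by simpa using hs
  have hre2 : (-(s + 1)).re < -1 := by simp; linarith
  have h2 : ∫ t in Set.Ioi (1 : ℝ), (∑ k ∈ Finset.Icc 1 ⌊t⌋₊, (1 : ℕ → ℂ) k) * (t : ℂ) ^ (-(s + 1))
      = (∫ t in Set.Ioi (1 : ℝ), (t : ℂ) ^ (-s)) -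
        ∫ x in Set.Ioi (1 : ℝ), ((Int.fract x : ℝ) : ℂ) * (x : ℂ) ^ (-(s + 1)) := by
    rw [← integral_sub (integrableOn_Ioi_cpow_of_lt hre one_pos)]
    · refine setIntegral_congr_fun measurableSet_Ioi fun t ht ↦ ?_
      have ht0 : (0 : ℝ) < t := lt_trans one_pos ht
      have e1 : (t : ℂ) ^ (-s) = t * (t : ℂ) ^ (-(s + 1)) := by
        rw [show -s = 1 + -(s + 1) by ring, cpow_add _ _ (by exact_mod_cast ht0.ne'), cpow_one]
      have e2 : ((⌊t⌋₊ : ℕ) : ℂ) = t - ((Int.fract t : ℝ) : ℂ) := by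
        have h3 : ((⌊t⌋₊ : ℕ) : ℝ) = t - Int.fract t := by
          rw [natCast_floor_eq_intCast_floor ht0.le]
          linarith [Int.floor_add_fract t]
        exact_mod_cast congrArg (fun x : ℝ ↦ (x : ℂ)) h3
      simp only [Pi.one_apply, Finset.sum_const, Nat.card_Icc, add_tsub_cancel_right,
        nsmul_eq_mul, mul_one, e1, e2]
      ring
    · refine Integrable.mono' (g := fun x : ℝ ↦ ‖(x : ℂ) ^ (-(s + 1))‖)
        (integrableOn_Ioi_cpow_of_lt hre2 one_pos).norm ?_ ?_
      · exact ((measurable_ofReal.comp measurable_fract).aestronglyMeasurable).mul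
          (integrableOn_Ioi_cpow_of_lt hre2 one_pos).aestronglyMeasurable
      · filter_upwards with x
        rw [norm_mul, norm_real, Real.norm_eq_abs, abs_of_nonneg (Int.fract_nonneg x)]
        exact mul_le_of_le_one_left (norm_nonneg _) (Int.fract_lt_one x).le
  rw [h2, integral_Ioi_cpow_of_lt hre one_pos, ← mellin_fractTail] at h1
  simp only [ofReal_one, one_cpow] at h1
  have e3 : -1 / (-s + 1) = (s - 1)⁻¹ := by
    rw [show -s + 1 = -(s - 1) by ring, neg_div_neg_eq, one_div]
  rw [e3] at h1
  calc riemannZeta₁ s = (s - 1) * ((s - 1)⁻¹ * riemannZeta₁ s) := by field_simp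
    _ = (s - 1) * (s * ((s - 1)⁻¹ - mellin fractTail (-s))) := by rw [h1]
    _ = _ := by field_simp

/-- A formula for `(s - 1) ζ(s)` in the right half plane. -/
theorem riemannZeta₁_eq {s : ℂ} (hs : 0 < s.re) :
    riemannZeta₁ s = s - s * (s - 1) * mellin fractTail (-s) := by
  have hopen : IsOpen {s : ℂ | 0 < s.re} := isOpen_lt continuous_const continuous_re
  have h1 : AnalyticOnNhd ℂ riemannZeta₁ {s : ℂ | 0 < s.re} :=
    differentiable_riemannZeta₁.differentiableOn.analyticOnNhd hopen
  have h2 : AnalyticOnNhd ℂ (fun s ↦ s - s * (s - 1) * mellin fractTail (-s)) {s : ℂ | 0 < s.re} := by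
    refine DifferentiableOn.analyticOnNhd (fun z hz ↦ ?_) hopen
    have := differentiableAt_mellin_fractTail hz
    exact DifferentiableAt.differentiableWithinAt (by fun_prop)
  have h3 := h1.eqOn_of_preconnected_of_eventuallyEq h2
    (convex_halfSpace_re_gt 0).isPreconnected (z₀ := 2) (by simp) (by
      have : {s : ℂ | 1 < s.re} ∈ 𝓝 (2 : ℂ) :=
        (isOpen_lt continuous_const continuous_re).mem_nhds (by simp)
      filter_upwards [this] with z hz
      exact riemannZeta₁_eq_of_one_lt_re hz)
  exact h3 hs

/-- At `s = 1/2` the formula for `riemannZeta₁` is `1/2` plus a nonnegative integral. Under RH this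
excludes real nontrivial zeros, so these zeros are exactly the ones off the real axis. -/
theorem riemannZeta_half_ne_zero : riemannZeta (1 / 2) ≠ 0 := by
  intro h
  have h1 : riemannZeta₁ (1 / 2) = 0 := by
    have := riemannZeta_eq_inv_sub_mul (s := 1 / 2) (by norm_num)
    rw [h] at this
    rcases mul_eq_zero.mp this.symm with h2 | h2
    · norm_num at h2
    · exact h2
  rw [riemannZeta₁_eq (by norm_num), mellin_fractTail] at h1
  have h2 : (∫ x in Set.Ioi (1 : ℝ), ((Int.fract x : ℝ) : ℂ) * (x : ℂ) ^ (-((1 / 2 : ℂ) + 1)))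
      = ((∫ x in Set.Ioi (1 : ℝ), Int.fract x * x ^ (-((1 / 2 : ℝ) + 1)) : ℝ) : ℂ) := by
    rw [← integral_complex_ofReal]
    refine setIntegral_congr_fun measurableSet_Ioi fun x hx ↦ ?_
    have hx0 : (0 : ℝ) < x := lt_trans one_pos hx
    push_cast [ofReal_cpow hx0.le]
    rfl
  have h3 : 0 ≤ ∫ x in Set.Ioi (1 : ℝ), Int.fract x * x ^ (-((1 / 2 : ℝ) + 1)) := by
    refine setIntegral_nonneg measurableSet_Ioi fun x hx ↦ ?_
    have hx0 : (0 : ℝ) < x := lt_trans one_pos hx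
    exact mul_nonneg (Int.fract_nonneg x) (by positivity)
  rw [h2] at h1
  have h4 := congrArg Complex.re h1
  have e : (1 / 2 - 1 / 2 * (1 / 2 - 1) *
      ((∫ x in Set.Ioi (1 : ℝ), Int.fract x * x ^ (-((1 / 2 : ℝ) + 1)) : ℝ) : ℂ) : ℂ)
      = ((1 / 2 + 1 / 4 * (∫ x in Set.Ioi (1 : ℝ), Int.fract x * x ^ (-((1 / 2 : ℝ) + 1))) : ℝ) : ℂ) := by
    push_cast
    ring
  rw [e, ofReal_re, zero_re] at h4
  linarith

lemma norm_riemannZeta₁_le {s : ℂ} (hs : 1 / 2 ≤ s.re) :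
    ‖riemannZeta₁ s‖ ≤ ‖s‖ + 2 * ‖s‖ * ‖s - 1‖ := by
  rw [riemannZeta₁_eq (by linarith)]
  refine (norm_sub_le _ _).trans ?_
  rw [norm_mul, norm_mul]
  have h := norm_mellin_fractTail_le (s := s) (by linarith)
  have h2 : 1 / s.re ≤ 2 := by
    rw [div_le_iff₀ (by linarith)]; linarith
  have : ‖s‖ * ‖s - 1‖ * ‖mellin fractTail (-s)‖ ≤ ‖s‖ * ‖s - 1‖ * 2 := by
    gcongr
    exact h.trans h2
  linarith

/-- One constant serves all coefficients bounded by `1`: it is applied to `1` for `ζ` and to the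
Möbius function for `1/ζ`. -/
lemma exists_norm_LSeries_le {σ : ℝ} (hσ : 1 < σ) :
    ∃ C : ℝ, 0 < C ∧ ∀ f : ℕ → ℂ, (∀ n, ‖f n‖ ≤ 1) → ∀ s : ℂ, σ ≤ s.re → ‖LSeries f s‖ ≤ C := by
  have hsum : LSeriesSummable 1 (σ : ℂ) := LSeriesSummable_one_iff.mpr (by simpa using hσ)
  refine ⟨∑' n, ‖LSeries.term 1 (σ : ℂ) n‖ + 1, by positivity, fun f hf s hs ↦ ?_⟩
  have hle : ∀ n, ‖LSeries.term f s n‖ ≤ ‖LSeries.term 1 (σ : ℂ) n‖ := by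
    intro n
    refine (LSeries.norm_term_le (g := 1) s (by simpa using hf n)).trans ?_
    exact LSeries.norm_term_le_of_re_le_re 1 (by simpa using hs) n
  have h2 : Summable fun n ↦ ‖LSeries.term f s n‖ :=
    Summable.of_nonneg_of_le (fun _ ↦ norm_nonneg _) hle hsum.norm
  calc ‖LSeries f s‖ ≤ ∑' n, ‖LSeries.term f s n‖ := norm_tsum_le_tsum_norm h2
    _ ≤ ∑' n, ‖LSeries.term 1 (σ : ℂ) n‖ := h2.tsum_le_tsum hle hsum.norm
    _ ≤ _ := by linarith

/-- The zeta function and its inverse are bounded to the right of `re s = 1`. -/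
lemma exists_norm_riemannZeta_le {σ : ℝ} (hσ : 1 < σ) :
    ∃ C : ℝ, 0 < C ∧ ∀ s : ℂ, σ ≤ s.re → ‖riemannZeta s‖ ≤ C ∧ 1 ≤ C * ‖riemannZeta s‖ := by
  obtain ⟨C, hC0, hC⟩ := exists_norm_LSeries_le hσ
  refine ⟨C, hC0, fun s hs ↦ ?_⟩
  have hs1 : 1 < s.re := by linarith
  constructor
  · rw [← LSeries_one_eq_riemannZeta hs1]
    exact hC 1 (by simp) s hs
  · have h1 := ArithmeticFunction.LSeries_zeta_mul_Lseries_moebius hs1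
    rw [ArithmeticFunction.LSeries_zeta_eq_riemannZeta hs1] at h1
    have h2 := hC (fun n ↦ (ArithmeticFunction.moebius n : ℂ)) (fun n ↦ by
      rw [norm_intCast]
      exact_mod_cast ArithmeticFunction.abs_moebius_le_one) s hs
    have h3 := congrArg norm h1
    rw [norm_mul, norm_one] at h3
    rw [← h3, mul_comm]
    gcongr

end KFree

namespace KFree

open MeasureTheory Filter Topology Complex Metric
open scoped ENNReal Real

/-! ### The factor of the functional equation -/

/-- The factor `cos (π s / 2) Γ(s)` of the functional equation. -/
noncomputable def feFactor (s : ℂ) : ℂ := Complex.cos (π * s / 2) * Complex.Gamma s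

lemma feFactor_conj (s : ℂ) : feFactor ((starRingEnd ℂ) s) = (starRingEnd ℂ) (feFactor s) := by
  simp only [feFactor, map_mul, ← Complex.Gamma_conj, ← Complex.cos_conj, map_div₀, conj_ofReal,
    Complex.conj_ofNat]

lemma norm_feFactor_sq (s : ℂ) :
    ((‖feFactor s‖ ^ 2 : ℝ) : ℂ) = feFactor s * feFactor ((starRingEnd ℂ) s) := by
  rw [feFactor_conj, Complex.mul_conj, Complex.normSq_eq_norm_sq]

lemma Gamma_one_add_mul_Gamma_one_sub {z : ℂ} (hz : z ≠ 0) :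
    Complex.Gamma (1 + z) * Complex.Gamma (1 - z) = π * z / Complex.sin (π * z) := by
  rw [add_comm, Complex.Gamma_add_one z hz, mul_assoc, Complex.Gamma_mul_Gamma_one_sub]
  ring

lemma sinh_ne_zero {x : ℝ} (hx : x ≠ 0) : Real.sinh x ≠ 0 := by
  rwa [Ne, Real.sinh_eq_zero]

/-- Since `feFactor` commutes with conjugation, `|F(s)|² = F(s) F(conj s)`, and on `re s = 1` the
reflection formula evaluates the product of Gamma values. The exact modulus replaces Stirling's
formula. -/
lemma norm_feFactor_one_add_mul_I_sq {t : ℝ} (ht : t ≠ 0) :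
    ‖feFactor (1 + t * I)‖ ^ 2
      = π * t / 2 * (Real.sinh (π * t / 2) / Real.cosh (π * t / 2)) := by
  have hz : (t * I : ℂ) ≠ 0 := by simp [ht]
  have hx : π * t / 2 ≠ 0 := by simp [ht, Real.pi_ne_zero]
  have hs : Complex.sinh ((π * t / 2 : ℝ) : ℂ) ≠ 0 := by
    rw [← ofReal_sinh]; exact_mod_cast sinh_ne_zero hx
  have hc : Complex.cosh ((π * t / 2 : ℝ) : ℂ) ≠ 0 := by
    rw [← ofReal_cosh]; exact_mod_cast (Real.cosh_pos _).ne'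
  apply Complex.ofReal_injective
  rw [norm_feFactor_sq]
  have hconj : (starRingEnd ℂ) (1 + t * I) = 1 - t * I := by
    simp [sub_eq_add_neg]
  rw [hconj, feFactor, feFactor]
  set x : ℝ := π * t / 2 with hxdef
  have e1 : Complex.cos (π * (1 + t * I) / 2) = -(Complex.sinh x * I) := by
    rw [show (π * (1 + t * I) / 2 : ℂ) = x * I + π / 2 by rw [hxdef]; push_cast; ring,
      Complex.cos_add_pi_div_two, Complex.sin_mul_I]
  have e2 : Complex.cos (π * (1 - t * I) / 2) = Complex.sinh x * I := by
    rw [show (π * (1 - t * I) / 2 : ℂ) = π / 2 - x * I by rw [hxdef]; push_cast; ring,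
      Complex.cos_pi_div_two_sub, Complex.sin_mul_I]
  have e3 : Complex.sin (π * (t * I)) = 2 * (Complex.sinh x * I) * Complex.cosh x := by
    rw [show (π * (t * I) : ℂ) = 2 * (x * I) by rw [hxdef]; push_cast; ring,
      Complex.sin_two_mul, Complex.sin_mul_I, Complex.cos_mul_I]
  have e4 := Gamma_one_add_mul_Gamma_one_sub hz
  rw [e3, show (π * (t * I) : ℂ) = 2 * x * I by rw [hxdef]; push_cast; ring] at e4
  rw [e1, e2]
  calc -(Complex.sinh x * I) * Complex.Gamma (1 + t * I) *
        (Complex.sinh x * I * Complex.Gamma (1 - t * I))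
      = -(Complex.sinh x * I) * (Complex.sinh x * I) *
        (Complex.Gamma (1 + t * I) * Complex.Gamma (1 - t * I)) := by ring
    _ = -(I * I) * (x * (Complex.sinh x / Complex.cosh x)) := by
        rw [e4]
        field_simp
    _ = _ := by rw [I_mul_I]; push_cast; ring

lemma norm_feFactor_two_add_mul_I_sq {t : ℝ} (ht : t ≠ 0) :
    ‖feFactor (2 + t * I)‖ ^ 2
      = (1 + t ^ 2) * (π * t / 2 * (Real.cosh (π * t / 2) / Real.sinh (π * t / 2))) := by
  have hz : (t * I : ℂ) ≠ 0 := by simp [ht]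
  have hx : π * t / 2 ≠ 0 := by simp [ht, Real.pi_ne_zero]
  have hs : Complex.sinh ((π * t / 2 : ℝ) : ℂ) ≠ 0 := by
    rw [← ofReal_sinh]; exact_mod_cast sinh_ne_zero hx
  have hc : Complex.cosh ((π * t / 2 : ℝ) : ℂ) ≠ 0 := by
    rw [← ofReal_cosh]; exact_mod_cast (Real.cosh_pos _).ne'
  apply Complex.ofReal_injective
  rw [norm_feFactor_sq]
  have hconj : (starRingEnd ℂ) (2 + t * I) = 2 - t * I := by
    simp [sub_eq_add_neg, Complex.conj_ofNat]
  rw [hconj, feFactor, feFactor]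
  set x : ℝ := π * t / 2 with hxdef
  have e1 : Complex.cos (π * (2 + t * I) / 2) = -Complex.cosh x := by
    rw [show (π * (2 + t * I) / 2 : ℂ) = x * I + π by rw [hxdef]; push_cast; ring,
      Complex.cos_add_pi, Complex.cos_mul_I]
  have e2 : Complex.cos (π * (2 - t * I) / 2) = -Complex.cosh x := by
    rw [show (π * (2 - t * I) / 2 : ℂ) = π - x * I by rw [hxdef]; push_cast; ring,
      Complex.cos_pi_sub, Complex.cos_mul_I]
  have e3 : Complex.sin (π * (t * I)) = 2 * (Complex.sinh x * I) * Complex.cosh x := by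
    rw [show (π * (t * I) : ℂ) = 2 * (x * I) by rw [hxdef]; push_cast; ring,
      Complex.sin_two_mul, Complex.sin_mul_I, Complex.cos_mul_I]
  have e4 := Gamma_one_add_mul_Gamma_one_sub hz
  rw [e3, show (π * (t * I) : ℂ) = 2 * x * I by rw [hxdef]; push_cast; ring] at e4
  have n1 : (1 + t * I : ℂ) ≠ 0 := fun h ↦ by simpa using congrArg re h
  have n2 : (1 - t * I : ℂ) ≠ 0 := fun h ↦ by simpa using congrArg re h
  have e5 : Complex.Gamma (2 + t * I) = (1 + t * I) * Complex.Gamma (1 + t * I) := by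
    rw [← Complex.Gamma_add_one _ n1]; ring_nf
  have e6 : Complex.Gamma (2 - t * I) = (1 - t * I) * Complex.Gamma (1 - t * I) := by
    rw [← Complex.Gamma_add_one _ n2]; ring_nf
  rw [e1, e2, e5, e6]
  calc -Complex.cosh x * ((1 + t * I) * Complex.Gamma (1 + t * I)) *
        (-Complex.cosh x * ((1 - t * I) * Complex.Gamma (1 - t * I)))
      = Complex.cosh x ^ 2 * (1 - t ^ 2 * (I * I)) *
        (Complex.Gamma (1 + t * I) * Complex.Gamma (1 - t * I)) := by ring
    _ = (1 - t ^ 2 * (I * I)) * (x * (Complex.cosh x / Complex.sinh x)) := by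
        rw [e4]
        field_simp
    _ = _ := by rw [I_mul_I]; push_cast; ring

lemma sinh_le_mul_cosh {x : ℝ} (hx : 0 ≤ x) : Real.sinh x ≤ x * Real.cosh x := by
  rcases hx.eq_or_lt with rfl | hx
  · simp
  obtain ⟨c, hc, h⟩ := exists_deriv_eq_slope Real.sinh hx Real.continuous_sinh.continuousOn
    Real.differentiable_sinh.differentiableOn
  rw [Real.deriv_sinh, Real.sinh_zero, sub_zero, sub_zero, eq_div_iff hx.ne'] at h
  rw [← h, mul_comm]
  gcongr
  rw [Real.cosh_le_cosh, abs_of_pos hc.1, abs_of_pos hx]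
  exact hc.2.le

lemma one_le_mul_coth {x : ℝ} (hx : x ≠ 0) : 1 ≤ x * (Real.cosh x / Real.sinh x) := by
  wlog h : 0 < x generalizing x
  · have := this (x := -x) (by simpa) (by
      rcases lt_or_gt_of_ne hx with h' | h'
      · linarith
      · exact absurd h' h)
    simpa [neg_div, div_neg] using this
  have hs : 0 < Real.sinh x := Real.sinh_pos_iff.mpr h
  rw [← mul_div_assoc, le_div_iff₀ hs, one_mul]
  exact sinh_le_mul_cosh h.le

lemma mul_tanh_le (x : ℝ) : x * (Real.sinh x / Real.cosh x) ≤ |x| := by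
  rw [← mul_div_assoc, div_le_iff₀ (Real.cosh_pos x)]
  have h1 : |Real.sinh x| ≤ Real.cosh x := by
    rw [abs_le]
    constructor
    · have := Real.exp_pos x
      rw [← Real.cosh_add_sinh] at this
      linarith
    · exact (Real.sinh_lt_cosh x).le
  calc x * Real.sinh x ≤ |x| * |Real.sinh x| := by
        rw [← abs_mul]; exact le_abs_self _
    _ ≤ _ := by gcongr

lemma norm_feFactor_one_le {s : ℂ} (hs : s.re = 1) :
    ‖feFactor s‖ ≤ 2 * (1 + |s.im|) ^ (1 / 2 : ℝ) := by
  have e : s = 1 + s.im * I := by apply Complex.ext <;> simp [hs]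
  have hpos : 0 < 1 + |s.im| := by positivity
  rcases eq_or_ne s.im 0 with h0 | h0
  · rw [e, h0]
    simp [feFactor]
  · have h1 := norm_feFactor_one_add_mul_I_sq h0
    rw [← e] at h1
    have h2 := mul_tanh_le (π * s.im / 2)
    rw [← h1] at h2
    have h3 : |π * s.im / 2| ≤ 4 * (1 + |s.im|) := by
      rw [abs_div, abs_mul, abs_of_pos Real.pi_pos, abs_two]
      nlinarith [Real.pi_lt_four, abs_nonneg s.im]
    refine abs_le_of_sq_le_sq' ?_ (by positivity) |>.2
    rw [mul_pow, ← Real.rpow_natCast ((1 + |s.im|) ^ (1 / 2 : ℝ)), ← Real.rpow_mul hpos.le]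
    norm_num
    linarith

lemma le_norm_feFactor_two {s : ℂ} (hs : s.re = 2) : 1 + |s.im| ≤ 2 * ‖feFactor s‖ := by
  have e : s = 2 + s.im * I := by apply Complex.ext <;> simp [hs]
  have hkey : 1 + s.im ^ 2 ≤ ‖feFactor s‖ ^ 2 := by
    rcases eq_or_ne s.im 0 with h0 | h0
    · rw [e, h0]
      simp [feFactor]
    · have h1 := norm_feFactor_two_add_mul_I_sq h0
      rw [← e] at h1
      rw [h1]
      have := one_le_mul_coth (x := π * s.im / 2) (by simp [h0, Real.pi_ne_zero])
      nlinarith [sq_nonneg s.im]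
  refine abs_le_of_sq_le_sq' ?_ (by positivity) |>.2
  nlinarith [sq_nonneg (1 - |s.im|), sq_abs s.im]

lemma feFactor_add_two {s : ℂ} (hs : 0 < s.re) : feFactor (s + 2) = -(s * (s + 1)) * feFactor s := by
  have h0 : s ≠ 0 := by rintro rfl; simp at hs
  have h1 : s + 1 ≠ 0 := by
    intro h
    have := congrArg re h
    simp at this
    linarith
  rw [feFactor, feFactor, show s + 2 = s + 1 + 1 by ring, Complex.Gamma_add_one _ h1,
    Complex.Gamma_add_one _ h0, show (π * (s + 1 + 1) / 2 : ℂ) = π * s / 2 + π by ring,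
    Complex.cos_add_pi]
  ring

lemma norm_cos_le (z : ℂ) : ‖Complex.cos z‖ ≤ Real.exp |z.im| := by
  rw [Complex.cos, norm_div, Complex.norm_ofNat, div_le_iff₀ (by norm_num)]
  refine (norm_add_le _ _).trans ?_
  rw [Complex.norm_exp, Complex.norm_exp]
  have h1 : (z * I).re ≤ |z.im| := by simpa using neg_le_abs z.im
  have h2 : (-z * I).re ≤ |z.im| := by simpa using le_abs_self z.im
  linarith [Real.exp_le_exp.mpr h1, Real.exp_le_exp.mpr h2]

lemma norm_Gamma_le {s : ℂ} (hs : 0 < s.re) : ‖Complex.Gamma s‖ ≤ Real.Gamma s.re := by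
  rw [Complex.Gamma_eq_integral hs, Complex.GammaIntegral, Real.Gamma_eq_integral hs]
  refine norm_integral_le_of_norm_le (Real.GammaIntegral_convergent hs) ?_
  filter_upwards [ae_restrict_mem measurableSet_Ioi] with x hx
  rw [norm_mul, norm_cpow_eq_rpow_re_of_pos hx, norm_real, Real.norm_eq_abs, Real.abs_exp]
  simp

lemma differentiableAt_feFactor {s : ℂ} (hs : 0 < s.re) : DifferentiableAt ℂ feFactor s := by
  unfold feFactor
  have : DifferentiableAt ℂ Complex.Gamma s := by
    refine Complex.differentiableAt_Gamma s fun m h ↦ ?_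
    rw [h] at hs
    simp at hs
    linarith [(Nat.cast_nonneg m : (0 : ℝ) ≤ m)]
  fun_prop

/-- The growth of the factor of the functional equation in `1 ≤ re s ≤ 3`. -/
lemma exists_norm_feFactor_le : ∃ C : ℝ, ∀ s : ℂ, 1 ≤ s.re → s.re ≤ 3 →
    ‖feFactor s‖ ≤ C * (1 + |s.im|) ^ (s.re - 1 / 2) := by
  obtain ⟨B, hB⟩ : ∃ B, ∀ x ∈ Set.Icc (1 : ℝ) 3, ‖Real.Gamma x‖ ≤ B :=
    isCompact_Icc.exists_bound_of_continuousOn fun x hx ↦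
      (Real.differentiableAt_Gamma fun m h ↦ by
        have := hx.1
        rw [h] at this
        linarith [(Nat.cast_nonneg m : (0 : ℝ) ≤ m)]).continuousAt.continuousWithinAt
  -- The edge `re s = 3` reduces to `re s = 1` by the recurrence with step `2`. Interpolating the
  -- exponents `1/2` and `5/2` gives exactly `re s - 1/2`.
  obtain ⟨C, hC⟩ := exists_norm_le_of_strip_edges (f := feFactor) (a := 1) (b := 3) (α := 1 / 2)
    (β := 5 / 2) (A := B) (B := π / 2) (C := 4) (by norm_num)
    (fun z h1 _ ↦ differentiableAt_feFactor (by linarith)) (fun z h1 h2 ↦ by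
      rw [feFactor, norm_mul, mul_comm]
      have e1 := norm_Gamma_le (s := z) (by linarith)
      have e2 := hB z.re ⟨h1, h2⟩
      have e3 := norm_cos_le (π * z / 2)
      have e4 : (π * z / 2 : ℂ).im = π / 2 * z.im := by
        rw [show (π * z / 2 : ℂ) = ((π / 2 : ℝ) : ℂ) * z by push_cast; ring, im_ofReal_mul]
      rw [e4, abs_mul, abs_of_pos (by positivity)] at e3
      have e5 := (e1.trans (le_abs_self _)).trans e2
      have hB0 : 0 ≤ B := (norm_nonneg _).trans e2
      gcongr) (fun z hz ↦ by
      refine (norm_feFactor_one_le hz).trans ?_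
      gcongr
      norm_num) (fun z hz ↦ by
      have hpos : 0 < 1 + |z.im| := by positivity
      set u : ℂ := z - 2 with hu
      have hure : u.re = 1 := by simp [hu, hz]; norm_num
      have huim : u.im = z.im := by simp [hu]
      have h1 : feFactor z = -(u * (u + 1)) * feFactor u := by
        rw [← feFactor_add_two (by rw [hure]; norm_num)]
        simp [hu]
      have h2 := norm_feFactor_one_le hure
      rw [huim] at h2
      have h3 : ‖u‖ ≤ 1 + |z.im| := by
        refine (Complex.norm_le_abs_re_add_abs_im u).trans ?_
        rw [hure, huim]; simp
      have h4 : ‖u + 1‖ ≤ 2 * (1 + |z.im|) := by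
        refine (norm_add_le _ _).trans ?_
        rw [norm_one]
        linarith [abs_nonneg z.im]
      rw [h1, norm_mul, norm_neg, norm_mul]
      calc ‖u‖ * ‖u + 1‖ * ‖feFactor u‖
          ≤ (1 + |z.im|) * (2 * (1 + |z.im|)) * (2 * (1 + |z.im|) ^ (1 / 2 : ℝ)) := by gcongr
        _ = 4 * ((1 + |z.im|) ^ (2 : ℝ) * (1 + |z.im|) ^ (1 / 2 : ℝ)) := by
            rw [Real.rpow_two]; ring
        _ = _ := by
            rw [← Real.rpow_add hpos]; norm_num)
  refine ⟨C, fun s h1 h2 ↦ ?_⟩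
  have := hC s h1 h2
  convert this using 3
  ring

end KFree

/-! ### Growth of `ζ` in vertical strips, from the functional equation and convexity. -/

namespace KFree
open MeasureTheory Filter Topology Complex Metric
open scoped ENNReal Real

lemma riemannZeta_one_sub_eq {s : ℂ} (hs : 0 < s.re) (hs1 : s ≠ 1) :
    riemannZeta (1 - s) = 2 * (2 * π : ℂ) ^ (-s) * feFactor s * riemannZeta s := by
  rw [riemannZeta_one_sub (fun n h ↦ ?_) hs1, feFactor]
  · ring
  · rw [h] at hs
    simp at hs
    linarith [(Nat.cast_nonneg n : (0 : ℝ) ≤ n)]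

lemma norm_two_pi_cpow (s : ℂ) : ‖(2 * π : ℂ) ^ (-s)‖ = (2 * π) ^ (-s.re) := by
  rw [show (2 * π : ℂ) = ((2 * π : ℝ) : ℂ) by push_cast; rfl,
    norm_cpow_eq_rpow_re_of_pos (by positivity), neg_re]

lemma norm_two_pi_cpow_le {s : ℂ} (hs : 0 ≤ s.re) : ‖(2 * π : ℂ) ^ (-s)‖ ≤ 1 := by
  rw [norm_two_pi_cpow]
  refine Real.rpow_le_one_of_one_le_of_nonpos ?_ (by linarith)
  linarith [Real.pi_gt_three]

/-- Growth of `ζ` on a line to the left of the critical strip. -/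
lemma exists_norm_riemannZeta_left_le {η : ℝ} (h0 : 0 < η) (h2 : η ≤ 2) :
    ∃ C : ℝ, ∀ z : ℂ, z.re = -η → ‖riemannZeta z‖ ≤ C * (1 + |z.im|) ^ (1 / 2 + η) := by
  obtain ⟨C, hC⟩ := exists_norm_feFactor_le
  obtain ⟨B, hB0, hB⟩ := exists_norm_riemannZeta_le (σ := 1 + η) (by linarith)
  refine ⟨2 * C * B, fun z hz ↦ ?_⟩
  have hre : (1 - z).re = 1 + η := by simp [hz]
  have him : |(1 - z).im| = |z.im| := by simp
  have hs1 : (1 - z) ≠ 1 := by intro h; rw [h] at hre; simp at hre; linarith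
  have h := riemannZeta_one_sub_eq (s := 1 - z) (by linarith) hs1
  rw [sub_sub_cancel] at h
  rw [h, norm_mul, norm_mul, norm_mul, Complex.norm_ofNat]
  have e1 := norm_two_pi_cpow_le (s := 1 - z) (by linarith)
  have e2 := hC (1 - z) (by linarith) (by linarith)
  rw [him, hre, show 1 + η - 1 / 2 = 1 / 2 + η by ring] at e2
  have e3 := (hB (1 - z) hre.ge).1
  have e4 := (norm_nonneg _).trans e2
  calc 2 * ‖(2 * π : ℂ) ^ (-(1 - z))‖ * ‖feFactor (1 - z)‖ * ‖riemannZeta (1 - z)‖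
      ≤ 2 * 1 * (C * (1 + |z.im|) ^ (1 / 2 + η)) * B := by
        gcongr
    _ = _ := by ring

/-- The functional equation carries the lower bound from `re = 2`. The true order is `|im z|^(3/2)`,
but linear growth is all that the left edge of the strip requires. -/
lemma exists_le_norm_riemannZeta_neg_one :
    ∃ c : ℝ, 0 < c ∧ ∀ z : ℂ, z.re = -1 → 1 + |z.im| ≤ c * ‖riemannZeta z‖ := by
  obtain ⟨B, hB0, hB⟩ := exists_norm_riemannZeta_le (σ := 2) (by norm_num)
  refine ⟨(2 * π) ^ (2 : ℝ) * B, by positivity, fun z hz ↦ ?_⟩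
  have hre : (1 - z).re = 2 := by simp [hz]; norm_num
  have him : |(1 - z).im| = |z.im| := by simp
  have hs1 : (1 - z) ≠ 1 := by intro h; rw [h] at hre; simp at hre
  have h := riemannZeta_one_sub_eq (s := 1 - z) (by linarith) hs1
  rw [sub_sub_cancel] at h
  rw [h, norm_mul, norm_mul, norm_mul, Complex.norm_ofNat, norm_two_pi_cpow, hre]
  have e2 := le_norm_feFactor_two hre
  rw [him] at e2
  have e3 := (hB (1 - z) hre.ge).2
  have e4 : (2 * π) ^ (2 : ℝ) * (2 * π) ^ (-2 : ℝ) = 1 := by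
    rw [← Real.rpow_add (by positivity)]; norm_num
  calc 1 + |z.im| ≤ 2 * ‖feFactor (1 - z)‖ * 1 := by linarith
    _ ≤ 2 * ‖feFactor (1 - z)‖ * (B * ‖riemannZeta (1 - z)‖) := by gcongr
    _ = ((2 * π) ^ (2 : ℝ) * (2 * π) ^ (-2 : ℝ)) * (2 * ‖feFactor (1 - z)‖ * (B * ‖riemannZeta (1 - z)‖)) := by
      rw [e4, one_mul]
    _ = _ := by ring

lemma norm_le_re_add_im {z : ℂ} {X : ℝ} (h : |z.re| ≤ X) : ‖z‖ ≤ (1 + X) * (1 + |z.im|) := by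
  have := norm_le_abs_re_add_abs_im z
  nlinarith [abs_nonneg z.re, abs_nonneg z.im]

/-- The recurrence with step `2` extends the bound to the right, and once to the left down to `re s
= 1/2`. Only polynomial growth matters, so the exponent is wasteful. -/
lemma exists_norm_feFactor_le_pow (n : ℕ) : ∃ (C : ℝ) (m : ℕ), ∀ s : ℂ, 1 / 2 ≤ s.re → s.re ≤ n + 3 →
    ‖feFactor s‖ ≤ C * (1 + |s.im|) ^ m := by
  induction n with
  | zero =>
    obtain ⟨C, hC⟩ := exists_norm_feFactor_le
    have hbase : ∀ s : ℂ, 1 ≤ s.re → s.re ≤ 3 → ‖feFactor s‖ ≤ |C| * (1 + |s.im|) ^ 3 := by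
      intro s h1 h2
      refine (hC s h1 h2).trans ?_
      rw [← Real.rpow_natCast]
      have := le_abs_self C
      gcongr
      · linarith [abs_nonneg s.im]
      · push_cast; linarith
    refine ⟨4 * |C|, 3, fun s h1 h2 ↦ ?_⟩
    rcases le_total 1 s.re with h | h
    · refine (hbase s h (by simpa using h2)).trans ?_
      gcongr
      linarith [abs_nonneg C]
    · have e1 := hbase (s + 2) (by simp; linarith) (by simp; linarith)
      rw [feFactor_add_two (by linarith), norm_mul, norm_neg, norm_mul] at e1
      have e2 : 1 / 2 ≤ ‖s‖ := h1.trans (re_le_norm s)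
      have e3 : 1 / 2 ≤ ‖s + 1‖ := le_trans (by simp; linarith) (re_le_norm (s + 1))
      have e4 : 1 / 4 ≤ ‖s‖ * ‖s + 1‖ := by nlinarith
      have e5 : (s + 2).im = s.im := by simp
      rw [e5] at e1
      nlinarith [norm_nonneg (feFactor s)]
  | succ n ih =>
    obtain ⟨C, m, hC⟩ := ih
    have hC0 : 0 ≤ C := by
      have h := hC 1 (by norm_num) (by simp; linarith [(Nat.cast_nonneg n : (0 : ℝ) ≤ n)])
      simpa using (norm_nonneg _).trans h
    refine ⟨C * (1 + (n + 4)) ^ 2, m + 2, fun s h1 h2 ↦ ?_⟩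
    push_cast at h2
    have hn := (Nat.cast_nonneg n : (0 : ℝ) ≤ n)
    rcases le_total s.re (n + 3) with h | h
    · refine (hC s h1 h).trans ?_
      have : 1 ≤ (1 + (n + 4) : ℝ) ^ 2 := one_le_pow₀ (by linarith)
      gcongr
      · nlinarith
      · linarith [abs_nonneg s.im]
      · omega
    · have e0 := hC (s - 2) (by simp; linarith) (by simp; linarith)
      have e1 := feFactor_add_two (s := s - 2) (by simp; linarith)
      rw [sub_add_cancel] at e1
      have e5 : (s - 2).im = s.im := by simp
      have e5' : (s - 2 + 1).im = s.im := by simp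
      rw [e5] at e0
      have e2 := norm_le_re_add_im (z := s - 2) (X := n + 4) (by rw [abs_of_nonneg] <;> simp <;> linarith)
      have e3 := norm_le_re_add_im (z := s - 2 + 1) (X := n + 4) (by rw [abs_of_nonneg] <;> simp <;> linarith)
      rw [e5] at e2
      rw [e5'] at e3
      rw [e1, norm_mul, norm_neg, norm_mul]
      calc ‖s - 2‖ * ‖s - 2 + 1‖ * ‖feFactor (s - 2)‖
          ≤ ((1 + (n + 4)) * (1 + |s.im|)) * ((1 + (n + 4)) * (1 + |s.im|)) * (C * (1 + |s.im|) ^ m) := by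
            gcongr
        _ = _ := by ring

lemma riemannZeta₁_of_ne {s : ℂ} (hs : s ≠ 1) : riemannZeta₁ s = (s - 1) * riemannZeta s := by
  rw [riemannZeta_eq_inv_sub_mul hs, mul_inv_cancel_left₀ (sub_ne_zero.mpr hs)]

/-- `(s - 1) ζ(s)` has polynomial growth in vertical strips. -/
theorem exists_norm_riemannZeta₁_le (X : ℝ) : ∃ (C : ℝ) (n : ℕ), 0 ≤ C ∧ ∀ z : ℂ, |z.re| ≤ X →
    ‖riemannZeta₁ z‖ ≤ C * (1 + |z.im|) ^ n := by
  rcases lt_or_ge X 0 with hX | hX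
  · exact ⟨0, 0, le_rfl, fun z hz ↦ absurd (abs_nonneg z.re) (by linarith)⟩
  obtain ⟨C, m, hC⟩ := exists_norm_feFactor_le_pow ⌈X⌉₊
  have hXc := Nat.le_ceil X
  have hcpt : IsCompact (closedBall (0 : ℂ) (X + 1)) := isCompact_closedBall _ _
  obtain ⟨B, hB⟩ := hcpt.exists_bound_of_continuousOn
    differentiable_riemannZeta₁.continuous.continuousOn
  set A : ℝ := 3 * (3 + X) ^ 2 with hA
  have hright : ∀ s : ℂ, 1 / 2 ≤ s.re → |s.re| ≤ X + 1 → ‖riemannZeta₁ s‖ ≤ A * (1 + |s.im|) ^ 2 := by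
    intro s h1 h2
    have e := norm_riemannZeta₁_le h1
    have e1 := norm_le_re_add_im h2
    have e2 := norm_le_re_add_im (z := s - 1) (X := X + 2) (by
      simp only [sub_re, one_re]
      refine (abs_sub _ _).trans ?_
      simp
      linarith)
    have e3 : (s - 1).im = s.im := by simp
    rw [e3] at e2
    have hy : 1 ≤ 1 + |s.im| := by linarith [abs_nonneg s.im]
    set y := 1 + |s.im|
    have e4 : ‖s‖ ≤ (3 + X) * y := by nlinarith
    have e5 : ‖s - 1‖ ≤ (3 + X) * y := by nlinarith
    have e6 : ‖s‖ * ‖s - 1‖ ≤ ((3 + X) * y) * ((3 + X) * y) := by gcongr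
    have e7 : (3 + X) * y ≤ ((3 + X) * y) * ((3 + X) * y) := by
      have : 1 ≤ (3 + X) * y := by nlinarith
      nlinarith
    rw [hA]
    nlinarith
  have hC0 : 0 ≤ C := by
    have h := hC 1 (by norm_num) (by simp; linarith [(Nat.cast_nonneg ⌈X⌉₊ : (0 : ℝ) ≤ _)])
    simpa using (norm_nonneg _).trans h
  have hB0 : 0 ≤ B := (norm_nonneg _).trans (hB 0 (by simp; linarith))
  have hA0 : 0 ≤ A := by positivity
  refine ⟨A + B + 2 * (2 + X) * C * A, m + 3, by positivity, fun z hz ↦ ?_⟩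
  have hy : 1 ≤ 1 + |z.im| := by linarith [abs_nonneg z.im]
  have hpow : ∀ j ≤ m + 3, (1 + |z.im|) ^ j ≤ (1 + |z.im|) ^ (m + 3) := fun j hj ↦
    pow_le_pow_right₀ hy hj
  have h5 : 0 ≤ 2 * (2 + X) * C * A := by positivity
  rcases le_total (1 / 2) z.re with h | h
  · refine (hright z h (by linarith)).trans ?_
    exact mul_le_mul (by linarith) (hpow 2 (by omega)) (by positivity) (by positivity)
  -- The reflected identity is divided by `s - 1 = -z`, which may vanish near the real axis;
  -- compactness covers that region.
  rcases le_total |z.im| 1 with h1 | h1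
  · refine (hB z ?_).trans ?_
    · rw [mem_closedBall, dist_zero_right]
      exact (norm_le_abs_re_add_abs_im z).trans (by linarith)
    · calc B ≤ (A + B + 2 * (2 + X) * C * A) * 1 := by linarith
        _ ≤ _ := by gcongr; exact one_le_pow₀ hy
  · obtain ⟨hz1, hz2⟩ := abs_le.mp hz
    set s := 1 - z with hs
    have hre : s.re = 1 - z.re := by simp [hs]
    have him : |s.im| = |z.im| := by simp [hs]
    have hzs : z = 1 - s := by simp [hs]
    have hs1 : s ≠ 1 := by
      intro h'
      rw [h'] at him
      simp only [one_im, abs_zero] at him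
      linarith
    have hz1' : z ≠ 1 := by
      intro h'
      rw [h'] at h1
      simp at h1
      linarith
    have hkey : (s - 1) * riemannZeta₁ z = -s * (2 * (2 * π : ℂ) ^ (-s) * feFactor s * riemannZeta₁ s) := by
      rw [riemannZeta₁_of_ne hz1', riemannZeta₁_of_ne hs1, hzs,
        riemannZeta_one_sub_eq (by linarith) hs1]
      ring
    have hn := congrArg norm hkey
    simp only [norm_mul, norm_neg, Complex.norm_ofNat] at hn
    have e1 : 1 ≤ ‖s - 1‖ := by
      refine le_trans ?_ (abs_im_le_norm _)
      simpa [him] using h1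
    have e2 : ‖s‖ ≤ (2 + X) * (1 + |z.im|) := by
      have := norm_le_re_add_im (z := s) (X := X + 1) (by rw [hre, abs_of_nonneg] <;> linarith)
      rw [him] at this
      linarith
    have e3 := norm_two_pi_cpow_le (s := s) (by linarith)
    have e4 := hC s (by linarith) (by linarith)
    have e5 := hright s (by linarith) (by rw [hre, abs_of_nonneg] <;> linarith)
    rw [him] at e4 e5
    calc ‖riemannZeta₁ z‖ ≤ ‖s - 1‖ * ‖riemannZeta₁ z‖ :=
          le_mul_of_one_le_left (norm_nonneg _) e1
      _ ≤ ((2 + X) * (1 + |z.im|)) * (2 * 1 * (C * (1 + |z.im|) ^ m) * (A * (1 + |z.im|) ^ 2)) := by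
          rw [hn]; gcongr
      _ = (2 * (2 + X) * C * A) * (1 + |z.im|) ^ (m + 3) := by ring
      _ ≤ _ := by gcongr; linarith

/-- A convexity bound for `ζ` on a line inside the critical strip. -/
theorem exists_norm_riemannZeta_le_rpow {σ : ℝ} (h0 : 0 < σ) (h1 : σ ≤ 3 / 4) :
    ∃ C : ℝ, ∀ z : ℂ, z.re = σ → ‖riemannZeta z‖ ≤ C * (1 + |z.im|) ^ (1 / 2 - σ / 4) := by
  -- Convexity between `re = -η` and `re = 1 + η` gives `ζ` the exponent `1/2 + η/2 - σ/2`; for `η =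
  -- σ/2` this is `1/2 - σ/4`, strictly below `1/2`.
  set η := σ / 2 with hη
  have hη0 : 0 < η := by positivity
  obtain ⟨C₁, hC₁⟩ := exists_norm_riemannZeta_left_le hη0 (by linarith)
  obtain ⟨C₂, hC₂0, hC₂⟩ := exists_norm_riemannZeta_le (σ := 1 + η) (by linarith)
  obtain ⟨A, n, hA0, hA⟩ := exists_norm_riemannZeta₁_le (1 + η)
  have hC₁0 : 0 ≤ C₁ := by
    have h := hC₁ (-η : ℝ) (by simp)
    simpa using (norm_nonneg _).trans h
  obtain ⟨C, hC⟩ := exists_norm_le_of_strip_edges (f := riemannZeta₁) (a := -η) (b := 1 + η)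
    (α := 3 / 2 + η) (β := 1) (A := A) (B := n) (C := 2 * (C₁ + C₂)) (by linarith)
    (fun z _ _ ↦ differentiable_riemannZeta₁ z) (fun z h2 h3 ↦ by
      refine (hA z (abs_le.mpr ⟨by linarith, h3⟩)).trans ?_
      rw [Real.exp_nat_mul]
      gcongr
      rw [add_comm]
      exact Real.add_one_le_exp _) (fun z hz ↦ by
      have hz1 : z ≠ 1 := by rintro rfl; simp at hz; linarith
      have hpos : 0 < 1 + |z.im| := by positivity
      have e : ‖z - 1‖ ≤ 2 * (1 + |z.im|) := by
        refine (norm_le_abs_re_add_abs_im _).trans ?_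
        simp only [sub_re, one_re, sub_im, one_im, sub_zero]
        rw [hz, abs_of_nonpos (by linarith)]
        linarith [abs_nonneg z.im]
      rw [riemannZeta₁_of_ne hz1, norm_mul, show 3 / 2 + η = 1 + (1 / 2 + η) by ring,
        Real.rpow_add hpos, Real.rpow_one]
      calc ‖z - 1‖ * ‖riemannZeta z‖
          ≤ (2 * (1 + |z.im|)) * (C₁ * (1 + |z.im|) ^ (1 / 2 + η)) := by
            gcongr
            exact hC₁ z hz
        _ = 2 * C₁ * ((1 + |z.im|) * (1 + |z.im|) ^ (1 / 2 + η)) := by ring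
        _ ≤ _ := by gcongr; linarith) (fun z hz ↦ by
      have hz1 : z ≠ 1 := by rintro rfl; simp at hz; linarith
      have e : ‖z - 1‖ ≤ 2 * (1 + |z.im|) := by
        refine (norm_le_abs_re_add_abs_im _).trans ?_
        simp only [sub_re, one_re, sub_im, one_im, sub_zero]
        rw [hz, abs_of_nonneg (by linarith)]
        linarith [abs_nonneg z.im]
      rw [riemannZeta₁_of_ne hz1, norm_mul, Real.rpow_one]
      calc ‖z - 1‖ * ‖riemannZeta z‖ ≤ (2 * (1 + |z.im|)) * C₂ := by
            gcongr
            exact (hC₂ z hz.ge).1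
        _ = 2 * C₂ * (1 + |z.im|) := by ring
        _ ≤ _ := by gcongr; linarith)
  refine ⟨5 * C, fun z hz ↦ ?_⟩
  have hpos : 0 < 1 + |z.im| := by positivity
  have hz1 : z ≠ 1 := by rintro rfl; simp at hz; linarith
  have e1 := hC z (by linarith) (by linarith)
  have e2 : 3 / 2 + η + (1 - (3 / 2 + η)) * (z.re - -η) / (1 + η - -η) = 1 + (1 / 2 - σ / 4) := by
    rw [hz, show 1 + η - -η = 1 + 2 * η by ring]
    have : 1 + 2 * η ≠ 0 := by positivity
    rw [show (1 - (3 / 2 + η)) * (σ - -η) / (1 + 2 * η) = -(σ + η) / 2 by field_simp; ring, hη]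
    ring
  rw [e2, Real.rpow_add hpos, Real.rpow_one, riemannZeta₁_of_ne hz1, norm_mul] at e1
  have e3 : 1 + |z.im| ≤ 5 * ‖z - 1‖ := by
    have a1 := abs_re_le_norm (z - 1)
    have a2 := abs_im_le_norm (z - 1)
    simp only [sub_re, one_re, sub_im, one_im, sub_zero] at a1 a2
    rw [hz, abs_of_nonpos (by linarith)] at a1
    linarith
  have hz0 : 0 < ‖z - 1‖ := norm_pos_iff.mpr (sub_ne_zero.mpr hz1)
  have e4 : (1 + |z.im|) * ‖riemannZeta z‖ ≤ (1 + |z.im|) * (5 * C * (1 + |z.im|) ^ (1 / 2 - σ / 4)) := by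
    nlinarith [norm_nonneg (riemannZeta z)]
  exact le_of_mul_le_mul_left e4 hpos

end KFree

/-! ### Nontrivial zeros: location, simplicity, symmetry and local count. -/

namespace KFree
open MeasureTheory Filter Topology Complex Metric
open scoped ENNReal Real ComplexConjugate

/-- The nontrivial zeros of `ζ` (those off the real axis). -/
def zeros : Set ℂ := {ρ | riemannZeta ρ = 0 ∧ ρ.im ≠ 0}

lemma re_of_mem_zeros (hRH : RiemannHypothesis) {ρ : ℂ} (h : ρ ∈ zeros) : ρ.re = 1 / 2 := by
  refine hRH ρ h.1 ?_ ?_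
  · rintro ⟨n, hn⟩
    apply h.2
    rw [hn]
    simp
  · rintro rfl
    exact h.2 rfl

lemma ne_one_of_mem_zeros {ρ : ℂ} (h : ρ ∈ zeros) : ρ ≠ 1 := by
  rintro rfl
  exact h.2 rfl

lemma riemannZeta₁_eq_zero_of_mem_zeros {ρ : ℂ} (h : ρ ∈ zeros) : riemannZeta₁ ρ = 0 := by
  rw [riemannZeta₁_of_ne (ne_one_of_mem_zeros h), h.1, mul_zero]

lemma ne_one_of_riemannZeta₁_eq_zero {z : ℂ} (hz : riemannZeta₁ z = 0) : z ≠ 1 := by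
  rintro rfl
  simp at hz

lemma riemannZeta_eq_zero_of_riemannZeta₁ {z : ℂ} (hz : riemannZeta₁ z = 0) : riemannZeta z = 0 := by
  rw [riemannZeta_eq_inv_sub_mul (ne_one_of_riemannZeta₁_eq_zero hz), hz, mul_zero]

/-- Trivial zeros start at `-2`, so the half plane misses them. By RH a real zero in it could only
be `1/2`, where `ζ` does not vanish. -/
lemma mem_zeros_of_riemannZeta₁_eq_zero (hRH : RiemannHypothesis) {z : ℂ} (hz : riemannZeta₁ z = 0)
    (hre : -2 < z.re) : z ∈ zeros := by
  have h0 := riemannZeta_eq_zero_of_riemannZeta₁ hz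
  refine ⟨h0, fun him ↦ riemannZeta_half_ne_zero ?_⟩
  have := hRH z h0 ?_ (ne_one_of_riemannZeta₁_eq_zero hz)
  · rwa [show (1 / 2 : ℂ) = z by apply Complex.ext <;> simp [this, him]]
  · rintro ⟨n, hn⟩
    rw [hn] at hre
    simp at hre
    linarith [(Nat.cast_nonneg n : (0 : ℝ) ≤ n)]

lemma deriv_riemannZeta_conj (s : ℂ) : deriv riemannZeta (conj s) = conj (deriv riemannZeta s) := by
  have h : riemannZeta = conj ∘ riemannZeta ∘ conj := by
    ext z
    simp [riemannZeta_conj]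
  have h2 := deriv_conj_conj (f := riemannZeta)
  rw [← h] at h2
  conv_lhs => rw [h2]
  simp

lemma conj_mem_zeros {ρ : ℂ} (h : ρ ∈ zeros) : conj ρ ∈ zeros := by
  refine ⟨?_, by simpa using h.2⟩
  rw [riemannZeta_conj, h.1, map_zero]

lemma deriv_riemannZeta_ne_zero (hsimple : ∀ ρ ∈ upperZeros, deriv riemannZeta ρ ≠ 0) {ρ : ℂ}
    (h : ρ ∈ zeros) : deriv riemannZeta ρ ≠ 0 := by
  rcases lt_or_gt_of_ne h.2 with h1 | h1
  · have := hsimple (conj ρ) ⟨(conj_mem_zeros h).1, by simpa using h1⟩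
    rw [deriv_riemannZeta_conj] at this
    intro h3
    rw [h3] at this
    simp at this
  · exact hsimple ρ ⟨h.1, h1⟩

lemma deriv_riemannZeta₁ {ρ : ℂ} (h : ρ ∈ zeros) :
    deriv riemannZeta₁ ρ = (ρ - 1) * deriv riemannZeta ρ := by
  have h1 := ne_one_of_mem_zeros h
  have h2 : riemannZeta₁ =ᶠ[𝓝 ρ] fun s ↦ (s - 1) * riemannZeta s := by
    filter_upwards [isOpen_ne.mem_nhds h1] with s hs
    exact riemannZeta₁_of_ne hs
  rw [h2.deriv_eq, deriv_fun_mul (by fun_prop) (differentiableAt_riemannZeta h1), h.1]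
  simp

lemma deriv_riemannZeta₁_ne_zero (hsimple : ∀ ρ ∈ upperZeros, deriv riemannZeta ρ ≠ 0) {ρ : ℂ}
    (h : ρ ∈ zeros) : deriv riemannZeta₁ ρ ≠ 0 := by
  rw [deriv_riemannZeta₁ h]
  exact mul_ne_zero (sub_ne_zero.mpr (ne_one_of_mem_zeros h)) (deriv_riemannZeta_ne_zero hsimple h)

lemma finite_zeros_inter_closedBall (c : ℂ) (R : ℝ) : (zeros ∩ closedBall c R).Finite :=
  ((isCompact_closedBall c R).inter_riemannZetaZeros_finite).subset fun _ h ↦ ⟨h.2, h.1.1⟩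

lemma countable_zeros : zeros.Countable := by
  have : zeros = ⋃ n : ℕ, zeros ∩ closedBall 0 (n : ℝ) := by
    ext z
    simp only [Set.mem_iUnion, Set.mem_inter_iff, mem_closedBall, dist_zero_right]
    exact ⟨fun h ↦ ⟨⌈‖z‖⌉₊, h, Nat.le_ceil _⟩, fun ⟨_, h, _⟩ ↦ h⟩
  rw [this]
  exact Set.countable_iUnion fun n ↦ (finite_zeros_inter_closedBall 0 n).countable

instance : Countable zeros := countable_zeros.to_subtype

/-- Conjugation exchanges the zeros above and below the real axis, so each half contributes `a`. -/
lemma hasSum_zeros {f : ℂ → ℝ} (hf : ∀ ρ, f (conj ρ) = f ρ) {a : ℝ}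
    (h : HasSum (fun ρ : upperZeros ↦ f ρ) a) : HasSum (fun ρ : zeros ↦ f ρ) (2 * a) := by
  set L : Set ℂ := {ρ | riemannZeta ρ = 0 ∧ ρ.im < 0} with hL
  have hU : zeros = upperZeros ∪ L := by
    ext ρ
    simp only [zeros, upperZeros, hL, Set.mem_ofPred_eq, Set.mem_union, ne_iff_lt_or_gt]
    tauto
  have hd : Disjoint upperZeros L := by
    rw [Set.disjoint_left]
    rintro ρ h1 h2
    exact absurd h1.2 h2.2.le.not_gt
  have hmem : ∀ ρ, ρ ∈ L ↔ conj ρ ∈ upperZeros := by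
    intro ρ
    simp only [hL, upperZeros, Set.mem_ofPred_eq, riemannZeta_conj, map_eq_zero, conj_im,
      Left.neg_pos_iff]
  let e : L ≃ upperZeros :=
    { toFun := fun ρ ↦ ⟨conj (ρ : ℂ), (hmem _).1 ρ.2⟩
      invFun := fun ρ ↦ ⟨conj (ρ : ℂ), (hmem _).2 (by simp)⟩
      left_inv := fun ρ ↦ by simp
      right_inv := fun ρ ↦ by simp }
  have h2 : HasSum (fun ρ : L ↦ f ρ) a := by
    rw [← e.hasSum_iff] at h
    exact h.congr_fun fun ρ ↦ by simp [e, hf]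
  rw [two_mul]
  have := HasSum.add_disjoint (f := f) hd h h2
  rw [← hU] at this
  exact this

/-- A bound for the number of zeros in a window of bounded height. -/
lemma exists_two_pow_card_le (hRH : RiemannHypothesis) : ∃ (C : ℝ) (n : ℕ), 1 ≤ C ∧
    ∀ (t : ℝ) (A : Finset zeros), (∀ ρ ∈ A, |(ρ : ℂ).im - t| ≤ 1) →
      (2 : ℝ) ^ A.card ≤ C * (1 + |t|) ^ n := by
  obtain ⟨C, n, hC0, hC⟩ := exists_norm_riemannZeta₁_le 8
  obtain ⟨B, hB0, hB⟩ := exists_norm_riemannZeta_le (σ := 2) (by norm_num)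
  refine ⟨B * (C * 7 ^ n) + 1, n, by linarith [show 0 ≤ B * (C * 7 ^ n) by positivity],
    fun t A hA ↦ ?_⟩
  -- The disc of radius `2` about `2 + it` contains the points `1/2 + iγ` with `|γ - t| ≤ 1`, since
  -- `(3/2)² + 1 ≤ 4`, and `|ζ|` is bounded below at its centre.
  set c : ℂ := 2 + t * I with hc
  have hcre : c.re = 2 := by simp [hc]
  have hcim : c.im = t := by simp [hc]
  have hM : ∀ z ∈ closedBall c (3 * 2), ‖riemannZeta₁ z‖ ≤ C * (7 ^ n * (1 + |t|) ^ n) := by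
    intro z hz
    rw [mem_closedBall, dist_eq] at hz
    have h1 := (abs_re_le_norm (z - c)).trans hz
    have h2 := (abs_im_le_norm (z - c)).trans hz
    rw [sub_re, hcre, abs_le] at h1
    rw [sub_im, hcim] at h2
    refine (hC z (abs_le.mpr ⟨by linarith, by linarith⟩)).trans ?_
    rw [← mul_pow]
    gcongr
    have h3 := abs_sub_abs_le_abs_sub z.im t
    linarith [abs_nonneg t]
  have key := two_pow_card_mul_norm_le differentiable_riemannZeta₁ (r := 2) (c := c) (by norm_num) hM
    (S := A.map (Function.Embedding.subtype _)) (by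
      intro a ha
      rw [Finset.mem_map] at ha
      obtain ⟨ρ, _, rfl⟩ := ha
      exact riemannZeta₁_eq_zero_of_mem_zeros ρ.2) (by
      intro a ha
      rw [Finset.mem_map] at ha
      obtain ⟨ρ, hρ, rfl⟩ := ha
      have h1 := hA ρ hρ
      have h2 := re_of_mem_zeros hRH ρ.2
      rw [abs_le] at h1
      rw [Function.Embedding.subtype_apply, ← Real.sqrt_sq (show (0 : ℝ) ≤ 2 by norm_num),
        Complex.norm_def]
      apply Real.sqrt_le_sqrt
      rw [normSq_apply, sub_re, sub_im, hcre, hcim, h2]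
      nlinarith)
  rw [Finset.card_map] at key
  have h1 : 1 ≤ B * ‖riemannZeta₁ c‖ := by
    have hc1 : c ≠ 1 := by intro h; rw [h] at hcre; norm_num at hcre
    rw [riemannZeta₁_of_ne hc1, norm_mul]
    have h2 : 1 ≤ ‖c - 1‖ := by
      refine le_trans ?_ (abs_re_le_norm _)
      rw [sub_re, hcre]
      norm_num
    have h3 := (hB c hcre.ge).2
    calc 1 ≤ B * (1 * ‖riemannZeta c‖) := by linarith
      _ ≤ _ := by gcongr
  have hp : (0 : ℝ) < 2 ^ A.card := by positivity
  calc (2 : ℝ) ^ A.card ≤ 2 ^ A.card * (B * ‖riemannZeta₁ c‖) := le_mul_of_one_le_right hp.le h1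
    _ = B * (2 ^ A.card * ‖riemannZeta₁ c‖) := by ring
    _ ≤ B * (C * (7 ^ n * (1 + |t|) ^ n)) := by gcongr
    _ = (B * (C * 7 ^ n)) * (1 + |t|) ^ n := by ring
    _ ≤ _ := by gcongr; linarith

/-- Taking logarithms gives `O(log)` zeros in a window of bounded height; a small power is more
convenient. -/
lemma exists_card_le (hRH : RiemannHypothesis) {η : ℝ} (hη : 0 < η) : ∃ C : ℝ, 0 < C ∧
    ∀ (t : ℝ) (A : Finset zeros), (∀ ρ ∈ A, |(ρ : ℂ).im - t| ≤ 1) →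
      (A.card : ℝ) ≤ C * (1 + |t|) ^ η := by
  obtain ⟨C, n, hC1, hC⟩ := exists_two_pow_card_le hRH
  have hl2 : 0 < Real.log 2 := Real.log_pos (by norm_num)
  have hlC : 0 ≤ Real.log C := Real.log_nonneg hC1
  refine ⟨(Real.log C + n / η) / Real.log 2 + 1, by positivity, fun t A hA ↦ ?_⟩
  have hy : 1 ≤ 1 + |t| := by linarith [abs_nonneg t]
  have h1 := Real.log_le_log (by positivity) (hC t A hA)
  rw [Real.log_pow, Real.log_mul (by positivity) (by positivity), Real.log_pow] at h1
  have h2 := Real.log_le_rpow_div (x := 1 + |t|) (by positivity) hη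
  have h3 : 1 ≤ (1 + |t|) ^ η := Real.one_le_rpow hy hη.le
  have h4 : (A.card : ℝ) * Real.log 2 ≤ (Real.log C + n / η) * (1 + |t|) ^ η := by
    calc _ ≤ Real.log C + n * ((1 + |t|) ^ η / η) := by
          refine h1.trans ?_
          gcongr
      _ = Real.log C * 1 + n / η * (1 + |t|) ^ η := by ring
      _ ≤ Real.log C * (1 + |t|) ^ η + n / η * (1 + |t|) ^ η := by gcongr
      _ = _ := by ring
  have h5 : (A.card : ℝ) ≤ (Real.log C + n / η) / Real.log 2 * (1 + |t|) ^ η := by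
    rw [div_mul_eq_mul_div, le_div_iff₀ hl2]
    exact h4
  nlinarith

lemma summable_one_add_abs_rpow : Summable fun j : ℤ ↦ (1 + |(j : ℝ)|) ^ (-3 : ℝ) := by
  have h : ∀ m : ℕ, Summable fun n : ℕ ↦ ((m + n : ℕ) : ℝ) ^ (-3 : ℝ) := by
    intro m
    have := (summable_nat_add_iff m).mpr (Real.summable_nat_rpow (p := -3).mpr (by norm_num))
    simpa [add_comm] using this
  refine Summable.of_nat_of_neg ?_ ?_
  · simpa using h 1
  · simpa using h 1

/-- A smoothed count of the zeros near height `t`. -/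
lemma exists_sum_zeros_le (hRH : RiemannHypothesis) {η : ℝ} (hη : 0 < η) (hη1 : η ≤ 1) :
    ∃ C : ℝ, 0 < C ∧ ∀ (t : ℝ) (A : Finset zeros),
      ∑ ρ ∈ A, (1 + |t - (ρ : ℂ).im|) ^ (-4 : ℝ) ≤ C * (1 + |t|) ^ η := by
  obtain ⟨C, hC0, hC⟩ := exists_card_le hRH hη
  set T : ℝ := ∑' j : ℤ, (1 + |(j : ℝ)|) ^ (-3 : ℝ) with hT
  have hT0 : 0 ≤ T := tsum_nonneg fun j ↦ by positivity
  refine ⟨16 * C * T + 1, by positivity, fun t A ↦ ?_⟩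
  have hw : 0 < (1 + |t|) ^ η := by positivity
  -- Zeros are grouped by `⌊γ - t⌋ = j`. Their number costs at most one power of `1 + |j|`, so the
  -- weight `-4` leaves the summable exponent `-3`.
  let g : zeros → ℤ := fun ρ ↦ ⌊(ρ : ℂ).im - t⌋
  have hfib : ∀ j : ℤ, ∑ ρ ∈ A with g ρ = j, (1 + |t - (ρ : ℂ).im|) ^ (-4 : ℝ)
      ≤ 16 * C * (1 + |t|) ^ η * (1 + |(j : ℝ)|) ^ (-3 : ℝ) := by
    intro j
    have h1 : ∀ ρ ∈ A.filter (g · = j), (1 + |t - (ρ : ℂ).im|) ^ (-4 : ℝ)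
        ≤ 16 * (1 + |(j : ℝ)|) ^ (-4 : ℝ) := by
      intro ρ hρ
      have hj := (Finset.mem_filter.mp hρ).2
      have a1 := Int.floor_le ((ρ : ℂ).im - t)
      have a2 := Int.lt_floor_add_one ((ρ : ℂ).im - t)
      rw [show ⌊(ρ : ℂ).im - t⌋ = j from hj] at a1 a2
      have a3 : |(j : ℝ)| ≤ 1 + |t - (ρ : ℂ).im| := by
        rw [abs_sub_comm, abs_le]
        have := neg_abs_le ((ρ : ℂ).im - t)
        have := le_abs_self ((ρ : ℂ).im - t)
        constructor <;> linarith
      have a4 : (1 + |(j : ℝ)|) / 2 ≤ 1 + |t - (ρ : ℂ).im| := by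
        linarith [abs_nonneg (t - (ρ : ℂ).im)]
      calc (1 + |t - (ρ : ℂ).im|) ^ (-4 : ℝ) ≤ ((1 + |(j : ℝ)|) / 2) ^ (-4 : ℝ) :=
            Real.rpow_le_rpow_of_nonpos (by positivity) a4 (by norm_num)
        _ = _ := by
            rw [Real.div_rpow (by positivity) (by norm_num),
              show (2 : ℝ) ^ (-4 : ℝ) = 1 / 16 by
                rw [Real.rpow_neg (by norm_num)]; norm_num]
            ring
    have h2 := hC (t + j) (A.filter (g · = j)) (by
      intro ρ hρ
      have hj := (Finset.mem_filter.mp hρ).2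
      have a1 := Int.floor_le ((ρ : ℂ).im - t)
      have a2 := Int.lt_floor_add_one ((ρ : ℂ).im - t)
      rw [show ⌊(ρ : ℂ).im - t⌋ = j from hj] at a1 a2
      rw [abs_le]
      constructor <;> linarith)
    have h3 : (1 + |t + j|) ^ η ≤ (1 + |t|) ^ η * (1 + |(j : ℝ)|) := by
      calc (1 + |t + j|) ^ η ≤ ((1 + |t|) * (1 + |(j : ℝ)|)) ^ η := by
            gcongr
            have := abs_add_le t j
            nlinarith [abs_nonneg t, abs_nonneg (j : ℝ)]
        _ = (1 + |t|) ^ η * (1 + |(j : ℝ)|) ^ η := Real.mul_rpow (by positivity) (by positivity)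
        _ ≤ (1 + |t|) ^ η * (1 + |(j : ℝ)|) := by
            gcongr
            exact Real.rpow_le_self_of_one_le (by linarith [abs_nonneg (j : ℝ)]) hη1
    calc ∑ ρ ∈ A with g ρ = j, (1 + |t - (ρ : ℂ).im|) ^ (-4 : ℝ)
        ≤ (A.filter (g · = j)).card • (16 * (1 + |(j : ℝ)|) ^ (-4 : ℝ)) :=
          Finset.sum_le_card_nsmul _ _ _ h1
      _ = (A.filter (g · = j)).card * (16 * (1 + |(j : ℝ)|) ^ (-4 : ℝ)) := nsmul_eq_mul _ _
      _ ≤ (C * ((1 + |t|) ^ η * (1 + |(j : ℝ)|))) * (16 * (1 + |(j : ℝ)|) ^ (-4 : ℝ)) := by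
          gcongr
          exact h2.trans (by gcongr)
      _ = 16 * C * (1 + |t|) ^ η * ((1 + |(j : ℝ)|) ^ (1 : ℝ) * (1 + |(j : ℝ)|) ^ (-4 : ℝ)) := by
          rw [Real.rpow_one]; ring
      _ = _ := by
          rw [← Real.rpow_add (by positivity)]
          norm_num
  have hsum := summable_one_add_abs_rpow
  calc ∑ ρ ∈ A, (1 + |t - (ρ : ℂ).im|) ^ (-4 : ℝ)
      = ∑ j ∈ A.image g, ∑ ρ ∈ A with g ρ = j, (1 + |t - (ρ : ℂ).im|) ^ (-4 : ℝ) :=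
        (Finset.sum_fiberwise_of_maps_to (fun ρ hρ ↦ Finset.mem_image_of_mem g hρ) _).symm
    _ ≤ ∑ j ∈ A.image g, 16 * C * (1 + |t|) ^ η * (1 + |(j : ℝ)|) ^ (-3 : ℝ) :=
        Finset.sum_le_sum fun j _ ↦ hfib j
    _ = 16 * C * (1 + |t|) ^ η * ∑ j ∈ A.image g, (1 + |(j : ℝ)|) ^ (-3 : ℝ) := by
        rw [Finset.mul_sum]
    _ ≤ 16 * C * (1 + |t|) ^ η * T := by
        gcongr
        exact hsum.sum_le_tsum _ fun j _ ↦ by positivity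
    _ ≤ _ := by linarith

end KFree

/-! ### The hypothesis on `J` and the square summability of the residues. -/

namespace KFree
open MeasureTheory Filter Topology Complex Metric
open scoped ENNReal Real ComplexConjugate

lemma mem_zeros_of_mem_upperZeros {ρ : ℂ} (h : ρ ∈ upperZeros) : ρ ∈ zeros := ⟨h.1, h.2.ne'⟩

lemma finite_upperZeros_le (hRH : RiemannHypothesis) (T : ℝ) :
    Finite {ρ : ℂ // ρ ∈ upperZeros ∧ ρ.im ≤ T} := by
  refine Set.Finite.to_subtype (s := {ρ : ℂ | ρ ∈ upperZeros ∧ ρ.im ≤ T})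
    ((finite_zeros_inter_closedBall 0 (1 / 2 + T)).subset ?_)
  rintro ρ ⟨h1, h2⟩
  have h3 := mem_zeros_of_mem_upperZeros h1
  refine ⟨h3, ?_⟩
  rw [mem_closedBall, dist_zero_right]
  refine (norm_le_abs_re_add_abs_im ρ).trans ?_
  rw [re_of_mem_zeros hRH h3, abs_of_pos h1.2, abs_of_pos (by norm_num)]
  linarith

lemma sum_le_J (hRH : RiemannHypothesis) {T : ℝ} (A : Finset upperZeros)
    (hA : ∀ ρ ∈ A, (ρ : ℂ).im ≤ T) : ∑ ρ ∈ A, 1 / ‖deriv riemannZeta ρ‖ ^ 2 ≤ J T := by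
  have := finite_upperZeros_le hRH T
  set g : A → {ρ : ℂ // ρ ∈ upperZeros ∧ ρ.im ≤ T} := fun ρ ↦ ⟨ρ, ρ.1.2, hA ρ ρ.2⟩ with hg
  have hinj : Function.Injective g := by
    intro a b hab
    have := congrArg Subtype.val hab
    exact Subtype.ext (Subtype.ext this)
  have := tsum_comp_le_tsum_of_inj (f := fun ρ : {ρ : ℂ // ρ ∈ upperZeros ∧ ρ.im ≤ T} ↦
    1 / ‖deriv riemannZeta ρ‖ ^ 2) Summable.of_finite (fun _ ↦ by positivity) hinj
  rw [← Finset.sum_coe_sort, ← tsum_fintype (L := .unconditional _)]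
  exact this

lemma J_mono (hRH : RiemannHypothesis) : Monotone J := by
  intro S T hST
  have := finite_upperZeros_le hRH T
  have hinj : Function.Injective (fun ρ : {ρ : ℂ // ρ ∈ upperZeros ∧ ρ.im ≤ S} ↦
      (⟨ρ, ρ.2.1, ρ.2.2.trans hST⟩ : {ρ : ℂ // ρ ∈ upperZeros ∧ ρ.im ≤ T})) := by
    intro a b hab
    have := congrArg Subtype.val (show (⟨a, _⟩ : {ρ : ℂ // ρ ∈ upperZeros ∧ ρ.im ≤ T}) = ⟨b, _⟩ from hab)
    exact Subtype.ext this
  exact tsum_comp_le_tsum_of_inj (f := fun ρ : {ρ : ℂ // ρ ∈ upperZeros ∧ ρ.im ≤ T} ↦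
    1 / ‖deriv riemannZeta ρ‖ ^ 2) Summable.of_finite (fun _ ↦ by positivity) hinj

lemma J_nonneg (T : ℝ) : 0 ≤ J T := tsum_nonneg fun _ ↦ by positivity

/-- Monotonicity of `J` extends the asymptotic bound to all `T ≥ 1`. -/
lemma exists_J_le (hRH : RiemannHypothesis)
    (hJ : ∀ ε : ℝ, 0 < ε → J =O[atTop] fun T : ℝ ↦ T ^ (1 + ε)) {ε : ℝ} (hε : 0 < ε) :
    ∃ C : ℝ, 0 < C ∧ ∀ T : ℝ, 1 ≤ T → J T ≤ C * T ^ (1 + ε) := by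
  obtain ⟨C, hC0, hC⟩ := (hJ ε hε).exists_pos
  rw [Asymptotics.isBigOWith_iff, eventually_atTop] at hC
  obtain ⟨T₀, hT₀⟩ := hC
  refine ⟨C + J T₀, by linarith [J_nonneg T₀], fun T hT ↦ ?_⟩
  have h1 : 1 ≤ T ^ (1 + ε) := Real.one_le_rpow hT (by linarith)
  rcases le_total T₀ T with h | h
  · have := hT₀ T h
    rw [Real.norm_of_nonneg (J_nonneg T), Real.norm_of_nonneg (by linarith)] at this
    nlinarith [J_nonneg T₀]
  · nlinarith [J_nonneg T₀, J_mono hRH h]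

/-- Dyadic decomposition: zeros of height about `2^j` contribute `O(2^(j(1+ε)) 2^(-jp))`, and `ε =
(p-1)/2` makes this geometric with ratio `2^(-ε)`. -/
lemma summable_upperZeros (hRH : RiemannHypothesis)
    (hJ : ∀ ε : ℝ, 0 < ε → J =O[atTop] fun T : ℝ ↦ T ^ (1 + ε)) {p : ℝ} (hp : 1 < p) :
    Summable fun ρ : upperZeros ↦ 1 / ‖deriv riemannZeta ρ‖ ^ 2 * (1 + |(ρ : ℂ).im|) ^ (-p) := by
  set ε := (p - 1) / 2 with hε
  have hε0 : 0 < ε := by linarith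
  obtain ⟨C, hC0, hC⟩ := exists_J_le hRH hJ hε0
  set q : ℝ := 2 ^ (-ε) with hq
  have hq0 : 0 < q := by positivity
  have hq1 : q < 1 := Real.rpow_lt_one_of_one_lt_of_neg (by norm_num) (by linarith)
  have hsum : Summable fun j : ℕ ↦ q ^ j := summable_geometric_of_lt_one hq0.le hq1
  refine summable_of_sum_le (c := C * 2 ^ (1 + ε) * ∑' j : ℕ, q ^ j) (fun ρ ↦ by positivity)
    fun A ↦ ?_
  -- The `+ 1` keeps the argument of `Nat.log` nonzero for zeros below height `1`.
  let g : upperZeros → ℕ := fun ρ ↦ Nat.log 2 (⌊(ρ : ℂ).im⌋₊ + 1)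
  have hfib : ∀ j : ℕ, ∑ ρ ∈ A with g ρ = j,
      1 / ‖deriv riemannZeta ρ‖ ^ 2 * (1 + |(ρ : ℂ).im|) ^ (-p) ≤ C * 2 ^ (1 + ε) * q ^ j := by
    intro j
    have hmem : ∀ ρ ∈ A.filter (g · = j), (2 : ℝ) ^ j ≤ 1 + |(ρ : ℂ).im| ∧
        (ρ : ℂ).im ≤ 2 ^ (j + 1) := by
      intro ρ hρ
      have hj : Nat.log 2 (⌊(ρ : ℂ).im⌋₊ + 1) = j := (Finset.mem_filter.mp hρ).2
      have h0 := ρ.2.2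
      have a1 : 2 ^ j ≤ ⌊(ρ : ℂ).im⌋₊ + 1 := hj ▸ Nat.pow_log_le_self 2 (by omega)
      have a2 : ⌊(ρ : ℂ).im⌋₊ + 1 < 2 ^ (j + 1) := hj ▸ Nat.lt_pow_succ_log_self (by norm_num) _
      have b1 : ((2 : ℝ) ^ j) ≤ ⌊(ρ : ℂ).im⌋₊ + 1 := by exact_mod_cast a1
      have b2 : (⌊(ρ : ℂ).im⌋₊ + 1 : ℝ) < 2 ^ (j + 1) := by exact_mod_cast a2
      have c1 := Nat.floor_le h0.le
      have c2 := Nat.lt_floor_add_one (ρ : ℂ).im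
      rw [abs_of_pos h0]
      constructor <;> linarith
    have h1 : (1 : ℝ) ≤ 2 ^ (j + 1) := one_le_pow₀ (by norm_num)
    calc ∑ ρ ∈ A with g ρ = j, 1 / ‖deriv riemannZeta ρ‖ ^ 2 * (1 + |(ρ : ℂ).im|) ^ (-p)
        ≤ ∑ ρ ∈ A with g ρ = j, 1 / ‖deriv riemannZeta ρ‖ ^ 2 * ((2 : ℝ) ^ j) ^ (-p) := by
          refine Finset.sum_le_sum fun ρ hρ ↦ ?_
          gcongr 1
          exact Real.rpow_le_rpow_of_nonpos (by positivity) (hmem ρ hρ).1 (by linarith)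
      _ = (∑ ρ ∈ A with g ρ = j, 1 / ‖deriv riemannZeta ρ‖ ^ 2) * ((2 : ℝ) ^ j) ^ (-p) := by
          rw [Finset.sum_mul]
      _ ≤ (C * (2 ^ (j + 1)) ^ (1 + ε)) * ((2 : ℝ) ^ j) ^ (-p) := by
          gcongr
          exact (sum_le_J hRH _ fun ρ hρ ↦ (hmem ρ hρ).2).trans (hC _ h1)
      _ = C * 2 ^ (1 + ε) * q ^ j := by
          rw [hq, pow_succ, Real.mul_rpow (by positivity) (by norm_num), ← Real.rpow_natCast 2 j,
            ← Real.rpow_natCast _ j, ← Real.rpow_mul (by norm_num), ← Real.rpow_mul (by norm_num),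
            ← Real.rpow_mul (by norm_num)]
          have : (2 : ℝ) ^ (-ε * j) = 2 ^ (j * (1 + ε)) * 2 ^ ((j : ℝ) * -p) := by
            rw [← Real.rpow_add (by norm_num)]
            congr 1
            rw [hε]
            ring
          rw [this]
          ring
  calc ∑ ρ ∈ A, 1 / ‖deriv riemannZeta ρ‖ ^ 2 * (1 + |(ρ : ℂ).im|) ^ (-p)
      = ∑ j ∈ A.image g, ∑ ρ ∈ A with g ρ = j,
          1 / ‖deriv riemannZeta ρ‖ ^ 2 * (1 + |(ρ : ℂ).im|) ^ (-p) :=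
        (Finset.sum_fiberwise_of_maps_to (fun ρ hρ ↦ Finset.mem_image_of_mem g hρ) _).symm
    _ ≤ ∑ j ∈ A.image g, C * 2 ^ (1 + ε) * q ^ j := Finset.sum_le_sum fun j _ ↦ hfib j
    _ = C * 2 ^ (1 + ε) * ∑ j ∈ A.image g, q ^ j := by rw [Finset.mul_sum]
    _ ≤ _ := by
        gcongr
        exact hsum.sum_le_tsum _ fun j _ ↦ by positivity

/-- The residue of `ζ(w/k) / (w ζ(w))` at a simple zero `ρ` of `ζ`. -/
noncomputable def zetaRes (k : ℕ) (ρ : ℂ) : ℂ := riemannZeta (ρ / k) / (ρ * deriv riemannZeta ρ)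

lemma norm_zetaRes_conj (k : ℕ) (ρ : ℂ) : ‖zetaRes k (conj ρ)‖ = ‖zetaRes k ρ‖ := by
  have : zetaRes k (conj ρ) = conj (zetaRes k ρ) := by
    rw [zetaRes, zetaRes, deriv_riemannZeta_conj, map_div₀, map_mul, ← riemannZeta_conj, map_div₀,
      conj_natCast]
  rw [this, norm_conj]

lemma betaTerm_eq (k : ℕ) (ρ : ℂ) : betaTerm k ρ = 2 * ‖zetaRes k ρ‖ ^ 2 := by
  rw [betaTerm, zetaRes, norm_div, div_pow]
  ring

/-- Weighted square summability of the residues. -/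
theorem summable_zetaRes (hRH : RiemannHypothesis)
    (hJ : ∀ ε : ℝ, 0 < ε → J =O[atTop] fun T : ℝ ↦ T ^ (1 + ε)) {k : ℕ} (hk : 2 ≤ k) :
    ∃ η : ℝ, 0 < η ∧ η ≤ 1 ∧
      Summable fun ρ : zeros ↦ ‖zetaRes k ρ‖ ^ 2 * (1 + |(ρ : ℂ).im|) ^ η := by
  have hk0 : (2 : ℝ) ≤ k := by exact_mod_cast hk
  -- `σ = re (ρ/k)`. The convexity bound squared over `|ρ|²` has exponent `-1 - σ/2`. Half of the
  -- saving pays for the weight `η = σ/4`; the other half leaves `p = 1 + σ/4 > 1`.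
  set σ : ℝ := 1 / (2 * k) with hσ
  have hσ0 : 0 < σ := by positivity
  have hσ1 : σ ≤ 1 / 4 := by
    rw [hσ]
    apply one_div_le_one_div_of_le <;> linarith
  obtain ⟨C, hC⟩ := exists_norm_riemannZeta_le_rpow hσ0 (by linarith)
  refine ⟨σ / 4, by positivity, by linarith, ?_⟩
  have hs := summable_upperZeros hRH hJ (p := 1 + σ / 4) (by linarith)
  have hz := (hasSum_zeros (f := fun ρ ↦ 1 / ‖deriv riemannZeta ρ‖ ^ 2 * (1 + |ρ.im|) ^ (-(1 + σ / 4)))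
    (fun ρ ↦ by simp [deriv_riemannZeta_conj]) hs.hasSum).summable
  refine Summable.of_nonneg_of_le (fun ρ ↦ by positivity) (fun ρ ↦ ?_) (hz.mul_left (16 * C ^ 2))
  have hre := re_of_mem_zeros hRH ρ.2
  have hy : 0 < 1 + |(ρ : ℂ).im| := by positivity
  have e1 := hC (ρ / k) (by
    rw [div_natCast_re, hre, hσ]
    ring)
  rw [div_natCast_im] at e1
  have hC0 : 0 ≤ C := by
    by_contra! h
    have := (norm_nonneg _).trans e1
    have h2 : 0 < (1 + |(ρ : ℂ).im / k|) ^ (1 / 2 - σ / 4) := by positivity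
    nlinarith
  have e2 : ‖riemannZeta (ρ / k)‖ ≤ C * (1 + |(ρ : ℂ).im|) ^ (1 / 2 - σ / 4) := by
    have h1 : |(ρ : ℂ).im / k| ≤ |(ρ : ℂ).im| := by
      rw [abs_div, Nat.abs_cast]
      exact div_le_self (abs_nonneg _) (by linarith)
    refine e1.trans ?_
    gcongr 2
    · linarith
    · linarith
  have e3 : (1 + |(ρ : ℂ).im|) ≤ 4 * ‖(ρ : ℂ)‖ := by
    have a1 := abs_re_le_norm (ρ : ℂ)
    have a2 := abs_im_le_norm (ρ : ℂ)
    rw [hre, abs_of_pos (by norm_num)] at a1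
    linarith
  have e4 : 1 / ‖(ρ : ℂ)‖ ≤ 4 / (1 + |(ρ : ℂ).im|) := by
    rw [div_le_div_iff₀ (by linarith) hy]
    linarith
  set y := 1 + |(ρ : ℂ).im|
  set d := ‖deriv riemannZeta (ρ : ℂ)‖
  have e5 : ‖zetaRes k ρ‖ = ‖riemannZeta (ρ / k)‖ * (1 / ‖(ρ : ℂ)‖) * (1 / d) := by
    rw [zetaRes, norm_div, norm_mul, div_eq_mul_inv, mul_inv]
    ring
  rw [e5]
  calc (‖riemannZeta (ρ / k)‖ * (1 / ‖(ρ : ℂ)‖) * (1 / d)) ^ 2 * y ^ (σ / 4)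
      ≤ ((C * y ^ (1 / 2 - σ / 4)) * (4 / y) * (1 / d)) ^ 2 * y ^ (σ / 4) := by gcongr
    _ = 16 * C ^ 2 * (1 / d ^ 2 * ((y ^ (1 / 2 - σ / 4)) ^ 2 * (y⁻¹) ^ 2 * y ^ (σ / 4))) := by ring
    _ = _ := by
        congr 2
        rw [← Real.rpow_natCast, ← Real.rpow_natCast, ← Real.rpow_mul hy.le, ← Real.rpow_neg_one,
          ← Real.rpow_mul hy.le, ← Real.rpow_add hy, ← Real.rpow_add hy]
        congr 1
        push_cast
        ring

end KFree

/-! ### Smoothed sums of simple fractions over the zeros, and their mean squares. -/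

namespace KFree
open MeasureTheory Filter Topology Complex Metric
open scoped ENNReal Real ComplexConjugate

/-- An entire function with value `1` at `0` decaying rapidly in vertical strips. -/
noncomputable def gaussKer (z : ℂ) : ℂ := cexp (z ^ 2)

lemma differentiable_gaussKer : Differentiable ℂ gaussKer := by
  unfold gaussKer
  fun_prop

@[simp] lemma gaussKer_zero : gaussKer 0 = 1 := by simp [gaussKer]

lemma norm_gaussKer (z : ℂ) : ‖gaussKer z‖ = Real.exp (z.re ^ 2 - z.im ^ 2) := by
  rw [gaussKer, Complex.norm_exp]
  congr 1
  rw [sq, mul_re]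
  ring

lemma exists_norm_gaussKer_le (X : ℝ) (n : ℕ) :
    ∃ C : ℝ, 0 < C ∧ ∀ z : ℂ, |z.re| ≤ X → ‖gaussKer z‖ * (1 + |z.im|) ^ n ≤ C := by
  refine ⟨Real.exp (X ^ 2) * Real.exp ((n + 2) ^ 2 / (4 * 1)), by positivity, fun z hz ↦ ?_⟩
  have h1 := pow_mul_exp_neg_mul_sq_le n one_pos z.im
  have h2 : Real.exp ((n + 2) ^ 2 / (4 * 1)) / (1 + z.im ^ 2) ≤ Real.exp ((n + 2) ^ 2 / (4 * 1)) :=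
    div_le_self (by positivity) (by nlinarith [sq_nonneg z.im])
  have h3 : z.re ^ 2 ≤ X ^ 2 := by
    rw [← sq_abs z.re]
    gcongr
  rw [norm_gaussKer, sub_eq_add_neg, Real.exp_add]
  calc Real.exp (z.re ^ 2) * Real.exp (-z.im ^ 2) * (1 + |z.im|) ^ n
      = Real.exp (z.re ^ 2) * ((1 + |z.im|) ^ n * Real.exp (-(1 * z.im ^ 2))) := by
        rw [one_mul]; ring
    _ ≤ _ := by
        gcongr
        exact h1.trans h2

lemma differentiable_dslope {f : ℂ → ℂ} (hf : Differentiable ℂ f) (a : ℂ) :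
    Differentiable ℂ (dslope f a) := by
  rw [← differentiableOn_univ, differentiableOn_dslope univ_mem, differentiableOn_univ]
  exact hf

/-- At distance at least `1` from `a` the division costs nothing. Nearer to `a`, the maximum
principle on the unit disc about `a`, which lies within distance `2` of `w`, applies. The bound is
uniform in `a`. -/
lemma norm_dslope_le {f : ℂ → ℂ} (hf : Differentiable ℂ f) {a w : ℂ} (ha : f a = 0) {M : ℝ}
    (hM : ∀ z ∈ closedBall w 2, ‖f z‖ ≤ M) : ‖dslope f a w‖ ≤ M := by
  have key : ∀ z ∈ closedBall w 2, 1 ≤ ‖z - a‖ → ‖dslope f a z‖ ≤ M := by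
    intro z hz h
    have hne : z ≠ a := by
      rintro rfl
      simp at h
      linarith
    rw [dslope_of_ne _ hne, slope_def_field, ha, sub_zero, norm_div]
    exact (div_le_self (norm_nonneg _) h).trans (hM z hz)
  rcases le_total 1 ‖w - a‖ with h | h
  · exact key w (mem_closedBall_self (by norm_num)) h
  · have hd := differentiable_dslope hf a
    refine norm_le_of_forall_mem_frontier_norm_le (U := ball a 1) isBounded_ball hd.diffContOnCl ?_ ?_
    · intro z hz
      rw [frontier_ball a one_ne_zero, mem_sphere, dist_eq] at hz
      refine key z ?_ hz.ge
      rw [mem_closedBall, dist_eq]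
      calc ‖z - w‖ = ‖(z - a) - (w - a)‖ := by ring_nf
        _ ≤ ‖z - a‖ + ‖w - a‖ := norm_sub_le _ _
        _ ≤ 2 := by linarith
    · rw [closure_ball a one_ne_zero, mem_closedBall, dist_eq]
      exact h

lemma lintegral_inv_sq_add_sq {δ : ℝ} (hδ : 0 < δ) (γ : ℝ) :
    ∫⁻ t : ℝ, ENNReal.ofReal ((δ ^ 2 + (2 * π * t - γ) ^ 2)⁻¹) = ENNReal.ofReal (1 / (2 * δ)) := by
  have e : (fun t : ℝ ↦ (δ ^ 2 + (2 * π * t - γ) ^ 2)⁻¹)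
      = fun t : ℝ ↦ (δ ^ 2)⁻¹ * (1 + (2 * π / δ * (t - γ / (2 * π))) ^ 2)⁻¹ := by
    ext t
    rw [← mul_inv]
    congr 1
    field_simp
  have hc : 2 * π / δ ≠ 0 := by positivity
  have hint : Integrable fun t : ℝ ↦ (δ ^ 2 + (2 * π * t - γ) ^ 2)⁻¹ := by
    rw [e]
    exact ((integrable_inv_one_add_sq.comp_mul_left' hc).comp_sub_right (γ / (2 * π))).const_mul _
  rw [← ofReal_integral_eq_lintegral_ofReal hint (Eventually.of_forall fun t ↦ by positivity), e,
    integral_const_mul,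
    integral_sub_right_eq_self (fun t : ℝ ↦ (1 + (2 * π / δ * t) ^ 2)⁻¹),
    Measure.integral_comp_mul_left (fun t : ℝ ↦ (1 + t ^ 2)⁻¹), integral_univ_inv_one_add_sq,
    abs_of_pos (by positivity)]
  congr 1
  rw [smul_eq_mul]
  field_simp

/-- The smoothed sum of simple fractions with poles at the zeros of `ζ`. -/
noncomputable def poleSum (c : zeros → ℂ) (w : ℂ) : ℂ :=
  ∑' ρ : zeros, c ρ * (gaussKer (w - ρ) / (w - ρ))

lemma exists_norm_gaussKer_sub_le (hRH : RiemannHypothesis) (X : ℝ) (n : ℕ) :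
    ∃ C : ℝ, 0 < C ∧ ∀ (w : ℂ) (ρ : zeros), |w.re| ≤ X →
      ‖gaussKer (w - ρ)‖ ≤ C * (1 + |w.im - (ρ : ℂ).im|) ^ (-n : ℝ) := by
  obtain ⟨C, hC0, hC⟩ := exists_norm_gaussKer_le (X + 1 / 2) n
  refine ⟨C, hC0, fun w ρ hw ↦ ?_⟩
  have h := hC (w - ρ) (by
    rw [sub_re, re_of_mem_zeros hRH ρ.2]
    refine (abs_sub _ _).trans ?_
    rw [abs_of_pos (show (0 : ℝ) < 1 / 2 by norm_num)]
    linarith)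
  rw [sub_im] at h
  rw [Real.rpow_neg (by positivity), Real.rpow_natCast, ← div_eq_mul_inv, le_div_iff₀ (by positivity)]
  exact h

lemma exists_sum_gaussKer_le (hRH : RiemannHypothesis) (X : ℝ) {η : ℝ} (hη : 0 < η) (hη1 : η ≤ 1) :
    ∃ C : ℝ, 0 < C ∧ ∀ (w : ℂ) (A : Finset zeros), |w.re| ≤ X →
      ∑ ρ ∈ A, ‖gaussKer (w - ρ)‖ ≤ C * (1 + |w.im|) ^ η := by
  obtain ⟨C, hC0, hC⟩ := exists_norm_gaussKer_sub_le hRH X 4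
  obtain ⟨B, hB0, hB⟩ := exists_sum_zeros_le hRH hη hη1
  refine ⟨C * B, by positivity, fun w A hw ↦ ?_⟩
  calc ∑ ρ ∈ A, ‖gaussKer (w - ρ)‖
      ≤ ∑ ρ ∈ A, C * (1 + |w.im - (ρ : ℂ).im|) ^ (-4 : ℝ) :=
        Finset.sum_le_sum fun ρ _ ↦ by simpa using hC w ρ hw
    _ = C * ∑ ρ ∈ A, (1 + |w.im - (ρ : ℂ).im|) ^ (-4 : ℝ) := by rw [Finset.mul_sum]
    _ ≤ C * (B * (1 + |w.im|) ^ η) := by gcongr; exact hB _ _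
    _ = _ := by ring

/-- The mean square of `poleSum` on a vertical line near the critical line. -/
theorem exists_lineNorm_poleSum_le (hRH : RiemannHypothesis) (X : ℝ) {η : ℝ} (hη : 0 < η)
    (hη1 : η ≤ 1) : ∃ C : ℝ, 0 < C ∧ ∀ (σ : ℝ) (c : zeros → ℂ), |σ| ≤ X → σ ≠ 1 / 2 →
      Summable (fun ρ : zeros ↦ ‖c ρ‖ ^ 2 * (1 + |(ρ : ℂ).im|) ^ η) →
      lineNorm (poleSum c) σ
        ≤ ENNReal.ofReal (C / |σ - 1 / 2| * ∑' ρ : zeros, ‖c ρ‖ ^ 2 * (1 + |(ρ : ℂ).im|) ^ η) := by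
  obtain ⟨B, hB0, hB⟩ := exists_sum_gaussKer_le hRH X hη hη1
  obtain ⟨K, hK0, hK⟩ := exists_norm_gaussKer_sub_le hRH X 1
  refine ⟨B * K / 2, by positivity, fun σ c hσ hσ2 hs ↦ ?_⟩
  set δ := |σ - 1 / 2| with hδ
  have hδ0 : 0 < δ := abs_pos.mpr (sub_ne_zero.mpr hσ2)
  let w : ℝ → ℂ := fun t ↦ σ + 2 * π * t * I
  have hwre : ∀ t, (w t).re = σ := fun t ↦ by simp [w]
  have hwim : ∀ t, (w t).im = 2 * π * t := fun t ↦ by simp [w]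
  have hden : ∀ t (ρ : zeros), ‖w t - ρ‖ ^ 2 = δ ^ 2 + (2 * π * t - (ρ : ℂ).im) ^ 2 := by
    intro t ρ
    rw [← normSq_eq_norm_sq, normSq_apply, sub_re, sub_im, hwre, hwim, re_of_mem_zeros hRH ρ.2, hδ,
      sq_abs]
    ring
  set b : ℝ → ℝ := fun t ↦ B * (1 + |2 * π * t|) ^ η with hb
  set g : zeros → ℝ → ℝ := fun ρ t ↦ ‖c ρ‖ ^ 2 * (‖gaussKer (w t - ρ)‖ / ‖w t - ρ‖ ^ 2) with hg
  -- Cauchy–Schwarz with the Gaussian split into two square roots: one factor is a smoothed count of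
  -- zeros near height `2πt`, of size `(1+|2πt|)^η`; the other keeps the coefficients.
  have hpt : ∀ t, ‖poleSum c (w t)‖ₑ ^ 2 ≤ ∑' ρ : zeros, ENNReal.ofReal (b t * g ρ t) := by
    intro t
    by_cases hsum : Summable fun ρ : zeros ↦ c ρ * (gaussKer (w t - ρ) / (w t - ρ))
    · refine le_of_tendsto ((ENNReal.continuous_pow 2).comp continuous_enorm |>.continuousAt.tendsto.comp
        hsum.hasSum) (Eventually.of_forall fun A ↦ ?_)
      have h1 : ‖∑ ρ ∈ A, c ρ * (gaussKer (w t - ρ) / (w t - ρ))‖ ^ 2 ≤ b t * ∑ ρ ∈ A, g ρ t := by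
        have h2 : ‖∑ ρ ∈ A, c ρ * (gaussKer (w t - ρ) / (w t - ρ))‖
            ≤ ∑ ρ ∈ A, √‖gaussKer (w t - ρ)‖ * (‖c ρ‖ * (√‖gaussKer (w t - ρ)‖ / ‖w t - ρ‖)) := by
          refine (norm_sum_le _ _).trans (Finset.sum_le_sum fun ρ _ ↦ le_of_eq ?_)
          rw [norm_mul, norm_div]
          nth_rewrite 1 [← Real.mul_self_sqrt (norm_nonneg (gaussKer (w t - ρ)))]
          ring
        calc _ ≤ (∑ ρ ∈ A, √‖gaussKer (w t - ρ)‖ *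
                (‖c ρ‖ * (√‖gaussKer (w t - ρ)‖ / ‖w t - ρ‖))) ^ 2 := by gcongr
          _ ≤ (∑ ρ ∈ A, √‖gaussKer (w t - ρ)‖ ^ 2) *
                ∑ ρ ∈ A, (‖c ρ‖ * (√‖gaussKer (w t - ρ)‖ / ‖w t - ρ‖)) ^ 2 :=
              Finset.sum_mul_sq_le_sq_mul_sq _ _ _
          _ = (∑ ρ ∈ A, ‖gaussKer (w t - ρ)‖) * ∑ ρ ∈ A, g ρ t := by
              simp only [mul_pow, div_pow, Real.sq_sqrt (norm_nonneg _), hg]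
          _ ≤ b t * ∑ ρ ∈ A, g ρ t := by
              gcongr
              have := hB (w t) A (by rwa [hwre])
              rwa [hwim] at this
      simp only [Function.comp_apply]
      calc ‖∑ ρ ∈ A, c ρ * (gaussKer (w t - ρ) / (w t - ρ))‖ₑ ^ 2
          = ENNReal.ofReal (‖∑ ρ ∈ A, c ρ * (gaussKer (w t - ρ) / (w t - ρ))‖ ^ 2) := by
            rw [ENNReal.ofReal_pow (norm_nonneg _), ofReal_norm]
        _ ≤ ENNReal.ofReal (∑ ρ ∈ A, b t * g ρ t) := by
            rw [← Finset.mul_sum]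
            exact ENNReal.ofReal_le_ofReal h1
        _ = ∑ ρ ∈ A, ENNReal.ofReal (b t * g ρ t) :=
            ENNReal.ofReal_sum_of_nonneg fun ρ _ ↦ by positivity
        _ ≤ _ := ENNReal.sum_le_tsum _
    -- A divergent series has the default sum `0`, so the bound is trivial there and no convergence
    -- has to be proved.
    · rw [poleSum, tsum_eq_zero_of_not_summable hsum]
      simp
  -- The weight moves from `2πt` to `γ` at the price of one factor `1 + |2πt - γ|`, absorbed by the
  -- remaining Gaussian. A Cauchy kernel of total mass `1/(2δ)` is left for each zero.
  have hbg : ∀ ρ t, b t * g ρ t ≤ B * K * (‖c ρ‖ ^ 2 * (1 + |(ρ : ℂ).im|) ^ η) *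
      (δ ^ 2 + (2 * π * t - (ρ : ℂ).im) ^ 2)⁻¹ := by
    intro ρ t
    have h1 := hK (w t) ρ (by rwa [hwre])
    rw [hwim, Nat.cast_one, Real.rpow_neg (by positivity), Real.rpow_one] at h1
    have h2 : (1 + |2 * π * t|) ^ η ≤ (1 + |(ρ : ℂ).im|) ^ η * (1 + |2 * π * t - (ρ : ℂ).im|) := by
      calc (1 + |2 * π * t|) ^ η
          ≤ ((1 + |(ρ : ℂ).im|) * (1 + |2 * π * t - (ρ : ℂ).im|)) ^ η := by
            have h3 := abs_sub_abs_le_abs_sub (2 * π * t) (ρ : ℂ).im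
            refine Real.rpow_le_rpow (by positivity) ?_ hη.le
            nlinarith [abs_nonneg (ρ : ℂ).im, abs_nonneg (2 * π * t - (ρ : ℂ).im)]
        _ = (1 + |(ρ : ℂ).im|) ^ η * (1 + |2 * π * t - (ρ : ℂ).im|) ^ η :=
            Real.mul_rpow (by positivity) (by positivity)
        _ ≤ _ := by
            gcongr
            exact Real.rpow_le_self_of_one_le
              (by linarith [abs_nonneg (2 * π * t - (ρ : ℂ).im)]) hη1
    have hv : 0 < 1 + |2 * π * t - (ρ : ℂ).im| := by positivity
    simp only [hb, hg]
    rw [hden]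
    calc B * (1 + |2 * π * t|) ^ η * (‖c ρ‖ ^ 2 * (‖gaussKer (w t - ρ)‖ /
            (δ ^ 2 + (2 * π * t - (ρ : ℂ).im) ^ 2)))
        ≤ B * ((1 + |(ρ : ℂ).im|) ^ η * (1 + |2 * π * t - (ρ : ℂ).im|)) * (‖c ρ‖ ^ 2 *
          ((K * (1 + |2 * π * t - (ρ : ℂ).im|)⁻¹) / (δ ^ 2 + (2 * π * t - (ρ : ℂ).im) ^ 2))) := by
          gcongr
      _ = B * K * (‖c ρ‖ ^ 2 * (1 + |(ρ : ℂ).im|) ^ η) *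
          (δ ^ 2 + (2 * π * t - (ρ : ℂ).im) ^ 2)⁻¹ *
          ((1 + |2 * π * t - (ρ : ℂ).im|) * (1 + |2 * π * t - (ρ : ℂ).im|)⁻¹) := by ring
      _ = _ := by rw [mul_inv_cancel₀ hv.ne', mul_one]
  calc lineNorm (poleSum c) σ = ∫⁻ t, ‖poleSum c (w t)‖ₑ ^ 2 := rfl
    _ ≤ ∫⁻ t, ∑' ρ : zeros, ENNReal.ofReal (B * K * (‖c ρ‖ ^ 2 * (1 + |(ρ : ℂ).im|) ^ η)) *
          ENNReal.ofReal ((δ ^ 2 + (2 * π * t - (ρ : ℂ).im) ^ 2)⁻¹) := by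
        refine lintegral_mono fun t ↦ (hpt t).trans (ENNReal.tsum_le_tsum fun ρ ↦ ?_)
        rw [← ENNReal.ofReal_mul (by positivity)]
        exact ENNReal.ofReal_le_ofReal (hbg ρ t)
    _ = ∑' ρ : zeros, ENNReal.ofReal (B * K * (‖c ρ‖ ^ 2 * (1 + |(ρ : ℂ).im|) ^ η)) *
          ENNReal.ofReal (1 / (2 * δ)) := by
        rw [lintegral_tsum fun ρ ↦ by fun_prop]
        congr 1 with ρ
        rw [lintegral_const_mul _ (by fun_prop), lintegral_inv_sq_add_sq hδ0]
    _ = ∑' ρ : zeros, ENNReal.ofReal (B * K / 2 / δ * (‖c ρ‖ ^ 2 * (1 + |(ρ : ℂ).im|) ^ η)) := by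
        congr 1 with ρ
        rw [← ENNReal.ofReal_mul (by positivity)]
        congr 1
        field_simp
    _ = _ := by
        rw [← ENNReal.ofReal_tsum_of_nonneg (fun ρ ↦ by positivity) (hs.mul_left _), tsum_mul_left]

end KFree

/-! ### The transform with all polar parts removed: holomorphy and polynomial growth. -/

namespace KFree
open MeasureTheory Filter Topology Complex Metric
open scoped ENNReal Real ComplexConjugate

/-- Polynomial growth in every vertical strip. -/
def PolyGrowth (f : ℂ → ℂ) : Prop :=
  ∀ X : ℝ, ∃ (C : ℝ) (n : ℕ), 0 ≤ C ∧ ∀ z : ℂ, |z.re| ≤ X → ‖f z‖ ≤ C * (1 + |z.im|) ^ n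

lemma PolyGrowth.mul {f g : ℂ → ℂ} (hf : PolyGrowth f) (hg : PolyGrowth g) :
    PolyGrowth fun z ↦ f z * g z := by
  intro X
  obtain ⟨C, n, hC0, hC⟩ := hf X
  obtain ⟨B, m, hB0, hB⟩ := hg X
  refine ⟨C * B, n + m, by positivity, fun z hz ↦ ?_⟩
  rw [norm_mul, pow_add]
  calc ‖f z‖ * ‖g z‖ ≤ (C * (1 + |z.im|) ^ n) * (B * (1 + |z.im|) ^ m) := by
        gcongr
        exacts [hC z hz, hB z hz]
    _ = _ := by ring

lemma PolyGrowth.add {f g : ℂ → ℂ} (hf : PolyGrowth f) (hg : PolyGrowth g) :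
    PolyGrowth fun z ↦ f z + g z := by
  intro X
  obtain ⟨C, n, hC0, hC⟩ := hf X
  obtain ⟨B, m, hB0, hB⟩ := hg X
  refine ⟨C + B, n + m, by positivity, fun z hz ↦ ?_⟩
  have hy : 1 ≤ 1 + |z.im| := by linarith [abs_nonneg z.im]
  refine (norm_add_le _ _).trans ?_
  rw [add_mul]
  gcongr
  · refine (hC z hz).trans ?_
    gcongr
    omega
  · refine (hB z hz).trans ?_
    gcongr
    omega

lemma PolyGrowth.const (c : ℂ) : PolyGrowth fun _ ↦ c :=
  fun _ ↦ ⟨‖c‖, 0, norm_nonneg _, fun z _ ↦ by simp⟩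

lemma PolyGrowth.id : PolyGrowth fun z ↦ z := fun X ↦
  ⟨1 + |X|, 1, by positivity, fun z hz ↦ by
    rw [pow_one]
    exact norm_le_re_add_im (hz.trans (le_abs_self X))⟩

lemma PolyGrowth.sub {f g : ℂ → ℂ} (hf : PolyGrowth f) (hg : PolyGrowth g) :
    PolyGrowth fun z ↦ f z - g z := by
  have := hf.add ((PolyGrowth.const (-1)).mul hg)
  simpa [sub_eq_add_neg] using this

lemma PolyGrowth.comp_div_natCast {f : ℂ → ℂ} (hf : PolyGrowth f) {k : ℕ} (hk : 1 ≤ k) :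
    PolyGrowth fun z ↦ f (z / k) := by
  intro X
  obtain ⟨C, n, hC0, hC⟩ := hf X
  have hk' : (1 : ℝ) ≤ k := by exact_mod_cast hk
  have hle : ∀ x : ℝ, |x / k| ≤ |x| := fun x ↦ by
    rw [abs_div, Nat.abs_cast]
    exact div_le_self (abs_nonneg _) hk'
  refine ⟨C, n, hC0, fun z hz ↦ ?_⟩
  refine (hC (z / k) ?_).trans ?_
  · rw [div_natCast_re]
    exact (hle _).trans hz
  · rw [div_natCast_im]
    gcongr C * (1 + ?_) ^ n
    exact hle _

lemma PolyGrowth.riemannZeta₁ : PolyGrowth riemannZeta₁ := exists_norm_riemannZeta₁_le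

lemma PolyGrowth.gaussKer : PolyGrowth gaussKer := by
  intro X
  obtain ⟨C, hC0, hC⟩ := exists_norm_gaussKer_le X 0
  exact ⟨C, 0, hC0.le, fun z hz ↦ by simpa using hC z hz⟩

lemma PolyGrowth.exists_norm_dslope_le {f : ℂ → ℂ} (hf : PolyGrowth f) (hd : Differentiable ℂ f)
    (X : ℝ) : ∃ (C : ℝ) (n : ℕ), 0 ≤ C ∧ ∀ a w : ℂ, f a = 0 → |w.re| ≤ X →
      ‖dslope f a w‖ ≤ C * (1 + |w.im|) ^ n := by
  obtain ⟨C, n, hC0, hC⟩ := hf (X + 2)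
  refine ⟨C * 3 ^ n, n, by positivity, fun a w ha hw ↦ ?_⟩
  refine norm_dslope_le hd ha fun z hz ↦ ?_
  rw [mem_closedBall, dist_eq] at hz
  have h1 := (abs_re_le_norm (z - w)).trans hz
  have h2 := (abs_im_le_norm (z - w)).trans hz
  rw [sub_re] at h1
  rw [sub_im] at h2
  refine (hC z ?_).trans ?_
  · have := abs_sub_abs_le_abs_sub z.re w.re
    linarith
  · have := abs_sub_abs_le_abs_sub z.im w.im
    rw [mul_assoc, ← mul_pow]
    gcongr
    linarith [abs_nonneg w.im]

lemma PolyGrowth.dslope {f : ℂ → ℂ} (hf : PolyGrowth f) (hd : Differentiable ℂ f) {a : ℂ}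
    (ha : f a = 0) : PolyGrowth (dslope f a) := by
  intro X
  obtain ⟨C, n, hC0, hC⟩ := hf.exists_norm_dslope_le hd X
  exact ⟨C, n, hC0, fun z hz ↦ hC a z ha hz⟩

/-- The quotient `H / D`, continued to the simple zeros of `D` at which `H` vanishes. -/
noncomputable def regQuot (H D : ℂ → ℂ) (w : ℂ) : ℂ :=
  open Classical in if D w = 0 then deriv H w / deriv D w else H w / D w

lemma eq_sub_mul_dslope {f : ℂ → ℂ} {a : ℂ} (ha : f a = 0) (w : ℂ) :
    f w = (w - a) * dslope f a w := by
  have := sub_smul_dslope f a w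
  rw [ha, sub_zero, smul_eq_mul] at this
  exact this.symm

/-- Near a simple common zero the quotient equals the quotient of the two divided differences, whose
denominator does not vanish; its value there is the ratio of derivatives. -/
lemma differentiableAt_regQuot {H D : ℂ → ℂ} (hH : Differentiable ℂ H) (hD : Differentiable ℂ D)
    {a : ℂ} (h : D a = 0 → H a = 0 ∧ deriv D a ≠ 0) : DifferentiableAt ℂ (regQuot H D) a := by
  by_cases ha : D a = 0
  · obtain ⟨hHa, hDa⟩ := h ha
    have hDd := differentiable_dslope hD a
    have hHd := differentiable_dslope hH a
    have hne : dslope D a a ≠ 0 := by rwa [dslope_same]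
    have hev := hDd.continuous.continuousAt.eventually_ne hne
    have heq : regQuot H D =ᶠ[𝓝 a] fun w ↦ dslope H a w / dslope D a w := by
      filter_upwards [hev] with w hw
      by_cases hwa : w = a
      · subst hwa
        rw [regQuot, if_pos ha, dslope_same, dslope_same]
      · have h0 : w - a ≠ 0 := sub_ne_zero.mpr hwa
        have hDw : D w ≠ 0 := by
          rw [eq_sub_mul_dslope ha]
          exact mul_ne_zero h0 hw
        rw [regQuot, if_neg hDw, eq_sub_mul_dslope ha w, eq_sub_mul_dslope hHa w,
          mul_div_mul_left _ _ h0]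
    exact heq.differentiableAt_iff.mpr ((hHd a).div (hDd a) hne)
  · have hev := hD.continuous.continuousAt.eventually_ne ha
    have heq : regQuot H D =ᶠ[𝓝 a] fun w ↦ H w / D w := by
      filter_upwards [hev] with w hw
      rw [regQuot, if_neg hw]
    exact heq.differentiableAt_iff.mpr ((hH a).div (hD a) ha)

lemma regQuot_mul {H D : ℂ → ℂ} {a : ℂ} (h : D a = 0 → H a = 0) : H a = regQuot H D a * D a := by
  by_cases ha : D a = 0
  · rw [ha, mul_zero, h ha]
  · rw [regQuot, if_neg ha, div_mul_cancel₀ _ ha]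

/-- `w (w - 1) ζ(w)`. -/
noncomputable def denomFn (w : ℂ) : ℂ := w * riemannZeta₁ w

/-- The numerator of the Mellin transform of the error term, before removing the zero at `k`. -/
noncomputable def numerFn (k : ℕ) (w : ℂ) : ℂ :=
  k * (w - 1) * riemannZeta₁ (w / k) - w * riemannZeta₁ w / riemannZeta k

/-- The sum over the zeros, multiplied by `(w - 1) ζ(w)`. -/
noncomputable def zeroSum (k : ℕ) (w : ℂ) : ℂ :=
  ∑' ρ : zeros, zetaRes k ρ * (gaussKer (w - ρ) * dslope riemannZeta₁ ρ w)

/-- The numerator of the transform after removing all polar parts in `re w > -2`. -/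
noncomputable def regNumer (k : ℕ) (w : ℂ) : ℂ :=
  dslope (numerFn k) k w - gaussKer w * riemannZeta₁ w - w * zeroSum k w

lemma summable_of_sum_norm_le {ι : Type*} {f : ι → ℂ} {B : ℝ} (h : ∀ A : Finset ι, ∑ i ∈ A, ‖f i‖ ≤ B) :
    Summable f ∧ ‖∑' i, f i‖ ≤ B := by
  have hs : Summable fun i ↦ ‖f i‖ := summable_of_sum_le (fun _ ↦ norm_nonneg _) h
  refine ⟨hs.of_norm, (norm_tsum_le_tsum_norm hs).trans ?_⟩
  exact hs.tsum_le_of_sum_le h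

variable {k : ℕ}

lemma differentiable_denomFn : Differentiable ℂ denomFn := by
  unfold denomFn
  fun_prop

lemma PolyGrowth.denomFn : PolyGrowth denomFn := PolyGrowth.id.mul PolyGrowth.riemannZeta₁

lemma differentiable_numerFn (k : ℕ) : Differentiable ℂ (numerFn k) := by
  unfold numerFn
  have : Differentiable ℂ fun w : ℂ ↦ riemannZeta₁ (w / k) :=
    differentiable_riemannZeta₁.comp (by fun_prop)
  fun_prop

lemma PolyGrowth.numerFn (hk : 1 ≤ k) : PolyGrowth (numerFn k) := by
  unfold KFree.numerFn
  simp only [div_eq_mul_inv]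
  refine PolyGrowth.sub (.mul (.mul (.const _) (.sub .id (.const _))) ?_)
    (.mul (.mul .id .riemannZeta₁) (.const _))
  simpa only [div_eq_mul_inv] using PolyGrowth.riemannZeta₁.comp_div_natCast hk

lemma riemannZeta_natCast_ne_zero (hk : 2 ≤ k) : riemannZeta k ≠ 0 := by
  refine riemannZeta_ne_zero_of_one_lt_re ?_
  rw [natCast_re]
  exact_mod_cast hk

lemma natCast_ne_one (hk : 2 ≤ k) : (k : ℂ) ≠ 1 := by
  exact_mod_cast (by omega : k ≠ 1)

lemma numerFn_natCast (hk : 2 ≤ k) : numerFn k k = 0 := by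
  have hk0 : (k : ℂ) ≠ 0 := by exact_mod_cast (by omega : k ≠ 0)
  rw [numerFn, div_self hk0, riemannZeta₁_one, riemannZeta₁_of_ne (natCast_ne_one hk)]
  field_simp [riemannZeta_natCast_ne_zero hk]
  ring

lemma exists_sum_zeroSum_le (hRH : RiemannHypothesis) {R₀ : ℝ} (hR : ∀ ρ : zeros, ‖zetaRes k ρ‖ ≤ R₀)
    (X : ℝ) : ∃ (C : ℝ) (n : ℕ), 0 ≤ C ∧ ∀ (w : ℂ) (A : Finset zeros), |w.re| ≤ X →
      ∑ ρ ∈ A, ‖zetaRes k ρ * (gaussKer (w - ρ) * dslope riemannZeta₁ ρ w)‖ ≤ C * (1 + |w.im|) ^ n := by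
  obtain ⟨C, n, hC0, hC⟩ := PolyGrowth.riemannZeta₁.exists_norm_dslope_le differentiable_riemannZeta₁ X
  obtain ⟨B, hB0, hB⟩ := exists_sum_gaussKer_le hRH X one_pos le_rfl
  refine ⟨|R₀| * (B * C), n + 1, by positivity, fun w A hw ↦ ?_⟩
  calc ∑ ρ ∈ A, ‖zetaRes k ρ * (gaussKer (w - ρ) * dslope riemannZeta₁ ρ w)‖
      ≤ ∑ ρ ∈ A, |R₀| * (‖gaussKer (w - ρ)‖ * (C * (1 + |w.im|) ^ n)) := by
        refine Finset.sum_le_sum fun ρ _ ↦ ?_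
        rw [norm_mul, norm_mul]
        gcongr
        · exact (hR ρ).trans (le_abs_self _)
        · exact hC ρ w (riemannZeta₁_eq_zero_of_mem_zeros ρ.2) hw
    _ = |R₀| * ((∑ ρ ∈ A, ‖gaussKer (w - ρ)‖) * (C * (1 + |w.im|) ^ n)) := by
        rw [Finset.sum_mul, Finset.mul_sum]
    _ ≤ |R₀| * ((B * (1 + |w.im|)) * (C * (1 + |w.im|) ^ n)) := by
        gcongr
        simpa using hB w A hw
    _ = _ := by ring

lemma PolyGrowth.zeroSum (hRH : RiemannHypothesis) {R₀ : ℝ} (hR : ∀ ρ : zeros, ‖zetaRes k ρ‖ ≤ R₀) :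
    PolyGrowth (zeroSum k) := by
  intro X
  obtain ⟨C, n, hC0, hC⟩ := exists_sum_zeroSum_le hRH hR X
  exact ⟨C, n, hC0, fun w hw ↦ (summable_of_sum_norm_le fun A ↦ hC w A hw).2⟩

lemma summable_zeros (hRH : RiemannHypothesis) :
    Summable fun ρ : zeros ↦ (1 + |(ρ : ℂ).im|) ^ (-4 : ℝ) := by
  obtain ⟨C, _, hC⟩ := exists_sum_zeros_le hRH one_pos le_rfl
  refine summable_of_sum_le (c := C) (fun ρ ↦ by positivity) fun A ↦ ?_
  simpa using hC 0 A

lemma differentiable_zeroSum (hRH : RiemannHypothesis) {R₀ : ℝ}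
    (hR : ∀ ρ : zeros, ‖zetaRes k ρ‖ ≤ R₀) : Differentiable ℂ (zeroSum k) := by
  intro w₀
  set X := ‖w₀‖ + 1 with hX
  have hX0 : 0 < X := by positivity
  obtain ⟨C, n, hC0, hC⟩ := PolyGrowth.riemannZeta₁.exists_norm_dslope_le differentiable_riemannZeta₁ X
  obtain ⟨B, hB0, hB⟩ := exists_norm_gaussKer_sub_le hRH X 4
  have hd : DifferentiableOn ℂ (zeroSum k) (ball 0 X) := by
    refine differentiableOn_tsum_of_summable_norm (u := fun ρ : zeros ↦
      |R₀| * ((B * ((1 + X) ^ 4 * (1 + |(ρ : ℂ).im|) ^ (-4 : ℝ))) * (C * (1 + X) ^ n)))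
      ((((((summable_zeros hRH).mul_left _).mul_left _).mul_right _).mul_left _)) (fun ρ ↦ ?_)
      isOpen_ball fun ρ w hw ↦ ?_
    · have h1 := differentiable_dslope differentiable_riemannZeta₁ (ρ : ℂ)
      have h2 : Differentiable ℂ fun w : ℂ ↦ gaussKer (w - ρ) :=
        differentiable_gaussKer.comp (by fun_prop)
      exact ((h2.mul h1).const_mul _).differentiableOn
    · rw [mem_ball, dist_zero_right] at hw
      have hre := (abs_re_le_norm w).trans hw.le
      have him := (abs_im_le_norm w).trans hw.le
      have e1 := hB w ρ hre
      have e2 := hC ρ w (riemannZeta₁_eq_zero_of_mem_zeros ρ.2) hre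
      have e3 : (1 + |w.im - (ρ : ℂ).im|) ^ (-4 : ℝ) ≤ (1 + X) ^ 4 * (1 + |(ρ : ℂ).im|) ^ (-4 : ℝ) := by
        rw [Real.rpow_neg (by positivity), Real.rpow_neg (by positivity), ← div_eq_mul_inv,
          le_div_iff₀ (by positivity), inv_mul_le_iff₀ (by positivity)]
        norm_cast
        rw [← mul_pow]
        gcongr
        have := abs_sub_abs_le_abs_sub (ρ : ℂ).im w.im
        rw [abs_sub_comm] at this
        nlinarith [abs_nonneg (w.im - (ρ : ℂ).im)]
      push_cast at e1
      rw [norm_mul, norm_mul]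
      gcongr
      · exact (hR ρ).trans (le_abs_self _)
      · exact e1.trans (by gcongr)
      · exact e2.trans (by gcongr)
  exact hd.differentiableAt (isOpen_ball.mem_nhds (by simp [hX]))

lemma zeroSum_eq (w : ℂ) (hw : w ∉ zeros) :
    zeroSum k w = riemannZeta₁ w * poleSum (fun ρ ↦ zetaRes k ρ) w := by
  rw [zeroSum, poleSum, ← tsum_mul_left]
  congr 1 with ρ
  have hne : w ≠ ρ := by
    rintro rfl
    exact hw ρ.2
  have h0 : w - ρ ≠ 0 := sub_ne_zero.mpr hne
  rw [dslope_of_ne _ hne, slope_def_field, riemannZeta₁_eq_zero_of_mem_zeros ρ.2, sub_zero]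
  field_simp

/-- At a zero every divided difference based at another zero vanishes, and `gaussKer 0 = 1`; hence
the smoothing leaves the residue unchanged. -/
lemma zeroSum_of_mem {w : ℂ} (hw : w ∈ zeros) : zeroSum k w = zetaRes k w * deriv riemannZeta₁ w := by
  rw [zeroSum, tsum_eq_single (⟨w, hw⟩ : zeros)]
  · simp
  · intro ρ hρ
    have hne : w ≠ ρ := by
      rintro rfl
      exact hρ rfl
    rw [dslope_of_ne _ hne, slope_def_field, riemannZeta₁_eq_zero_of_mem_zeros ρ.2,
      riemannZeta₁_eq_zero_of_mem_zeros hw]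
    simp

lemma differentiable_regNumer (hRH : RiemannHypothesis) {R₀ : ℝ}
    (hR : ∀ ρ : zeros, ‖zetaRes k ρ‖ ≤ R₀) : Differentiable ℂ (regNumer k) :=
  ((differentiable_dslope (differentiable_numerFn k) _).sub
    (differentiable_gaussKer.mul differentiable_riemannZeta₁)).sub
    (differentiable_id.mul (differentiable_zeroSum hRH hR))

lemma PolyGrowth.regNumer (hRH : RiemannHypothesis) (hk : 2 ≤ k) {R₀ : ℝ}
    (hR : ∀ ρ : zeros, ‖zetaRes k ρ‖ ≤ R₀) : PolyGrowth (regNumer k) :=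
  .sub (.sub ((PolyGrowth.numerFn (by omega)).dslope (differentiable_numerFn k) (numerFn_natCast hk))
    (.mul .gaussKer .riemannZeta₁)) (.mul .id (.zeroSum hRH hR))

lemma dslope_numerFn (hk : 2 ≤ k) {w : ℂ} (hw : w ≠ k) :
    dslope (numerFn k) k w = numerFn k w / (w - k) := by
  rw [dslope_of_ne _ hw, slope_def_field, numerFn_natCast hk, sub_zero]

/-- Both `dslope (numerFn k) k` and `gaussKer * riemannZeta₁` take the value `riemannZeta₁ 0` at
`0`: the residue of the transform there is `1`. -/
lemma regNumer_zero (hk : 2 ≤ k) : regNumer k 0 = 0 := by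
  have hk0 : (k : ℂ) ≠ 0 := by exact_mod_cast (by omega : k ≠ 0)
  rw [regNumer, dslope_numerFn hk hk0.symm, numerFn]
  simp
  field_simp
  ring

/-- This cancellation is what determines `zetaRes`; simplicity of the zero permits the division by
`ζ'`. -/
lemma regNumer_of_mem_zeros (hsimple : ∀ ρ ∈ upperZeros, deriv riemannZeta ρ ≠ 0) (hk : 2 ≤ k) {w : ℂ}
    (hw : w ∈ zeros) : regNumer k w = 0 := by
  have hk0 : (k : ℂ) ≠ 0 := by exact_mod_cast (by omega : k ≠ 0)
  have hwk : w ≠ k := by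
    rintro rfl
    exact hw.2 (by simp)
  have hw0 : w ≠ 0 := by
    rintro rfl
    exact hw.2 (by simp)
  have hwk1 : w / k ≠ 1 := by
    intro h
    rw [div_eq_one_iff_eq hk0] at h
    exact hwk h
  have h1 : w - k ≠ 0 := sub_ne_zero.mpr hwk
  have hd := deriv_riemannZeta_ne_zero hsimple hw
  rw [regNumer, dslope_numerFn hk hwk, numerFn, zeroSum_of_mem hw, deriv_riemannZeta₁ hw,
    riemannZeta₁_eq_zero_of_mem_zeros hw, riemannZeta₁_of_ne hwk1, zetaRes]
  field_simp
  ring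

lemma riemannZeta₁_zero_ne : riemannZeta₁ 0 ≠ 0 := by
  rw [riemannZeta₁_of_ne zero_ne_one, riemannZeta_zero]
  norm_num

lemma denomFn_eq_zero (hRH : RiemannHypothesis) {w : ℂ} (hre : -2 < w.re) (h : denomFn w = 0) :
    w = 0 ∨ w ∈ zeros := by
  rcases mul_eq_zero.mp h with h | h
  · exact .inl h
  · exact .inr (mem_zeros_of_riemannZeta₁_eq_zero hRH h hre)

lemma deriv_denomFn (w : ℂ) : deriv denomFn w = riemannZeta₁ w + w * deriv riemannZeta₁ w := by
  unfold denomFn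
  rw [deriv_fun_mul differentiableAt_fun_id (differentiable_riemannZeta₁ w)]
  simp

lemma regNumer_and_deriv_denomFn (hRH : RiemannHypothesis)
    (hsimple : ∀ ρ ∈ upperZeros, deriv riemannZeta ρ ≠ 0) (hk : 2 ≤ k) {w : ℂ} (hre : -2 < w.re)
    (h : denomFn w = 0) : regNumer k w = 0 ∧ deriv denomFn w ≠ 0 := by
  rw [deriv_denomFn]
  rcases denomFn_eq_zero hRH hre h with rfl | hw
  · refine ⟨regNumer_zero hk, ?_⟩
    simpa using riemannZeta₁_zero_ne
  · refine ⟨regNumer_of_mem_zeros hsimple hk hw, ?_⟩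
    rw [riemannZeta₁_eq_zero_of_mem_zeros hw, zero_add]
    refine mul_ne_zero ?_ (deriv_riemannZeta₁_ne_zero hsimple hw)
    rintro rfl
    exact hw.2 (by simp)

/-- The transform of the error term with all its polar parts in `re w > -2` removed. -/
noncomputable def regTransform (k : ℕ) : ℂ → ℂ := regQuot (regNumer k) denomFn

lemma exists_le_norm_denomFn {σ : ℝ} (hσ : 1 < σ) :
    ∃ c : ℝ, 0 < c ∧ ∀ w : ℂ, w.re = σ → 1 ≤ c * ‖denomFn w‖ := by
  obtain ⟨C, hC0, hC⟩ := exists_norm_riemannZeta_le hσ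
  refine ⟨C / (σ * (σ - 1)), div_pos hC0 (mul_pos (by linarith) (by linarith)), fun w hw ↦ ?_⟩
  have hw1 : w ≠ 1 := by
    rintro rfl
    simp at hw
    linarith
  have h1 : σ ≤ ‖w‖ := hw ▸ re_le_norm w
  have h2 : σ - 1 ≤ ‖w - 1‖ := by
    have := re_le_norm (w - 1)
    rwa [sub_re, hw, one_re] at this
  have h3 := (hC w hw.ge).2
  have h4 : 0 < σ * (σ - 1) := mul_pos (by linarith) (by linarith)
  rw [denomFn, riemannZeta₁_of_ne hw1, norm_mul, norm_mul, div_mul_eq_mul_div, le_div_iff₀ h4, one_mul]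
  have h5 : σ * (σ - 1) ≤ ‖w‖ * ‖w - 1‖ :=
    mul_le_mul h1 h2 (by linarith) (norm_nonneg _)
  calc σ * (σ - 1) ≤ (‖w‖ * ‖w - 1‖) * (C * ‖riemannZeta w‖) := by nlinarith
    _ = _ := by ring

/-- The regularised transform is holomorphic of polynomial growth in a wide strip. -/
theorem stripFunction_regTransform (hRH : RiemannHypothesis)
    (hsimple : ∀ ρ ∈ upperZeros, deriv riemannZeta ρ ≠ 0) (hk : 2 ≤ k) {R₀ : ℝ}
    (hR : ∀ ρ : zeros, ‖zetaRes k ρ‖ ≤ R₀) : StripFunction (regTransform k) (-1) (k + 1) := by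
  have hk2 : (2 : ℝ) ≤ k := by exact_mod_cast hk
  have hHd := differentiable_regNumer hRH hR
  have hdiff : ∀ w : ℂ, -2 < w.re → DifferentiableAt ℂ (regTransform k) w := fun w hw ↦
    differentiableAt_regQuot hHd differentiable_denomFn
      (regNumer_and_deriv_denomFn hRH hsimple hk hw)
  refine ⟨fun w hw _ ↦ hdiff w (by linarith), ?_⟩
  obtain ⟨C₁, n₁, hC₁0, hC₁⟩ := PolyGrowth.denomFn (3 * k + 6)
  obtain ⟨C₂, n₂, hC₂0, hC₂⟩ := PolyGrowth.regNumer hRH hk hR (3 * k + 6)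
  obtain ⟨c, hc0, hc⟩ := exists_le_norm_denomFn (σ := k + 1) (by linarith)
  set L : ℝ := 2 * k + 6 with hL
  have hL1 : 1 ≤ L := by linarith
  refine ⟨(2 * ((C₁ + C₂) * L ^ (n₁ + n₂)) * c) ^ (4 * k + 9), (n₁ + n₂) * (4 * k + 9),
    fun w h1 h2 ↦ ?_⟩
  -- The disc of radius `k + 5/2` about `k + 1 + it` stays in `re > -2`, where the numerator
  -- vanishes at every zero of the denominator and those zeros are simple. Radius `k + 2` reaches
  -- the edge `re = -1`, and `1 + 2(k+2)/(1/2) = 4k + 9` is the exponent.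
  set z₀ : ℂ := (k + 1 : ℝ) + w.im * I with hz₀
  have hre : z₀.re = k + 1 := by simp [hz₀]
  have him : z₀.im = w.im := by simp [hz₀]
  set M : ℝ := (C₁ + C₂) * (L * (1 + |w.im|)) ^ (n₁ + n₂) with hM
  have hball : ∀ z ∈ closedBall z₀ (2 * (k + 5 / 2)), |z.re| ≤ 3 * k + 6 ∧
      1 + |z.im| ≤ L * (1 + |w.im|) := by
    intro z hz
    rw [mem_closedBall, dist_eq] at hz
    have a1 := (abs_re_le_norm (z - z₀)).trans hz
    have a2 := (abs_im_le_norm (z - z₀)).trans hz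
    rw [sub_re, hre, abs_le] at a1
    rw [sub_im, him] at a2
    have a3 := abs_sub_abs_le_abs_sub z.im w.im
    refine ⟨abs_le.mpr ⟨by linarith, by linarith⟩, ?_⟩
    nlinarith [abs_nonneg w.im]
  have hbound : ∀ (C : ℝ) (n : ℕ) (z : ℂ), 0 ≤ C → C ≤ C₁ + C₂ → n ≤ n₁ + n₂ →
      z ∈ closedBall z₀ (2 * (k + 5 / 2)) → C * (1 + |z.im|) ^ n ≤ M := by
    intro C n z hC hCC hn hz
    have h3 := (hball z hz).2
    have h4 : 1 ≤ L * (1 + |w.im|) := by nlinarith [abs_nonneg w.im]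
    calc C * (1 + |z.im|) ^ n ≤ (C₁ + C₂) * (L * (1 + |w.im|)) ^ n := by gcongr
      _ ≤ M := by
        rw [hM]
        gcongr
  have hlow := hc z₀ hre
  have hDne : denomFn z₀ ≠ 0 := by
    intro h
    rw [h] at hlow
    simp at hlow
    linarith
  have hreball : ∀ z ∈ ball z₀ (k + 5 / 2), -2 < z.re := by
    intro z hz
    rw [mem_ball, dist_eq] at hz
    have a1 := (abs_re_le_norm (z - z₀)).trans_lt hz
    rw [sub_re, hre, abs_lt] at a1
    linarith
  have hfin : {z ∈ ball z₀ (k + 5 / 2) | denomFn z = 0}.Finite := by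
    refine ((finite_zeros_inter_closedBall z₀ (k + 5 / 2)).union (Set.finite_singleton 0)).subset ?_
    rintro z ⟨hz, hz0⟩
    rcases denomFn_eq_zero hRH (hreball z hz) hz0 with h | h
    · exact .inr h
    · exact .inl ⟨h, ball_subset_closedBall hz⟩
  have key := norm_quotient_le (Q := regTransform k) (z := w) (c := z₀) (r := k + 2)
    (R := k + 5 / 2) (M := M) differentiable_denomFn hHd (by linarith) (by linarith)
    (fun z hz ↦ (hC₁ z (hball z hz).1).trans (hbound _ _ z hC₁0 (by linarith) (by omega) hz))
    (fun z hz ↦ (hC₂ z (hball z hz).1).trans (hbound _ _ z hC₂0 (by linarith) (by omega) hz))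
    (S := hfin.toFinset) (fun a ha ↦ by
      obtain ⟨ha1, ha2⟩ := hfin.mem_toFinset.mp ha
      obtain ⟨h3, h4⟩ := regNumer_and_deriv_denomFn hRH hsimple hk (hreball a ha1) ha2
      exact ⟨ha2, h3, h4, ha1⟩)
    (fun a ha ha2 ↦ hfin.mem_toFinset.mpr ⟨ha, ha2⟩) hDne
    (fun z hz ↦ (hdiff z (hreball z hz)).continuousAt.continuousWithinAt)
    (fun z hz ↦ regQuot_mul fun h ↦ (regNumer_and_deriv_denomFn hRH hsimple hk (hreball z hz) h).1)
    (by
      rw [mem_closedBall, dist_eq, show w - z₀ = ((w.re - (k + 1) : ℝ) : ℂ) by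
        apply Complex.ext <;> simp [hz₀], norm_real, Real.norm_eq_abs, abs_le]
      constructor <;> linarith)
  have e1 : (1 + 2 * (k + 2 : ℝ) / (k + 5 / 2 - (k + 2))) = (4 * k + 9 : ℕ) := by
    push_cast
    rw [show (k + 5 / 2 - (k + 2) : ℝ) = 1 / 2 by ring]
    ring
  rw [e1, Real.rpow_natCast] at key
  refine key.trans ?_
  rw [pow_mul, ← mul_pow]
  have hM0 : 0 ≤ M := by positivity
  have hn0 : 0 < ‖denomFn z₀‖ := norm_pos_iff.mpr hDne
  gcongr
  rw [div_le_iff₀ hn0]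
  calc 2 * M ≤ 2 * M * (c * ‖denomFn z₀‖) := le_mul_of_one_le_right (by positivity) hlow
    _ = _ := by rw [hM, mul_pow]; ring

end KFree

/-! ### The transform of the error term on the two edges of the strip. -/

namespace KFree
open MeasureTheory Filter Topology Complex Metric
open scoped ENNReal Real ComplexConjugate

variable {k : ℕ}

/-- The Laplace transform of the error term. -/
noncomputable def errTransform (k : ℕ) (w : ℂ) : ℂ := dslope (numerFn k) k w / denomFn w

lemma errTransform_eq (hk : 2 ≤ k) {w : ℂ} (h0 : w ≠ 0) (h1 : w ≠ 1) (hwk : w ≠ k)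
    (hz : riemannZeta w ≠ 0) :
    errTransform k w = riemannZeta (w / k) / (w * riemannZeta w) - 1 / (riemannZeta k * (w - k)) := by
  have hk0 : (k : ℂ) ≠ 0 := by exact_mod_cast (by omega : k ≠ 0)
  have hwk1 : w / k ≠ 1 := by
    intro h
    rw [div_eq_one_iff_eq hk0] at h
    exact hwk h
  have e1 : w - k ≠ 0 := sub_ne_zero.mpr hwk
  have e2 : w - 1 ≠ 0 := sub_ne_zero.mpr h1
  have e3 := riemannZeta_natCast_ne_zero hk
  rw [errTransform, denomFn, dslope_numerFn hk hwk, numerFn, riemannZeta₁_of_ne hwk1,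
    riemannZeta₁_of_ne h1]
  field_simp

/-- The regularised difference quotient `(exp (z²) - 1) / z`. -/
noncomputable def gaussSlope : ℂ → ℂ := dslope (fun z ↦ gaussKer z - 1) 0

lemma gaussSlope_of_ne {z : ℂ} (hz : z ≠ 0) : gaussSlope z = (gaussKer z - 1) / z := by
  rw [gaussSlope, dslope_of_ne _ hz, slope_def_field]
  simp

lemma exists_norm_gaussSlope_le (X : ℝ) :
    ∃ C : ℝ, 0 < C ∧ ∀ z : ℂ, |z.re| ≤ X → ‖gaussSlope z‖ ≤ C / (1 + |z.im|) := by
  obtain ⟨B, hB0, hB⟩ := exists_norm_gaussKer_le (X + 2) 0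
  have hB' : ∀ z : ℂ, |z.re| ≤ X + 2 → ‖gaussKer z - 1‖ ≤ B + 1 := fun z hz ↦ by
    have := hB z hz
    rw [pow_zero, mul_one] at this
    refine (norm_sub_le _ _).trans ?_
    simpa using this
  refine ⟨2 * (B + 1), by positivity, fun z hz ↦ ?_⟩
  rw [le_div_iff₀ (by positivity)]
  rcases le_total 1 |z.im| with h | h
  · have hz0 : z ≠ 0 := by
      rintro rfl
      simp at h
      linarith
    have h1 := abs_im_le_norm z
    have h2 := hB' z (by linarith)
    rw [gaussSlope_of_ne hz0, norm_div, div_mul_eq_mul_div, div_le_iff₀ (by linarith)]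
    nlinarith [norm_nonneg (gaussKer z - 1)]
  · have h1 : ‖gaussSlope z‖ ≤ B + 1 := by
      refine norm_dslope_le (by have := differentiable_gaussKer; fun_prop) (by simp) fun y hy ↦ hB' y ?_
      rw [mem_closedBall, dist_eq] at hy
      have h3 := (abs_re_le_norm (y - z)).trans hy
      rw [sub_re] at h3
      have := abs_sub_abs_le_abs_sub y.re z.re
      linarith
    nlinarith [norm_nonneg (gaussSlope z)]

/-- The constant is that of `(a+b+c)² ≤ 3(a²+b²+c²)`. Only `G` has to be measurable; `S` needs no
regularity because it is split off last, so `poleSum` may be used for it. -/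
lemma lineNorm_le_add {F G S : ℂ → ℂ} {σ C : ℝ} (hG : Continuous fun t : ℝ ↦ G (σ + 2 * π * t * I))
    (hF : ∀ w : ℂ, w.re = σ → ‖F w‖ ≤ C / (1 + |w.im|) + ‖G w‖ + ‖S w‖) :
    lineNorm F σ ≤ 3 * (ENNReal.ofReal (C ^ 2 * π) + lineNorm G σ + lineNorm S σ) := by
  have h1 : ∀ t : ℝ, ‖F (σ + 2 * π * t * I)‖ₑ ^ 2 ≤ 3 * (ENNReal.ofReal (C ^ 2 * (1 + t ^ 2)⁻¹)
      + ‖G (σ + 2 * π * t * I)‖ₑ ^ 2 + ‖S (σ + 2 * π * t * I)‖ₑ ^ 2) := by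
    intro t
    set w : ℂ := σ + 2 * π * t * I with hw
    have h2 := hF w (by simp [hw])
    have him : w.im = 2 * π * t := by simp [hw]
    rw [him] at h2
    have h3 : (C / (1 + |2 * π * t|)) ^ 2 ≤ C ^ 2 * (1 + t ^ 2)⁻¹ := by
      rw [div_pow, div_eq_mul_inv]
      gcongr
      rw [abs_mul, abs_of_pos (by positivity : 0 < 2 * π)]
      have h4 : |t| ≤ 2 * π * |t| := by
        nlinarith [abs_nonneg t, Real.pi_gt_three]
      nlinarith [abs_nonneg t, sq_abs t]
    have h5 : ‖F w‖ ^ 2 ≤ 3 * (C ^ 2 * (1 + t ^ 2)⁻¹ + ‖G w‖ ^ 2 + ‖S w‖ ^ 2) := by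
      set a := C / (1 + |2 * π * t|)
      have h6 : ‖F w‖ ^ 2 ≤ (a + ‖G w‖ + ‖S w‖) ^ 2 := by gcongr
      nlinarith [sq_nonneg (a - ‖G w‖), sq_nonneg (a - ‖S w‖), sq_nonneg (‖G w‖ - ‖S w‖)]
    calc ‖F w‖ₑ ^ 2 = ENNReal.ofReal (‖F w‖ ^ 2) := by
          rw [ENNReal.ofReal_pow (norm_nonneg _), ofReal_norm]
      _ ≤ ENNReal.ofReal (3 * (C ^ 2 * (1 + t ^ 2)⁻¹ + ‖G w‖ ^ 2 + ‖S w‖ ^ 2)) :=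
          ENNReal.ofReal_le_ofReal h5
      _ = _ := by
          rw [ENNReal.ofReal_mul (by norm_num), ENNReal.ofReal_add (by positivity) (by positivity),
            ENNReal.ofReal_add (by positivity) (by positivity), ENNReal.ofReal_pow (norm_nonneg _),
            ENNReal.ofReal_pow (norm_nonneg _), ofReal_norm, ofReal_norm, ENNReal.ofReal_ofNat]
  have hm : Measurable fun t : ℝ ↦ ENNReal.ofReal (C ^ 2 * (1 + t ^ 2)⁻¹) := by fun_prop
  have hmG : Measurable fun t : ℝ ↦ ‖G (σ + 2 * π * t * I)‖ₑ ^ 2 :=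
    (hG.measurable.enorm).pow_const 2
  have hmm : Measurable fun t : ℝ ↦
      ENNReal.ofReal (C ^ 2 * (1 + t ^ 2)⁻¹) + ‖G (σ + 2 * π * t * I)‖ₑ ^ 2 := hm.add hmG
  have hint : ∫⁻ t : ℝ, ENNReal.ofReal (C ^ 2 * (1 + t ^ 2)⁻¹) = ENNReal.ofReal (C ^ 2 * π) := by
    rw [← ofReal_integral_eq_lintegral_ofReal (integrable_inv_one_add_sq.const_mul _)
      (Eventually.of_forall fun t ↦ by positivity), integral_const_mul, integral_univ_inv_one_add_sq]
  calc lineNorm F σ ≤ ∫⁻ t : ℝ, 3 * (ENNReal.ofReal (C ^ 2 * (1 + t ^ 2)⁻¹)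
      + ‖G (σ + 2 * π * t * I)‖ₑ ^ 2 + ‖S (σ + 2 * π * t * I)‖ₑ ^ 2) := lintegral_mono h1
    _ = _ := by
      rw [lintegral_const_mul' _ _ (by norm_num), lintegral_add_left hmm,
        lintegral_add_left hm, hint]
      rfl

lemma one_add_abs_im_le {w : ℂ} {a : ℝ} {c : ℝ} (hc : 0 < c) (h : c ≤ |w.re - a|) :
    1 + |w.im| ≤ (1 + c⁻¹) * ‖w - a‖ := by
  have h1 := abs_re_le_norm (w - a)
  have h2 := abs_im_le_norm (w - a)
  simp only [sub_re, sub_im, ofReal_re, ofReal_im, sub_zero] at h1 h2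
  have h3 : 1 ≤ c⁻¹ * ‖w - a‖ := by
    rw [← div_eq_inv_mul, le_div_iff₀ hc]
    linarith
  linarith

lemma regTransform_eq {w : ℂ} (h0 : w ≠ 0) (hD : riemannZeta₁ w ≠ 0) :
    regTransform k w
      = errTransform k w - gaussKer w / w - poleSum (fun ρ ↦ zetaRes k ρ) w := by
  have hw : w ∉ zeros := fun h ↦ hD (riemannZeta₁_eq_zero_of_mem_zeros h)
  have hd : denomFn w ≠ 0 := mul_ne_zero h0 hD
  rw [regTransform, regQuot, if_neg hd, regNumer, zeroSum_eq w hw, errTransform, denomFn]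
  field_simp

lemma exists_norm_errTransform_right_le (hk : 2 ≤ k) :
    ∃ C : ℝ, 0 < C ∧ ∀ w : ℂ, w.re = k + 1 → ‖errTransform k w‖ ≤ C / (1 + |w.im|) := by
  have hk2 : (2 : ℝ) ≤ k := by exact_mod_cast hk
  have hk0 : (0 : ℝ) < k := by linarith
  obtain ⟨C₁, hC₁0, hC₁⟩ := exists_norm_riemannZeta_le (σ := (k + 1) / k)
    (by rw [lt_div_iff₀ hk0]; linarith)
  obtain ⟨C₂, hC₂0, hC₂⟩ := exists_norm_riemannZeta_le (σ := k + 1) (by linarith)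
  refine ⟨2 * (C₁ * C₂) + 2 * ‖(riemannZeta k)⁻¹‖, by positivity, fun w hw ↦ ?_⟩
  have h0 : w ≠ 0 := by rintro rfl; simp at hw; linarith
  have h1 : w ≠ 1 := by rintro rfl; simp at hw; linarith
  have hwk : w ≠ k := by rintro rfl; simp at hw
  have hz := (hC₂ w hw.ge).2
  have hz0 : 0 < ‖riemannZeta w‖ := by
    by_contra! h
    nlinarith
  rw [errTransform_eq hk h0 h1 hwk (norm_pos_iff.mp hz0)]
  have e1 := one_add_abs_im_le (w := w) (a := 0) one_pos
    (by rw [hw, abs_of_pos (by linarith)]; linarith)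
  have e2 := one_add_abs_im_le (w := w) (a := k) one_pos (by rw [hw]; simp)
  rw [inv_one, ofReal_zero, sub_zero] at e1
  rw [inv_one, ofReal_natCast] at e2
  have e3 := (hC₁ (w / k) (by rw [div_natCast_re, hw])).1
  have hy : 0 < 1 + |w.im| := by positivity
  have e4 : ‖riemannZeta (w / k) / (w * riemannZeta w)‖ ≤ 2 * (C₁ * C₂) / (1 + |w.im|) := by
    rw [norm_div, norm_mul, div_le_div_iff₀ (by positivity) hy]
    calc ‖riemannZeta (w / k)‖ * (1 + |w.im|) ≤ C₁ * ((1 + 1) * ‖w‖) := by gcongr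
      _ ≤ C₁ * ((1 + 1) * ‖w‖) * (C₂ * ‖riemannZeta w‖) := le_mul_of_one_le_right (by positivity) hz
      _ = _ := by ring
  have e5 : ‖1 / (riemannZeta k * (w - k))‖ ≤ 2 * ‖(riemannZeta k)⁻¹‖ / (1 + |w.im|) := by
    have : 0 < ‖w - k‖ := norm_pos_iff.mpr (sub_ne_zero.mpr hwk)
    rw [one_div, mul_inv, norm_mul, norm_inv (w - k), ← div_eq_mul_inv, div_le_div_iff₀ this hy]
    nlinarith [norm_nonneg (riemannZeta k)⁻¹]
  rw [add_div]
  exact (norm_sub_le _ _).trans (add_le_add e4 e5)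

/-- On `re w = -1` the functional equation gives `ζ(w/k)` order at most `|im w|^(1/2+1/k)`, which is
at most linear as `k ≥ 2`. The linear lower bound for `ζ(w)` compensates it, and the factor `1/w`
remains. -/
lemma exists_norm_errTransform_left_le (hk : 2 ≤ k) :
    ∃ C : ℝ, 0 < C ∧ ∀ w : ℂ, w.re = -1 → ‖errTransform k w‖ ≤ C / (1 + |w.im|) := by
  have hk2 : (2 : ℝ) ≤ k := by exact_mod_cast hk
  have hk0 : (0 : ℝ) < k := by linarith
  have hη : 1 / (k : ℝ) ≤ 1 / 2 := one_div_le_one_div_of_le (by norm_num) hk2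
  obtain ⟨C₁, hC₁⟩ := exists_norm_riemannZeta_left_le (η := 1 / k) (by positivity) (by linarith)
  obtain ⟨C₂, hC₂0, hC₂⟩ := exists_le_norm_riemannZeta_neg_one
  refine ⟨2 * (|C₁| * C₂) + 2 * ‖(riemannZeta k)⁻¹‖ + 1, by positivity, fun w hw ↦ ?_⟩
  have h0 : w ≠ 0 := by rintro rfl; simp at hw
  have h1 : w ≠ 1 := by rintro rfl; norm_num at hw
  have hwk : w ≠ k := by rintro rfl; simp at hw; linarith
  have hy : 0 < 1 + |w.im| := by positivity
  have hz := hC₂ w hw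
  have hz0 : 0 < ‖riemannZeta w‖ := by
    by_contra! h
    nlinarith
  rw [errTransform_eq hk h0 h1 hwk (norm_pos_iff.mp hz0)]
  have e1 := one_add_abs_im_le (w := w) (a := 0) one_pos (by rw [hw]; norm_num)
  have e2 := one_add_abs_im_le (w := w) (a := k) one_pos
    (by rw [hw, abs_of_nonpos (by linarith)]; linarith)
  rw [inv_one, ofReal_zero, sub_zero] at e1
  rw [inv_one, ofReal_natCast] at e2
  have e3 : ‖riemannZeta (w / k)‖ ≤ |C₁| * (1 + |w.im|) := by
    have h2 := hC₁ (w / k) (by rw [div_natCast_re, hw]; ring)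
    rw [div_natCast_im] at h2
    have h3 : |w.im / k| ≤ |w.im| := by
      rw [abs_div, Nat.abs_cast]
      exact div_le_self (abs_nonneg _) (by linarith)
    refine h2.trans ?_
    calc C₁ * (1 + |w.im / k|) ^ (1 / 2 + 1 / (k : ℝ)) ≤ |C₁| * (1 + |w.im / k|) ^ (1 : ℝ) := by
          gcongr
          · exact le_abs_self _
          · linarith [abs_nonneg (w.im / k)]
          · linarith
      _ ≤ |C₁| * (1 + |w.im|) := by
          rw [Real.rpow_one]
          gcongr 2
  have e4 : ‖riemannZeta (w / k) / (w * riemannZeta w)‖ ≤ 2 * (|C₁| * C₂) / (1 + |w.im|) := by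
    rw [norm_div, norm_mul, div_le_div_iff₀ (by positivity) hy]
    calc ‖riemannZeta (w / k)‖ * (1 + |w.im|) ≤ |C₁| * (C₂ * ‖riemannZeta w‖) * ((1 + 1) * ‖w‖) := by
          gcongr
          exact e3.trans (by gcongr)
      _ = _ := by ring
  have e5 : ‖1 / (riemannZeta k * (w - k))‖ ≤ 2 * ‖(riemannZeta k)⁻¹‖ / (1 + |w.im|) := by
    have : 0 < ‖w - k‖ := norm_pos_iff.mpr (sub_ne_zero.mpr hwk)
    rw [one_div, mul_inv, norm_mul, norm_inv (w - k), ← div_eq_mul_inv, div_le_div_iff₀ this hy]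
    nlinarith [norm_nonneg (riemannZeta k)⁻¹]
  refine (norm_sub_le _ _).trans ((add_le_add e4 e5).trans ?_)
  rw [← add_div]
  exact div_le_div_of_nonneg_right (by linarith) hy.le

/-- Away from `re w = 0` and `re w = 1/2` the polar parts can be estimated separately: the transform
and the Gaussian term are `O(1/(1+|im w|))`, and `poleSum` has finite mean square. -/
lemma lineNorm_regTransform_lt_top (hRH : RiemannHypothesis) {σ : ℝ} (hσ0 : σ ≠ 0) (hσ : σ ≠ 1 / 2)
    (hσ2 : -2 < σ) {η : ℝ} (hη : 0 < η) (hη1 : η ≤ 1)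
    (hs : Summable fun ρ : zeros ↦ ‖zetaRes k ρ‖ ^ 2 * (1 + |(ρ : ℂ).im|) ^ η)
    {C : ℝ} (hC : ∀ w : ℂ, w.re = σ → ‖errTransform k w‖ ≤ C / (1 + |w.im|)) :
    lineNorm (regTransform k) σ < ⊤ := by
  obtain ⟨B, hB0, hB⟩ := exists_norm_gaussKer_le |σ| 1
  obtain ⟨P, _, hP⟩ := exists_lineNorm_poleSum_le hRH |σ| hη hη1
  have h1 := hP σ (fun ρ ↦ zetaRes k ρ) le_rfl hσ hs
  refine (lineNorm_le_add (G := fun _ ↦ 0) (S := poleSum fun ρ ↦ zetaRes k ρ) (C := C + B / |σ|)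
    (σ := σ) continuous_const fun w hw ↦ ?_).trans_lt ?_
  · have hw0 : w ≠ 0 := by rintro rfl; simp at hw; exact hσ0 hw.symm
    have hD : riemannZeta₁ w ≠ 0 := fun h ↦ by
      have := re_of_mem_zeros hRH (mem_zeros_of_riemannZeta₁_eq_zero hRH h (by rwa [hw]))
      rw [hw] at this
      exact hσ this
    rw [regTransform_eq hw0 hD, norm_zero, add_zero, add_div]
    refine (norm_sub_le _ _).trans (add_le_add_left ((norm_sub_le _ _).trans
      (add_le_add (hC w hw) ?_)) _)
    have h2 := hB w (by rw [hw])
    have h3 := abs_re_le_norm w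
    rw [hw] at h3
    have h4 : 0 < |σ| := abs_pos.mpr hσ0
    rw [pow_one] at h2
    rw [norm_div, div_div, div_le_div_iff₀ (by linarith) (by positivity)]
    calc ‖gaussKer w‖ * (|σ| * (1 + |w.im|)) = |σ| * (‖gaussKer w‖ * (1 + |w.im|)) := by ring
      _ ≤ ‖w‖ * B := by gcongr
      _ = _ := mul_comm _ _
  · refine ENNReal.mul_lt_top (by norm_num) ?_
    have h5 : lineNorm (fun _ ↦ 0) σ = 0 := by simp [lineNorm]
    rw [h5, add_zero]
    exact ENNReal.add_lt_top.mpr ⟨ENNReal.ofReal_lt_top, h1.trans_lt ENNReal.ofReal_lt_top⟩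

/-- The residues are bounded and the regularised transform is square integrable on vertical lines,
uniformly in a wide strip. -/
theorem exists_lineNorm_regTransform_le (hRH : RiemannHypothesis)
    (hsimple : ∀ ρ ∈ upperZeros, deriv riemannZeta ρ ≠ 0) (hk : 2 ≤ k) {R₀ : ℝ}
    (hR : ∀ ρ : zeros, ‖zetaRes k ρ‖ ≤ R₀) {η : ℝ} (hη : 0 < η) (hη1 : η ≤ 1)
    (hs : Summable fun ρ : zeros ↦ ‖zetaRes k ρ‖ ^ 2 * (1 + |(ρ : ℂ).im|) ^ η) :
    ∃ B : ℝ, 0 ≤ B ∧ ∀ σ : ℝ, -1 ≤ σ → σ ≤ k + 1 → lineNorm (regTransform k) σ ≤ ENNReal.ofReal B := by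
  have hk2 : (2 : ℝ) ≤ k := by exact_mod_cast hk
  obtain ⟨C₁, hC₁0, hC₁⟩ := exists_norm_errTransform_left_le hk
  obtain ⟨C₂, hC₂0, hC₂⟩ := exists_norm_errTransform_right_le hk
  have h1 := lineNorm_regTransform_lt_top hRH (σ := -1) (by norm_num) (by norm_num) (by norm_num)
    hη hη1 hs hC₁
  have h2 := lineNorm_regTransform_lt_top hRH (σ := k + 1) (by linarith) (by linarith) (by linarith)
    hη hη1 hs hC₂
  refine ⟨(lineNorm (regTransform k) (-1) + lineNorm (regTransform k) (k + 1)).toReal,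
    ENNReal.toReal_nonneg, fun σ h3 h4 ↦ ?_⟩
  rw [ENNReal.ofReal_toReal (ENNReal.add_lt_top.mpr ⟨h1, h2⟩).ne]
  exact (stripFunction_regTransform hRH hsimple hk hR).lineNorm_le h3 h4

end KFree

/-! ### The transform after removing only finitely many zeros. -/

namespace KFree
open MeasureTheory Filter Topology Complex Metric
open scoped ENNReal Real ComplexConjugate

variable {k : ℕ}

/-- The transform of the error term without the polar parts at `0` and at the zeros in `A`. -/
noncomputable def tailTransform (k : ℕ) (A : Finset zeros) (w : ℂ) : ℂ :=
  errTransform k w - 1 / w - ∑ ρ ∈ A, zetaRes k ρ / (w - ρ)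

open Classical in
/-- The residues at the zeros outside `A`. -/
noncomputable def tailRes (k : ℕ) (A : Finset zeros) (ρ : zeros) : ℂ :=
  if ρ ∈ A then 0 else zetaRes k ρ

lemma norm_tailRes_le {R₀ : ℝ} (hR : ∀ ρ : zeros, ‖zetaRes k ρ‖ ≤ R₀) (A : Finset zeros) (ρ : zeros) :
    ‖tailRes k A ρ‖ ≤ R₀ := by
  rw [tailRes]
  split_ifs
  · simpa using (norm_nonneg _).trans (hR ρ)
  · exact hR ρ

lemma exists_sum_poleSum_le (hRH : RiemannHypothesis) (X : ℝ) : ∃ B : ℝ, 0 < B ∧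
    ∀ (R₀ δ : ℝ) (c : zeros → ℂ), 0 < δ → (∀ ρ, ‖c ρ‖ ≤ R₀) → ∀ (w : ℂ) (A : Finset zeros),
      |w.re| ≤ X → δ ≤ |w.re - 1 / 2| →
      ∑ ρ ∈ A, ‖c ρ * (gaussKer (w - ρ) / (w - ρ))‖ ≤ |R₀| * B / δ * (1 + |w.im|) := by
  obtain ⟨B, hB0, hB⟩ := exists_sum_gaussKer_le hRH X one_pos le_rfl
  refine ⟨B, hB0, fun R₀ δ c hδ hc w A hw hδw ↦ ?_⟩
  calc ∑ ρ ∈ A, ‖c ρ * (gaussKer (w - ρ) / (w - ρ))‖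
      ≤ ∑ ρ ∈ A, |R₀| * (‖gaussKer (w - ρ)‖ / δ) := by
        refine Finset.sum_le_sum fun ρ _ ↦ ?_
        have h1 := abs_re_le_norm (w - ρ)
        rw [sub_re, re_of_mem_zeros hRH ρ.2] at h1
        rw [norm_mul, norm_div]
        gcongr
        · exact (hc ρ).trans (le_abs_self _)
        · exact hδw.trans h1
    _ = |R₀| / δ * ∑ ρ ∈ A, ‖gaussKer (w - ρ)‖ := by
        rw [Finset.mul_sum]
        refine Finset.sum_congr rfl fun ρ _ ↦ ?_
        ring
    _ ≤ |R₀| / δ * (B * (1 + |w.im|)) := by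
        gcongr
        simpa using hB w A hw
    _ = _ := by ring

lemma poleSum_eq (hRH : RiemannHypothesis) {R₀ : ℝ} (hR : ∀ ρ : zeros, ‖zetaRes k ρ‖ ≤ R₀)
    (A : Finset zeros) {w : ℂ} (hw : w.re ≠ 1 / 2) :
    poleSum (fun ρ ↦ zetaRes k ρ) w
      = ∑ ρ ∈ A, zetaRes k ρ * (gaussKer (w - ρ) / (w - ρ)) + poleSum (tailRes k A) w := by
  obtain ⟨B, _, hB⟩ := exists_sum_poleSum_le hRH |w.re|
  have hδ : 0 < |w.re - 1 / 2| := abs_pos.mpr (sub_ne_zero.mpr hw)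
  have h2 := (summable_of_sum_norm_le fun S ↦ hB R₀ _ (tailRes k A) hδ (norm_tailRes_le hR A) w S
    le_rfl le_rfl).1
  have h1 : HasSum (fun ρ : zeros ↦ if ρ ∈ A then zetaRes k ρ * (gaussKer (w - ρ) / (w - ρ)) else 0)
      (∑ ρ ∈ A, zetaRes k ρ * (gaussKer (w - ρ) / (w - ρ))) := by
    have := hasSum_sum_of_ne_finset_zero (s := A) (f := fun ρ : zeros ↦ if ρ ∈ A then
      zetaRes k ρ * (gaussKer (w - ρ) / (w - ρ)) else 0) (L := .unconditional _)
      (fun ρ hρ ↦ if_neg hρ)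
    rwa [Finset.sum_congr rfl fun ρ hρ ↦ if_pos hρ] at this
  rw [poleSum, poleSum]
  refine ((h1.add h2.hasSum).congr_fun fun ρ ↦ ?_).tsum_eq
  rw [tailRes]
  split_ifs <;> simp

/-- Outside the critical line the tail transform is a regular part plus a smoothed sum over the
zeros outside `A`. -/
lemma tailTransform_eq (hRH : RiemannHypothesis) {R₀ : ℝ} (hR : ∀ ρ : zeros, ‖zetaRes k ρ‖ ≤ R₀)
    (A : Finset zeros) {w : ℂ} (h0 : w ≠ 0) (hw2 : -2 < w.re) (hw : w.re ≠ 1 / 2) :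
    tailTransform k A w = regTransform k w + gaussSlope w
      + ∑ ρ ∈ A, zetaRes k ρ * gaussSlope (w - ρ) + poleSum (tailRes k A) w := by
  have hD : riemannZeta₁ w ≠ 0 := fun h ↦
    hw (re_of_mem_zeros hRH (mem_zeros_of_riemannZeta₁_eq_zero hRH h hw2))
  rw [regTransform_eq h0 hD, poleSum_eq hRH hR A hw, gaussSlope_of_ne h0, tailTransform]
  -- Trading a plain fraction `1/(w-ρ)` for its smoothed version leaves the entire function
  -- `gaussSlope`, of size `O(1/|im w|)`.
  have : ∑ ρ ∈ A, zetaRes k ρ * gaussSlope (w - ρ)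
      = ∑ ρ ∈ A, zetaRes k ρ * (gaussKer (w - ρ) / (w - ρ)) - ∑ ρ ∈ A, zetaRes k ρ / (w - ρ) := by
    rw [← Finset.sum_sub_distrib]
    refine Finset.sum_congr rfl fun ρ _ ↦ ?_
    rw [gaussSlope_of_ne]
    · ring
    · intro h
      apply hw
      rw [sub_eq_zero.mp h, re_of_mem_zeros hRH ρ.2]
  rw [this]
  ring

lemma exists_norm_gaussSlope_sum_le (hRH : RiemannHypothesis) (k : ℕ) (A : Finset zeros) (X : ℝ) :
    ∃ C : ℝ, 0 ≤ C ∧ ∀ w : ℂ, |w.re| ≤ X →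
      ‖gaussSlope w + ∑ ρ ∈ A, zetaRes k ρ * gaussSlope (w - ρ)‖ ≤ C / (1 + |w.im|) := by
  obtain ⟨C, hC0, hC⟩ := exists_norm_gaussSlope_le (X + 1)
  refine ⟨C + ∑ ρ ∈ A, ‖zetaRes k ρ‖ * (C * (1 + |(ρ : ℂ).im|)), by positivity, fun w hw ↦ ?_⟩
  rw [add_div, Finset.sum_div]
  refine (norm_add_le _ _).trans (add_le_add (hC w (by linarith)) ?_)
  refine (norm_sum_le _ _).trans (Finset.sum_le_sum fun ρ _ ↦ ?_)
  rw [norm_mul, mul_div_assoc]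
  gcongr
  refine (hC (w - ρ) ?_).trans ?_
  · rw [sub_re, re_of_mem_zeros hRH ρ.2]
    refine (abs_sub _ _).trans ?_
    rw [abs_of_pos (show (0 : ℝ) < 1 / 2 by norm_num)]
    linarith
  · rw [sub_im, div_le_div_iff₀ (by positivity) (by positivity), mul_assoc]
    gcongr
    have := abs_sub_abs_le_abs_sub w.im (ρ : ℂ).im
    nlinarith [abs_nonneg (ρ : ℂ).im, abs_nonneg (w.im - (ρ : ℂ).im)]

/-- Qualitative growth only, to justify Plancherel: the constant may blow up as `a → 1/2`, since the
quantitative input is the line norm. -/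
lemma stripFunction_tailTransform (hRH : RiemannHypothesis)
    (hsimple : ∀ ρ ∈ upperZeros, deriv riemannZeta ρ ≠ 0) (hk : 2 ≤ k) {R₀ : ℝ}
    (hR : ∀ ρ : zeros, ‖zetaRes k ρ‖ ≤ R₀) (A : Finset zeros) {a : ℝ} (ha : 1 / 2 < a) :
    StripFunction (tailTransform k A) a (k + 1) := by
  obtain ⟨C₁, n, hC₁⟩ := (stripFunction_regTransform hRH hsimple hk hR).growth
  obtain ⟨C₂, hC₂0, hC₂⟩ := exists_norm_gaussSlope_sum_le hRH k A (k + 1)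
  obtain ⟨B, hB0, hB⟩ := exists_sum_poleSum_le hRH (k + 1)
  have hne : ∀ w : ℂ, a ≤ w.re → w ≠ 0 := by
    rintro w hw rfl
    simp at hw
    linarith
  refine ⟨fun w h1 h2 ↦ ?_, ?_⟩
  · have hw0 := hne w h1
    have hD : riemannZeta₁ w ≠ 0 := fun h ↦ by
      have := re_of_mem_zeros hRH (mem_zeros_of_riemannZeta₁_eq_zero hRH h (by linarith))
      linarith
    have e1 : DifferentiableAt ℂ (errTransform k) w :=
      (differentiable_dslope (differentiable_numerFn k) _ w).div (differentiable_denomFn w)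
        (mul_ne_zero hw0 hD)
    unfold tailTransform
    refine (e1.sub ((differentiableAt_const _).div differentiableAt_id hw0)).sub
      (DifferentiableAt.fun_sum fun ρ _ ↦ (differentiableAt_const _).div (by fun_prop) ?_)
    intro h
    have := re_of_mem_zeros hRH ρ.2
    rw [← sub_eq_zero.mp h] at this
    linarith
  · set δ := a - 1 / 2 with hδ
    have hδ0 : 0 < δ := by linarith
    refine ⟨|C₁| + C₂ + |R₀| * B / δ, n + 1, fun w h1 h2 ↦ ?_⟩
    have hre : |w.re| ≤ k + 1 := abs_le.mpr ⟨by linarith, h2⟩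
    have hy : 1 ≤ 1 + |w.im| := by linarith [abs_nonneg w.im]
    have e1 := hC₁ w (by linarith) h2
    have e2 := hC₂ w hre
    have e3 := (summable_of_sum_norm_le fun S ↦ hB R₀ δ (tailRes k A) hδ0 (norm_tailRes_le hR A) w S
      hre (by rw [abs_of_pos (by linarith)]; linarith)).2
    have hp1 : (1 + |w.im|) ≤ (1 + |w.im|) ^ (n + 1) := le_self_pow₀ hy (by omega)
    have hp2 : (1 + |w.im|) ^ n ≤ (1 + |w.im|) ^ (n + 1) := pow_le_pow_right₀ hy (by omega)
    rw [tailTransform_eq hRH hR A (hne w h1) (by linarith) (by linarith), add_assoc (regTransform k w)]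
    calc _ ≤ ‖regTransform k w‖ + ‖gaussSlope w + ∑ ρ ∈ A, zetaRes k ρ * gaussSlope (w - ρ)‖
          + ‖poleSum (tailRes k A) w‖ := norm_add₃_le
      _ ≤ |C₁| * (1 + |w.im|) ^ (n + 1) + C₂ * (1 + |w.im|) ^ (n + 1)
          + |R₀| * B / δ * (1 + |w.im|) ^ (n + 1) := by
        gcongr
        · refine e1.trans ?_
          gcongr
          exact le_abs_self _
        · refine e2.trans ?_
          rw [div_le_iff₀ (by linarith)]
          nlinarith [mul_le_mul_of_nonneg_left (hy.trans hp1) hC₂0]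
        · exact e3.trans (by gcongr)
      _ = _ := by ring

lemma hasSum_tailRes (A : Finset zeros) {η : ℝ}
    (hs : Summable fun ρ : zeros ↦ ‖zetaRes k ρ‖ ^ 2 * (1 + |(ρ : ℂ).im|) ^ η) :
    HasSum (fun ρ : zeros ↦ ‖tailRes k A ρ‖ ^ 2 * (1 + |(ρ : ℂ).im|) ^ η)
      (∑' ρ : zeros, ‖zetaRes k ρ‖ ^ 2 * (1 + |(ρ : ℂ).im|) ^ η
        - ∑ ρ ∈ A, ‖zetaRes k ρ‖ ^ 2 * (1 + |(ρ : ℂ).im|) ^ η) := by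
  have h1 : HasSum (fun ρ : zeros ↦ if ρ ∈ A then ‖zetaRes k ρ‖ ^ 2 * (1 + |(ρ : ℂ).im|) ^ η else 0)
      (∑ ρ ∈ A, ‖zetaRes k ρ‖ ^ 2 * (1 + |(ρ : ℂ).im|) ^ η) := by
    have := hasSum_sum_of_ne_finset_zero (s := A) (f := fun ρ : zeros ↦ if ρ ∈ A then
      ‖zetaRes k ρ‖ ^ 2 * (1 + |(ρ : ℂ).im|) ^ η else 0) (L := .unconditional _)
      (fun ρ hρ ↦ if_neg hρ)
    rwa [Finset.sum_congr rfl fun ρ hρ ↦ if_pos hρ] at this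
  refine (hs.hasSum.sub h1).congr_fun fun ρ ↦ ?_
  rw [tailRes]
  split_ifs <;> simp

/-- The mean square of the tail transform on a line close to the critical line. -/
theorem exists_lineNorm_tailTransform_le (hRH : RiemannHypothesis)
    (hsimple : ∀ ρ ∈ upperZeros, deriv riemannZeta ρ ≠ 0) (hk : 2 ≤ k) {R₀ : ℝ}
    (hR : ∀ ρ : zeros, ‖zetaRes k ρ‖ ≤ R₀) {η : ℝ} (hη : 0 < η) (hη1 : η ≤ 1)
    (hs : Summable fun ρ : zeros ↦ ‖zetaRes k ρ‖ ^ 2 * (1 + |(ρ : ℂ).im|) ^ η) :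
    ∃ C : ℝ, 0 < C ∧ ∀ A : Finset zeros, ∃ B : ℝ, 0 ≤ B ∧ ∀ σ : ℝ, 1 / 2 < σ → σ ≤ k + 1 →
      lineNorm (tailTransform k A) σ ≤ ENNReal.ofReal (B + C / (σ - 1 / 2) *
        (∑' ρ : zeros, ‖zetaRes k ρ‖ ^ 2 * (1 + |(ρ : ℂ).im|) ^ η
        - ∑ ρ ∈ A, ‖zetaRes k ρ‖ ^ 2 * (1 + |(ρ : ℂ).im|) ^ η)) := by
  obtain ⟨B₁, hB₁0, hB₁⟩ := exists_lineNorm_regTransform_le hRH hsimple hk hR hη hη1 hs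
  obtain ⟨P, hP0, hP⟩ := exists_lineNorm_poleSum_le hRH (k + 1) hη hη1
  have hG := stripFunction_regTransform hRH hsimple hk hR
  -- The constant in front of the tail is fixed before `A`, whereas `B` may depend on `A`; the final
  -- limit relies on this order.
  refine ⟨3 * P, by positivity, fun A ↦ ?_⟩
  obtain ⟨C₂, hC₂0, hC₂⟩ := exists_norm_gaussSlope_sum_le hRH k A (k + 1)
  have ht := hasSum_tailRes A hs
  refine ⟨3 * (C₂ ^ 2 * π + B₁), by positivity, fun σ h1 h2 ↦ ?_⟩
  have hre : |σ| ≤ k + 1 := abs_le.mpr ⟨by linarith, h2⟩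
  have e1 := hP σ (tailRes k A) hre (by linarith) ht.summable
  rw [ht.tsum_eq, abs_of_pos (by linarith)] at e1
  set τ := ∑' ρ : zeros, ‖zetaRes k ρ‖ ^ 2 * (1 + |(ρ : ℂ).im|) ^ η
        - ∑ ρ ∈ A, ‖zetaRes k ρ‖ ^ 2 * (1 + |(ρ : ℂ).im|) ^ η with hτ
  have hτ0 : 0 ≤ τ := ht.nonneg fun ρ ↦ by positivity
  have hP' : 0 ≤ P / (σ - 1 / 2) * τ := mul_nonneg (div_nonneg hP0.le (by linarith)) hτ0
  refine (lineNorm_le_add (hG.continuous_line (by linarith) h2) fun w hw ↦ ?_).trans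
    (?_ : 3 * (ENNReal.ofReal (C₂ ^ 2 * π) + lineNorm (regTransform k) σ
      + lineNorm (poleSum (tailRes k A)) σ) ≤ _)
  · rw [tailTransform_eq hRH hR A (by rintro rfl; simp at hw; linarith) (by linarith) (by linarith),
      add_assoc (regTransform k w), add_comm (regTransform k w)]
    refine norm_add₃_le.trans ?_
    gcongr
    exact hC₂ w (by rwa [hw])
  · calc _ ≤ 3 * (ENNReal.ofReal (C₂ ^ 2 * π) + ENNReal.ofReal B₁
          + ENNReal.ofReal (P / (σ - 1 / 2) * τ)) := by
          gcongr
          exact hB₁ σ (by linarith) h2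
      _ = _ := by
          rw [← ENNReal.ofReal_add (by positivity) hB₁0, ← ENNReal.ofReal_add (by positivity) hP',
            ← ENNReal.ofReal_ofNat 3, ← ENNReal.ofReal_mul (by norm_num)]
          congr 1
          ring

end KFree

/-! ### The `k`-free integers, their Dirichlet series and the Laplace transform of the error term.
-/

namespace KFree
open MeasureTheory Filter Topology Complex Metric
open scoped ENNReal Real ComplexConjugate

variable {k : ℕ}

lemma not_isKFree_zero : ¬ IsKFree k 0 := fun h ↦ h 2 Nat.prime_two (dvd_zero _)

lemma IsKFree.factorization_lt {a : ℕ} (h : IsKFree k a) {p : ℕ} (hp : p.Prime) :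
    a.factorization p < k := by
  by_contra! hle
  exact h p hp ((hp.pow_dvd_iff_le_factorization (fun h0 ↦ not_isKFree_zero (h0 ▸ h))).mpr hle)

/-- Take the largest `d` with `d ^ k ∣ n`: a `k`-th prime power in the cofactor would enlarge it. -/
lemma exists_eq_mul_pow (hk : 1 ≤ k) {n : ℕ} (hn : n ≠ 0) :
    ∃ a d : ℕ, IsKFree k a ∧ d ≠ 0 ∧ n = a * d ^ k := by
  have hbd : ∀ d, d ^ k ∣ n → d ≤ n := fun d hd ↦
    (Nat.le_self_pow (by omega) d).trans (Nat.le_of_dvd (Nat.pos_of_ne_zero hn) hd)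
  classical
  set d := Nat.findGreatest (fun d ↦ d ^ k ∣ n) n with hd
  have hdn : d ^ k ∣ n := Nat.findGreatest_spec (P := fun d ↦ d ^ k ∣ n) (m := 1)
    (Nat.pos_of_ne_zero hn) (by simp)
  obtain ⟨a, ha⟩ := hdn
  have hd0 : d ≠ 0 := by
    intro h
    rw [h, zero_pow (by omega), zero_mul] at ha
    exact hn ha
  refine ⟨a, d, fun p hp hpa ↦ ?_, hd0, by rw [ha, mul_comm]⟩
  have h1 : (d * p) ^ k ∣ n := by
    rw [ha, mul_pow]
    exact mul_dvd_mul_left _ hpa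
  have h2 := Nat.le_findGreatest (P := fun d ↦ d ^ k ∣ n) (hbd _ h1) h1
  rw [← hd] at h2
  have := hp.two_le
  nlinarith [Nat.pos_of_ne_zero hd0]

/-- At each prime the exponent of `a` is below `k`, so the exponent of `d` is the quotient by `k` of
that of `a * d ^ k`. -/
lemma eq_and_eq_of_mul_pow_eq {a b d e : ℕ} (ha : IsKFree k a) (hb : IsKFree k b)
    (hd : d ≠ 0) (he : e ≠ 0) (h : a * d ^ k = b * e ^ k) : a = b ∧ d = e := by
  have ha0 : a ≠ 0 := fun h0 ↦ not_isKFree_zero (h0 ▸ ha)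
  have hb0 : b ≠ 0 := fun h0 ↦ not_isKFree_zero (h0 ▸ hb)
  have hde : d = e := by
    refine Nat.eq_of_factorization_eq hd he fun p ↦ ?_
    by_cases hp : p.Prime
    · have h1 := congrArg (fun n ↦ n.factorization p) h
      simp only [Nat.factorization_mul ha0 (pow_ne_zero _ hd),
        Nat.factorization_mul hb0 (pow_ne_zero _ he), Nat.factorization_pow, Finsupp.add_apply,
        Finsupp.smul_apply, smul_eq_mul] at h1
      have h2 := ha.factorization_lt hp
      have h3 := hb.factorization_lt hp
      have h4 := congrArg (· / k) h1
      rwa [Nat.add_mul_div_left _ _ (by omega), Nat.add_mul_div_left _ _ (by omega),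
        Nat.div_eq_of_lt h2, Nat.div_eq_of_lt h3, zero_add, zero_add] at h4
    · rw [Nat.factorization_eq_zero_of_not_prime _ hp, Nat.factorization_eq_zero_of_not_prime _ hp]
  subst hde
  exact ⟨Nat.eq_of_mul_eq_mul_right (Nat.pos_of_ne_zero (pow_ne_zero _ hd)) h, rfl⟩

open Classical in
/-- The indicator function of the `k`-free integers. -/
noncomputable def kfreeInd (k n : ℕ) : ℂ := if IsKFree k n then 1 else 0

lemma norm_kfreeInd_le (k n : ℕ) : ‖kfreeInd k n‖ ≤ 1 := by
  unfold kfreeInd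
  split_ifs <;> simp

lemma sum_kfreeInd (k : ℕ) (x : ℝ) : ∑ n ∈ Finset.Icc 1 ⌊x⌋₊, kfreeInd k n = count k x := by
  unfold kfreeInd count
  rw [Finset.sum_boole]

lemma LSeriesSummable_kfreeInd {s : ℂ} (hs : 1 < s.re) : LSeriesSummable (kfreeInd k) s :=
  LSeriesSummable_of_bounded_of_one_lt_re (m := 1) (fun n _ ↦ norm_kfreeInd_le k n) hs

/-- The Dirichlet series of the `k`-free integers. -/
theorem LSeries_kfreeInd_mul (hk : 1 ≤ k) {s : ℂ} (hs : 1 < s.re) :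
    LSeries (kfreeInd k) s * riemannZeta (k * s) = riemannZeta s := by
  have hk' : (1 : ℝ) ≤ k := by exact_mod_cast hk
  have hks : 1 < (k * s).re := by
    rw [show (k : ℂ) = ((k : ℝ) : ℂ) by simp, re_ofReal_mul]
    nlinarith
  have hs1 := LSeriesSummable_kfreeInd (k := k) hs
  have hs2 := LSeriesSummable_one_iff.mpr hks
  rw [← LSeries_one_eq_riemannZeta hks, ← LSeries_one_eq_riemannZeta hs, LSeries, LSeries,
    tsum_mul_tsum_of_summable_norm hs1.norm hs2.norm, LSeries]
  have hsupp : ∀ x : ℕ × ℕ,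
      LSeries.term (kfreeInd k) s x.1 * LSeries.term 1 (k * s) x.2 ≠ 0 → IsKFree k x.1 ∧ x.2 ≠ 0 := by
    rintro ⟨a, d⟩ h
    obtain ⟨h1, h2⟩ := mul_ne_zero_iff.mp h
    refine ⟨?_, ?_⟩
    · by_contra hne
      apply h1
      simp only [LSeries.term, kfreeInd, if_neg hne]
      simp
    · rintro rfl
      exact h2 (LSeries.term_zero _ _)
  symm
  -- The pairs `(a, d)` with `a` `k`-free and `d ≠ 0` correspond bijectively to the positive
  -- integers `a * d ^ k`.
  refine tsum_eq_tsum_of_ne_zero_bij (fun x ↦ x.1.1 * x.1.2 ^ k) ?_ ?_ ?_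
  · rintro ⟨x, hx⟩ ⟨y, hy⟩ hxy
    obtain ⟨h1, h2⟩ := hsupp x hx
    obtain ⟨h3, h4⟩ := hsupp y hy
    obtain ⟨h5, h6⟩ := eq_and_eq_of_mul_pow_eq h1 h3 h2 h4 hxy
    exact Subtype.ext (Prod.ext h5 h6)
  · intro n hn
    have hn0 : n ≠ 0 := by
      rintro rfl
      exact hn (LSeries.term_zero _ _)
    obtain ⟨a, d, ha, hd, rfl⟩ := exists_eq_mul_pow hk hn0
    have ha0 : a ≠ 0 := fun h0 ↦ not_isKFree_zero (h0 ▸ ha)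
    refine ⟨⟨(a, d), ?_⟩, rfl⟩
    rw [Function.mem_support]
    refine mul_ne_zero ?_ ?_
    · rw [LSeries.term_of_ne_zero ha0, kfreeInd, if_pos ha]
      simp [ha0]
    · rw [LSeries.term_of_ne_zero hd]
      simp [hd]
  · rintro ⟨⟨a, d⟩, hx⟩
    obtain ⟨ha, hd⟩ := hsupp _ hx
    have ha0 : a ≠ 0 := fun h0 ↦ not_isKFree_zero (h0 ▸ ha)
    simp only at ha hd ⊢
    rw [LSeries.term_of_ne_zero ha0, LSeries.term_of_ne_zero hd,
      LSeries.term_of_ne_zero (mul_ne_zero ha0 (pow_ne_zero _ hd)), kfreeInd, if_pos ha,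
      natCast_cpow_natCast_mul, Nat.cast_mul, natCast_mul_natCast_cpow, Nat.cast_pow]
    simp only [Pi.one_apply]
    ring

lemma image_exp_Ioi (hk : 1 ≤ k) : (fun y : ℝ ↦ Real.exp (k * y)) '' Set.Ioi 0 = Set.Ioi 1 := by
  have hk' : (0 : ℝ) < k := by exact_mod_cast hk
  ext x
  simp only [Set.mem_image, Set.mem_Ioi]
  constructor
  · rintro ⟨y, hy, rfl⟩
    exact Real.one_lt_exp_iff.mpr (by positivity)
  · intro hx
    refine ⟨Real.log x / k, div_pos (Real.log_pos hx) hk', ?_⟩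
    rw [mul_div_cancel₀ _ hk'.ne', Real.exp_log (by linarith)]

lemma ofReal_exp_cpow (x : ℝ) (z : ℂ) : ((Real.exp x : ℝ) : ℂ) ^ z = cexp (x * z) := by
  rw [cpow_def_of_ne_zero (by exact_mod_cast (Real.exp_pos x).ne'), ← ofReal_log (Real.exp_pos x).le,
    Real.log_exp]

lemma hasDerivAt_exp_mul (c y : ℝ) :
    HasDerivAt (fun y : ℝ ↦ Real.exp (c * y)) (c * Real.exp (c * y)) y := by
  have := ((hasDerivAt_id y).const_mul c).exp
  simpa [mul_comm] using this

lemma injective_exp_mul (hk : 1 ≤ k) : Function.Injective fun y : ℝ ↦ Real.exp (k * y) := by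
  have hk' : (0 : ℝ) < k := by exact_mod_cast hk
  intro a b h
  exact mul_left_cancel₀ hk'.ne' (Real.exp_injective h)

/-- Partial summation for `ζ(s)/ζ(ks)` at `s = w/k`, with `x = exp (k y)`. This scaling places the
poles at the zeros of `ζ` themselves, on `re w = 1/2`. -/
lemma integral_count (hk : 2 ≤ k) {w : ℂ} (hw : (k : ℝ) < w.re) :
    ∫ y in Set.Ioi (0 : ℝ), (count k (Real.exp (k * y)) : ℂ) * cexp (-(w * y))
      = riemannZeta (w / k) / (w * riemannZeta w) := by
  have hk' : (2 : ℝ) ≤ k := by exact_mod_cast hk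
  have hk0 : (k : ℂ) ≠ 0 := by exact_mod_cast (by omega : k ≠ 0)
  have hs : 1 < (w / k).re := by
    rw [div_natCast_re, lt_div_iff₀ (by linarith)]
    linarith
  have hw0 : w ≠ 0 := by rintro rfl; simp at hw; linarith
  have h1 := LSeries_eq_mul_integral (kfreeInd k) (r := 1) zero_le_one hs
    (LSeriesSummable_kfreeInd hs) (by
      refine Asymptotics.IsBigO.of_bound 1 (Eventually.of_forall fun n ↦ ?_)
      refine (norm_sum_le _ _).trans ((Finset.sum_le_sum fun j _ ↦ norm_kfreeInd_le k j).trans ?_)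
      simp)
  have h2 := LSeries_kfreeInd_mul (k := k) (by omega) hs
  rw [mul_div_cancel₀ _ hk0] at h2
  have hz : riemannZeta w ≠ 0 := riemannZeta_ne_zero_of_one_lt_re (by linarith)
  rw [← image_exp_Ioi (k := k) (by omega), integral_image_eq_integral_abs_deriv_smul measurableSet_Ioi
    (fun y _ ↦ (hasDerivAt_exp_mul k y).hasDerivWithinAt) (injective_exp_mul (by omega)).injOn] at h1
  have h3 : ∫ y in Set.Ioi (0 : ℝ), |(k : ℝ) * Real.exp (k * y)| •
      ((∑ n ∈ Finset.Icc 1 ⌊Real.exp (k * y)⌋₊, kfreeInd k n) *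
        ((Real.exp (k * y) : ℝ) : ℂ) ^ (-(w / k + 1)))
      = k * ∫ y in Set.Ioi (0 : ℝ), (count k (Real.exp (k * y)) : ℂ) * cexp (-(w * y)) := by
    rw [← integral_const_mul]
    refine setIntegral_congr_fun measurableSet_Ioi fun y _ ↦ ?_
    rw [sum_kfreeInd, ofReal_exp_cpow, abs_of_pos (by positivity), real_smul]
    push_cast
    rw [show -(w * y) = k * y + k * y * -(w / k + 1) by field_simp; ring, Complex.exp_add]
    ring
  rw [h3] at h1
  rw [eq_div_iff (mul_ne_zero hw0 hz), ← h2, h1]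
  field_simp

lemma ofReal_re_riemannZeta (k : ℕ) : ((riemannZeta k).re : ℂ) = riemannZeta k := by
  rw [← conj_eq_iff_re, ← riemannZeta_conj, conj_natCast]

lemma count_le (k : ℕ) {x : ℝ} (hx : 0 ≤ x) : (count k x : ℝ) ≤ x := by
  refine le_trans ?_ (Nat.floor_le hx)
  unfold count
  classical
  exact_mod_cast (Finset.card_filter_le _ _).trans (by simp)

lemma measurable_count (k : ℕ) : Measurable fun x ↦ (count k x : ℝ) := by
  have : (fun x ↦ (count k x : ℝ)) = (fun n : ℕ ↦ (count k n : ℝ)) ∘ fun x : ℝ ↦ ⌊x⌋₊ := by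
    ext x
    simp [count]
  rw [this]
  exact (measurable_from_nat).comp Nat.measurable_floor

lemma measurable_M (k : ℕ) : Measurable (M k) :=
  (measurable_count k).sub (measurable_id.div_const _)

lemma exists_abs_M_le (k : ℕ) : ∃ C : ℝ, 0 < C ∧ ∀ x : ℝ, 0 ≤ x → |M k x| ≤ C * x := by
  refine ⟨1 + |((riemannZeta k).re)⁻¹|, by positivity, fun x hx ↦ ?_⟩
  rw [M]
  refine (abs_sub _ _).trans ?_
  rw [Nat.abs_cast, div_eq_mul_inv, abs_mul, abs_of_nonneg hx]
  have := count_le k hx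
  linarith

lemma continuousAt_M {x : ℝ} (hx : 0 < x) (hn : ∀ n : ℕ, x ≠ n) : ContinuousAt (M k) x := by
  have h1 : (⌊x⌋₊ : ℝ) < x := lt_of_le_of_ne (Nat.floor_le hx.le) (hn _).symm
  have h2 : x < ⌊x⌋₊ + 1 := Nat.lt_floor_add_one x
  have h3 : ∀ᶠ y in 𝓝 x, (count k y : ℝ) = count k x := by
    filter_upwards [Ioo_mem_nhds h1 h2] with y hy
    have : ⌊y⌋₊ = ⌊x⌋₊ := by
      rw [Nat.floor_eq_iff ((Nat.cast_nonneg _).trans hy.1.le)]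
      exact ⟨hy.1.le, hy.2⟩
    simp [count, this]
  have h4 : ContinuousAt (fun y ↦ (count k y : ℝ)) x :=
    (continuousAt_const (y := (count k x : ℝ))).congr (h3.mono fun y hy ↦ hy.symm)
  exact h4.sub (by fun_prop)

/-- The error term in logarithmic scale without the contributions of `0` and of the zeros in `A`. -/
noncomputable def errTail (k : ℕ) (A : Finset zeros) : ℝ → ℂ :=
  Set.indicator (Set.Ioi 0) fun y ↦
    (M k (Real.exp (k * y)) : ℂ) - 1 - ∑ ρ ∈ A, zetaRes k ρ * cexp (ρ * y)

/-- The jumps lie at logarithms of integers and at `0`, a countable set. This is the regularity that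
Gaussian inversion requires. -/
lemma continuousAt_errTail_ae (hk : 1 ≤ k) (A : Finset zeros) : ∀ᵐ y : ℝ, ContinuousAt (errTail k A) y := by
  have hk' : (0 : ℝ) < k := by exact_mod_cast hk
  have hcount : ((Set.range fun n : ℕ ↦ Real.log n / k) ∪ {0}).Countable :=
    (Set.countable_range _).union (Set.countable_singleton 0)
  filter_upwards [hcount.ae_notMem volume] with y hy
  simp only [Set.mem_union, Set.mem_range, Set.mem_singleton_iff, not_or, not_exists] at hy
  rcases lt_or_gt_of_ne hy.2 with h | h
  · refine ContinuousAt.congr (continuousAt_const (y := (0 : ℂ))) ?_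
    filter_upwards [Iio_mem_nhds h] with z hz
    rw [errTail, Set.indicator_of_notMem]
    simpa using le_of_lt hz
  · have h1 : ContinuousAt (fun y : ℝ ↦ (M k (Real.exp (k * y)) : ℂ) - 1
        - ∑ ρ ∈ A, zetaRes k ρ * cexp (ρ * y)) y := by
      have h2 : ContinuousAt (fun y : ℝ ↦ M k (Real.exp (k * y))) y := by
        refine ContinuousAt.comp (g := M k) (continuousAt_M (Real.exp_pos _) fun n hn ↦ ?_) (by fun_prop)
        apply hy.1 n
        rw [← hn, Real.log_exp, mul_div_cancel_left₀ _ hk'.ne']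
      have h3 : ContinuousAt (fun y : ℝ ↦ (M k (Real.exp (k * y)) : ℂ)) y :=
        continuous_ofReal.continuousAt.comp h2
      exact (h3.sub continuousAt_const).sub (by fun_prop)
    refine h1.congr ?_
    filter_upwards [Ioi_mem_nhds h] with z hz
    rw [errTail, Set.indicator_of_mem hz]

lemma integrableOn_cexp_sub {w ρ : ℂ} (h : ρ.re < w.re) :
    IntegrableOn (fun y : ℝ ↦ cexp (ρ * y) * cexp (-(w * y))) (Set.Ioi 0) := by
  have := integrableOn_exp_mul_complex_Ioi (a := ρ - w) (by simpa using h) 0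
  refine this.congr_fun (fun y _ ↦ ?_) measurableSet_Ioi
  simp only
  rw [← Complex.exp_add]
  ring_nf

lemma integral_cexp_sub {w ρ : ℂ} (h : ρ.re < w.re) :
    ∫ y in Set.Ioi (0 : ℝ), cexp (ρ * y) * cexp (-(w * y)) = 1 / (w - ρ) := by
  have := integral_exp_mul_complex_Ioi (a := ρ - w) (by simpa using h) 0
  rw [ofReal_zero, mul_zero, Complex.exp_zero, ← neg_sub w ρ, neg_div_neg_eq] at this
  rw [← this]
  refine setIntegral_congr_fun measurableSet_Ioi fun y _ ↦ ?_
  rw [← Complex.exp_add]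
  ring_nf

lemma integrableOn_count {w : ℂ} (hw : (k : ℝ) < w.re) :
    IntegrableOn (fun y : ℝ ↦ (count k (Real.exp (k * y)) : ℂ) * cexp (-(w * y))) (Set.Ioi 0) := by
  refine Integrable.mono' (g := fun y : ℝ ↦ ‖cexp ((k : ℂ) * y) * cexp (-(w * y))‖)
    (integrableOn_cexp_sub (by simpa using hw)).norm ?_ ?_
  · have h1 : Measurable fun y : ℝ ↦ ((count k (Real.exp (k * y)) : ℝ) : ℂ) :=
      measurable_ofReal.comp ((measurable_count k).comp (by fun_prop))
    have h2 : Measurable fun y : ℝ ↦ (count k (Real.exp (k * y)) : ℂ) := by simpa using h1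
    exact (h2.mul (by fun_prop)).aestronglyMeasurable
  · filter_upwards with y
    rw [norm_mul, norm_mul, norm_natCast]
    gcongr
    refine (count_le k (Real.exp_pos _).le).trans (le_of_eq ?_)
    rw [Complex.norm_exp]
    simp

lemma errTail_mul (A : Finset zeros) (w : ℂ) (y : ℝ) : errTail k A y * cexp (-(w * y)) =
    Set.indicator (Set.Ioi 0) (fun y : ℝ ↦ (count k (Real.exp (k * y)) : ℂ) * cexp (-(w * y))
      - (riemannZeta k)⁻¹ * (cexp ((k : ℂ) * y) * cexp (-(w * y)))
      - cexp (0 * y) * cexp (-(w * y))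
      - ∑ ρ ∈ A, zetaRes k ρ * (cexp (ρ * y) * cexp (-(w * y)))) y := by
  rw [errTail]
  by_cases hy : y ∈ Set.Ioi (0 : ℝ)
  · rw [Set.indicator_of_mem hy, Set.indicator_of_mem hy, M]
    have : ∑ ρ ∈ A, zetaRes k ρ * (cexp (ρ * y) * cexp (-(w * y)))
        = (∑ ρ ∈ A, zetaRes k ρ * cexp (ρ * y)) * cexp (-(w * y)) := by
      rw [Finset.sum_mul]
      exact Finset.sum_congr rfl fun ρ _ ↦ by ring
    rw [this]
    push_cast
    rw [ofReal_re_riemannZeta, zero_mul, Complex.exp_zero]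
    ring
  · rw [Set.indicator_of_notMem hy, Set.indicator_of_notMem hy, zero_mul]

lemma re_lt_of_mem_zeros (hRH : RiemannHypothesis) (hk : 2 ≤ k) {w : ℂ} (hw : (k : ℝ) < w.re)
    (ρ : zeros) : (ρ : ℂ).re < w.re := by
  have hk' : (2 : ℝ) ≤ k := by exact_mod_cast hk
  rw [re_of_mem_zeros hRH ρ.2]
  linarith

lemma integrable_errTail (hRH : RiemannHypothesis) (hk : 2 ≤ k) (A : Finset zeros) {w : ℂ}
    (hw : (k : ℝ) < w.re) : Integrable fun y : ℝ ↦ errTail k A y * cexp (-(w * y)) := by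
  have hk' : (2 : ℝ) ≤ k := by exact_mod_cast hk
  simp only [errTail_mul]
  rw [integrable_indicator_iff measurableSet_Ioi]
  refine (((integrableOn_count hw).sub ((integrableOn_cexp_sub ?_).const_mul _)).sub
    (integrableOn_cexp_sub ?_)).sub (integrable_finsetSum _ fun ρ _ ↦
      (integrableOn_cexp_sub (re_lt_of_mem_zeros hRH hk hw ρ)).const_mul _)
  · simpa using hw
  · simp
    linarith

/-- The Laplace transform of the tail of the error term. -/
theorem integral_errTail (hRH : RiemannHypothesis) (hk : 2 ≤ k) (A : Finset zeros) {w : ℂ}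
    (hw : (k : ℝ) < w.re) :
    ∫ y : ℝ, errTail k A y * cexp (-(w * y)) = tailTransform k A w := by
  have hk' : (2 : ℝ) ≤ k := by exact_mod_cast hk
  have h1 := integrableOn_count (k := k) hw
  have h2 := (integrableOn_cexp_sub (w := w) (ρ := k) (by simpa using hw)).const_mul (riemannZeta k)⁻¹
  have h3 := integrableOn_cexp_sub (w := w) (ρ := 0) (by simp; linarith)
  have h12 : IntegrableOn (fun y : ℝ ↦ (count k (Real.exp (k * y)) : ℂ) * cexp (-(w * y))
      - (riemannZeta k)⁻¹ * (cexp ((k : ℂ) * y) * cexp (-(w * y)))) (Set.Ioi 0) := h1.sub h2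
  have h123 : IntegrableOn (fun y : ℝ ↦ (count k (Real.exp (k * y)) : ℂ) * cexp (-(w * y))
      - (riemannZeta k)⁻¹ * (cexp ((k : ℂ) * y) * cexp (-(w * y)))
      - cexp (0 * y) * cexp (-(w * y))) (Set.Ioi 0) := h12.sub h3
  have h4 : ∀ ρ ∈ A, Integrable (fun y : ℝ ↦ zetaRes k ρ * (cexp (ρ * y) * cexp (-(w * y))))
      (volume.restrict (Set.Ioi 0)) := fun ρ _ ↦
    (integrableOn_cexp_sub (re_lt_of_mem_zeros hRH hk hw ρ)).const_mul _
  simp only [errTail_mul]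
  rw [integral_indicator measurableSet_Ioi, integral_sub h123 (integrable_finsetSum _ h4),
    integral_sub h12 h3, integral_sub h1 h2, integral_finsetSum _ h4, integral_count hk hw,
    integral_const_mul, integral_cexp_sub (by simpa using hw), integral_cexp_sub (by simp; linarith),
    tailTransform, errTransform_eq hk]
  · congr 1
    · rw [sub_zero, ← one_div, one_div_mul_one_div]
    · refine Finset.sum_congr rfl fun ρ _ ↦ ?_
      rw [integral_const_mul, integral_cexp_sub (re_lt_of_mem_zeros hRH hk hw ρ)]
      ring
  · rintro rfl
    simp at hw
    linarith
  · rintro rfl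
    simp at hw
    linarith
  · rintro rfl
    simp at hw
  · exact riemannZeta_ne_zero_of_one_lt_re (by linarith)

end KFree

/-! ### Mean squares of trigonometric sums, and existence of a nontrivial zero. -/

namespace KFree
open MeasureTheory Filter Topology Complex Metric
open scoped ENNReal Real ComplexConjugate

variable {k : ℕ}

lemma tendsto_mean_cexp {l : ℝ} (hl : l ≠ 0) :
    Tendsto (fun Y : ℝ ↦ (Y : ℂ)⁻¹ * ∫ y in (0 : ℝ)..Y, cexp (l * I * y)) atTop (𝓝 0) := by
  have hc : (l * I : ℂ) ≠ 0 := mul_ne_zero (by exact_mod_cast hl) I_ne_zero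
  have h1 : Tendsto (fun Y : ℝ ↦ (2 / |l|) * Y⁻¹) atTop (𝓝 0) := by
    simpa using tendsto_inv_atTop_zero.const_mul (2 / |l|)
  refine squeeze_zero_norm' ?_ h1
  filter_upwards [eventually_gt_atTop 0] with Y hY
  rw [integral_exp_mul_complex hc, norm_mul, norm_inv, norm_real, Real.norm_eq_abs, abs_of_pos hY,
    norm_div, norm_mul, norm_I, mul_one, norm_real, Real.norm_eq_abs, mul_comm]
  gcongr
  refine (norm_sub_le _ _).trans ?_
  rw [Complex.norm_exp, Complex.norm_exp]
  simp
  norm_num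

/-- The mean square of a trigonometric polynomial with distinct frequencies. -/
lemma tendsto_mean_sq_trig {ι : Type*} (A : Finset ι) (c : ι → ℂ) (l : ι → ℝ)
    (hl : Set.InjOn l A) :
    Tendsto (fun Y : ℝ ↦ Y⁻¹ * ∫ y in (0 : ℝ)..Y, ‖∑ i ∈ A, c i * cexp (l i * I * y)‖ ^ 2) atTop
      (𝓝 (∑ i ∈ A, ‖c i‖ ^ 2)) := by
  classical
  have hpt : ∀ y : ℝ, ((‖∑ i ∈ A, c i * cexp (l i * I * y)‖ ^ 2 : ℝ) : ℂ)
      = ∑ i ∈ A, ∑ j ∈ A, c i * conj (c j) * cexp ((l i - l j : ℝ) * I * y) := by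
    intro y
    push_cast
    rw [← Complex.mul_conj', map_sum, Finset.sum_mul_sum]
    refine Finset.sum_congr rfl fun i _ ↦ Finset.sum_congr rfl fun j _ ↦ ?_
    rw [map_mul, ← Complex.exp_conj]
    simp only [map_mul, conj_ofReal, conj_I]
    rw [show ((l i : ℂ) - l j) * I * y = l i * I * y + l j * -I * y by ring,
      Complex.exp_add]
    ring
  have hint : ∀ Y : ℝ, ((Y⁻¹ * ∫ y in (0 : ℝ)..Y, ‖∑ i ∈ A, c i * cexp (l i * I * y)‖ ^ 2 : ℝ) : ℂ)
      = ∑ i ∈ A, ∑ j ∈ A, c i * conj (c j) *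
        ((Y : ℂ)⁻¹ * ∫ y in (0 : ℝ)..Y, cexp ((l i - l j : ℝ) * I * y)) := by
    intro Y
    rw [ofReal_mul, ← intervalIntegral.integral_ofReal]
    simp only [hpt]
    rw [intervalIntegral.integral_finsetSum fun i _ ↦ Continuous.intervalIntegrable (by fun_prop) _ _,
      Finset.mul_sum]
    refine Finset.sum_congr rfl fun i _ ↦ ?_
    rw [intervalIntegral.integral_finsetSum fun j _ ↦ Continuous.intervalIntegrable (by fun_prop) _ _,
      Finset.mul_sum]
    refine Finset.sum_congr rfl fun j _ ↦ ?_
    rw [intervalIntegral.integral_const_mul]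
    push_cast
    ring
  have hlim : Tendsto (fun Y : ℝ ↦ ∑ i ∈ A, ∑ j ∈ A, c i * conj (c j) *
        ((Y : ℂ)⁻¹ * ∫ y in (0 : ℝ)..Y, cexp ((l i - l j : ℝ) * I * y))) atTop
      (𝓝 (∑ i ∈ A, ∑ j ∈ A, c i * conj (c j) * if i = j then 1 else 0)) := by
    refine tendsto_finsetSum _ fun i hi ↦ tendsto_finsetSum _ fun j hj ↦ Tendsto.const_mul _ ?_
    split_ifs with h
    · subst h
      refine tendsto_const_nhds.congr' ?_
      filter_upwards [eventually_gt_atTop 0] with Y hY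
      have : (Y : ℂ) ≠ 0 := by exact_mod_cast hY.ne'
      simp [this]
    · refine tendsto_mean_cexp (sub_ne_zero.mpr fun h' ↦ h (hl hi hj h'))
  have hval : ∑ i ∈ A, ∑ j ∈ A, c i * conj (c j) * (if i = j then 1 else 0)
      = ((∑ i ∈ A, ‖c i‖ ^ 2 : ℝ) : ℂ) := by
    push_cast
    refine Finset.sum_congr rfl fun i hi ↦ ?_
    simp [hi, Complex.mul_conj']
  rw [hval] at hlim
  have := (continuous_re.tendsto _).comp hlim
  refine this.congr fun Y ↦ ?_
  rw [Function.comp_apply, ← hint, ofReal_re]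

/-- A function squeezed in mean square between good approximations converges. -/
lemma tendsto_of_approx {Φ : ℝ → ℝ} {b : ℝ} (hb : 0 ≤ b) (hΦ : ∀ᶠ Y in atTop, 0 ≤ Φ Y)
    (h : ∀ θ : ℝ, 0 < θ → θ < 1 → ∃ Q U : ℝ → ℝ, ∀ᶠ Y in atTop, |Q Y - b| ≤ θ ∧ U Y ≤ θ ^ 2 ∧
      Φ Y ≤ (1 + θ) * Q Y + (1 + θ⁻¹) * U Y ∧ Q Y ≤ (1 + θ) * Φ Y + (1 + θ⁻¹) * U Y) :
    Tendsto Φ atTop (𝓝 b) := by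
  rw [Metric.tendsto_atTop']
  intro ε hε
  set θ := min (1 / 2) (ε / (2 * (b + 4))) with hθ
  have hθ0 : 0 < θ := by positivity
  have hθ1 : θ ≤ 1 / 2 := min_le_left _ _
  have hθ2 : θ * (b + 4) ≤ ε / 2 := by
    have := min_le_right (1 / 2) (ε / (2 * (b + 4)))
    rw [← hθ, le_div_iff₀ (by positivity)] at this
    linarith
  obtain ⟨Q, U, hQU⟩ := h θ hθ0 (by linarith)
  obtain ⟨N, hN⟩ := eventually_atTop.mp (hQU.and hΦ)
  refine ⟨N, fun Y hY ↦ ?_⟩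
  obtain ⟨⟨h1, h2, h3, h4⟩, h5⟩ := hN Y hY.le
  -- The hypothesis `U ≤ θ²` is quadratic because the factor `1 + θ⁻¹` consumes one power of `θ`.
  have h6 : (1 + θ⁻¹) * U Y ≤ 2 * θ := by
    calc (1 + θ⁻¹) * U Y ≤ (1 + θ⁻¹) * θ ^ 2 := by gcongr
      _ = θ ^ 2 + θ := by field_simp
      _ ≤ 2 * θ := by nlinarith
  obtain ⟨h7, h8⟩ := abs_le.mp h1
  rw [Real.dist_eq, abs_lt]
  constructor
  · by_contra! hcon
    have h9 : Φ Y ≤ b - ε := by linarith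
    have : (1 + θ) * Φ Y ≤ Φ Y + θ * b := by nlinarith
    nlinarith
  · nlinarith

lemma norm_add_sq_le {θ : ℝ} (hθ : 0 < θ) (a b : ℂ) :
    ‖a + b‖ ^ 2 ≤ (1 + θ) * ‖a‖ ^ 2 + (1 + θ⁻¹) * ‖b‖ ^ 2 := by
  have h1 : ‖a + b‖ ^ 2 ≤ (‖a‖ + ‖b‖) ^ 2 := by
    gcongr
    exact norm_add_le a b
  have h2 : 2 * (‖a‖ * ‖b‖) ≤ θ * ‖a‖ ^ 2 + θ⁻¹ * ‖b‖ ^ 2 := by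
    have h3 : 0 ≤ θ⁻¹ * (θ * ‖a‖ - ‖b‖) ^ 2 := by positivity
    have h4 : θ⁻¹ * (θ * ‖a‖ - ‖b‖) ^ 2 = θ * ‖a‖ ^ 2 - 2 * (‖a‖ * ‖b‖) + θ⁻¹ * ‖b‖ ^ 2 := by
      field_simp
      ring
    linarith
  nlinarith

/-- The variance of the uniform law on a unit interval is `1/12`, so no choice of `c` makes the
integral smaller. -/
lemma sq_div_twelve_le_integral (c s a : ℝ) :
    s ^ 2 / 12 ≤ ∫ x in a..(a + 1), (c - s * x) ^ 2 := by
  have hderiv : ∀ x ∈ Set.uIcc a (a + 1), HasDerivAt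
      (fun x : ℝ ↦ c ^ 2 * x - c * s * x ^ 2 + s ^ 2 / 3 * x ^ 3) ((c - s * x) ^ 2) x := by
    intro x _
    have := (((hasDerivAt_id x).const_mul (c ^ 2)).sub ((hasDerivAt_pow 2 x).const_mul (c * s))).add
      ((hasDerivAt_pow 3 x).const_mul (s ^ 2 / 3))
    refine this.congr_deriv ?_
    norm_num
    ring
  rw [intervalIntegral.integral_eq_sub_of_hasDerivAt hderiv
    (Continuous.intervalIntegrable (by fun_prop) _ _)]
  nlinarith [sq_nonneg (c - s * a - s / 2)]

/-- The error term is too large to be square integrable with respect to `dx / x`. -/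
lemma lintegral_M_sub_one_eq_top (hk : 2 ≤ k) :
    ∫⁻ x in Set.Ioi (1 : ℝ), ENNReal.ofReal ((M k x - 1) ^ 2 / x) = ⊤ := by
  set s : ℝ := ((riemannZeta k).re)⁻¹ with hs
  have hs0 : s ≠ 0 := by
    refine inv_ne_zero fun h ↦ riemannZeta_natCast_ne_zero hk ?_
    rw [← ofReal_re_riemannZeta, h, ofReal_zero]
  -- Between consecutive integers `M k` is affine with slope `-1/ζ(k)`, so each unit interval
  -- contributes at least a constant times `1/(n+3)`, and the harmonic series diverges.
  have hpiece : ∀ n : ℕ, ENNReal.ofReal (s ^ 2 / 12 * (1 / (n + 3))) ≤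
      ∫⁻ x in Set.Ico ((n : ℝ) + 2) (n + 2 + 1), ENNReal.ofReal ((M k x - 1) ^ 2 / x) := by
    intro n
    set c : ℝ := count k (n + 2) - 1
    have hle : ∀ x ∈ Set.Ico ((n : ℝ) + 2) (n + 2 + 1),
        ENNReal.ofReal (1 / (n + 3) * (c - s * x) ^ 2) ≤ ENNReal.ofReal ((M k x - 1) ^ 2 / x) := by
      intro x hx
      have hx0 : 0 < x := lt_of_lt_of_le (by positivity) hx.1
      have hfl : ⌊x⌋₊ = n + 2 := by
        rw [Nat.floor_eq_iff hx0.le]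
        push_cast
        exact ⟨hx.1, hx.2⟩
      have hfl2 : ⌊(n : ℝ) + 2⌋₊ = n + 2 := by exact_mod_cast Nat.floor_natCast (n + 2)
      have hM : M k x - 1 = c - s * x := by
        have : count k x = count k (n + 2) := by rw [count, count, hfl, hfl2]
        rw [M, this, hs, div_eq_inv_mul]
        ring
      rw [hM, one_div_mul_eq_div]
      refine ENNReal.ofReal_le_ofReal (div_le_div_of_nonneg_left (sq_nonneg _) hx0 ?_)
      linarith [hx.2]
    refine le_trans ?_ (setLIntegral_mono' measurableSet_Ico hle)
    have hint : IntegrableOn (fun x : ℝ ↦ 1 / ((n : ℝ) + 3) * (c - s * x) ^ 2)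
        (Set.Ico ((n : ℝ) + 2) (n + 2 + 1)) :=
      ((by fun_prop : Continuous fun x : ℝ ↦ 1 / ((n : ℝ) + 3) * (c - s * x) ^ 2).integrableOn_Icc
        (a := (n : ℝ) + 2) (b := n + 2 + 1)).mono_set Set.Ico_subset_Icc_self
    rw [← ofReal_integral_eq_lintegral_ofReal hint (Eventually.of_forall fun x ↦ by positivity)]
    refine ENNReal.ofReal_le_ofReal ?_
    rw [integral_const_mul, integral_Ico_eq_integral_Ioo, ← integral_Ioc_eq_integral_Ioo,
      ← intervalIntegral.integral_of_le (by linarith), mul_comm]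
    gcongr
    exact sq_div_twelve_le_integral c s _
  have hdisj : Pairwise (Function.onFun Disjoint fun n : ℕ ↦ Set.Ico ((n : ℝ) + 2) (n + 2 + 1)) := by
    intro m n hmn
    rw [Function.onFun, Set.disjoint_left]
    rintro x ⟨h1, h2⟩ ⟨h3, h4⟩
    rcases lt_or_gt_of_ne hmn with h | h
    · have : (m : ℝ) + 1 ≤ n := by exact_mod_cast h
      linarith
    · have : (n : ℝ) + 1 ≤ m := by exact_mod_cast h
      linarith
  have hsub : (⋃ n : ℕ, Set.Ico ((n : ℝ) + 2) (n + 2 + 1)) ⊆ Set.Ioi 1 := by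
    refine Set.iUnion_subset fun n x hx ↦ ?_
    have : (0 : ℝ) ≤ n := Nat.cast_nonneg n
    simp only [Set.mem_Ioi]
    linarith [hx.1]
  rw [eq_top_iff]
  calc (⊤ : ℝ≥0∞) = ∑' n : ℕ, ENNReal.ofReal (s ^ 2 / 12 * (1 / (n + 3))) := by
        symm
        by_contra hne
        have h1 : Summable fun n : ℕ ↦ s ^ 2 / 12 * (1 / ((n : ℝ) + 3)) := by
          refine (ENNReal.summable_toReal hne).congr fun n ↦ ?_
          rw [ENNReal.toReal_ofReal (by positivity)]
        rw [summable_mul_left_iff (by positivity)] at h1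
        have h2 : Summable fun n : ℕ ↦ 1 / ((n + 3 : ℕ) : ℝ) := by simpa using h1
        exact Real.not_summable_one_div_natCast ((summable_nat_add_iff 3).mp h2)
    _ ≤ ∑' n : ℕ, ∫⁻ x in Set.Ico ((n : ℝ) + 2) (n + 2 + 1), ENNReal.ofReal ((M k x - 1) ^ 2 / x) :=
        ENNReal.tsum_le_tsum hpiece
    _ = ∫⁻ x in ⋃ n : ℕ, Set.Ico ((n : ℝ) + 2) (n + 2 + 1), ENNReal.ofReal ((M k x - 1) ^ 2 / x) :=
        (lintegral_iUnion (fun n ↦ measurableSet_Ico) hdisj _).symm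
    _ ≤ _ := lintegral_mono_set hsub

/-- The zeta function has a zero off the real axis. -/
theorem zeros_nonempty (hRH : RiemannHypothesis) : zeros.Nonempty := by
  -- Without zeros the only pole to remove is at `0`. For `k = 2` the transform of `M - 1` then
  -- continues to a function of finite mean square on `re w = -1`, so `M - 1` is square integrable
  -- even with the weight `exp (2y)`. This contradicts `lintegral_M_sub_one_eq_top`.
  by_contra hemp
  rw [Set.not_nonempty_iff_eq_empty] at hemp
  have hZ : IsEmpty zeros := by rw [hemp]; infer_instance
  have hk : 2 ≤ 2 := le_rfl
  have hsimple : ∀ ρ ∈ upperZeros, deriv riemannZeta ρ ≠ 0 := fun ρ hρ ↦ by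
    have := mem_zeros_of_mem_upperZeros hρ
    rw [hemp] at this
    exact this.elim
  have hR : ∀ ρ : zeros, ‖zetaRes 2 ρ‖ ≤ 0 := fun ρ ↦ isEmptyElim ρ
  have hG := stripFunction_regTransform hRH hsimple hk hR
  obtain ⟨B, _, hB⟩ := exists_lineNorm_regTransform_le hRH hsimple hk hR one_pos le_rfl
    (.of_finite)
  obtain ⟨C, hC0, hC⟩ := exists_norm_gaussSlope_le 3
  have hsl : Differentiable ℂ gaussSlope :=
    differentiable_dslope (by have := differentiable_gaussKer; fun_prop) 0
  have hF : StripFunction (fun w ↦ regTransform 2 w + gaussSlope w) (-1) (2 + 1 : ℝ) := by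
    obtain ⟨C', n, hC'⟩ := hG.growth
    refine ⟨fun w h1 h2 ↦ (hG.diff w h1 (by simpa using h2)).add (hsl w), |C'| + C, n, fun w h1 h2 ↦ ?_⟩
    have hy : 1 ≤ 1 + |w.im| := by linarith [abs_nonneg w.im]
    have hp : 1 ≤ (1 + |w.im|) ^ n := one_le_pow₀ hy
    refine (norm_add_le _ _).trans ?_
    rw [add_mul]
    gcongr
    · refine (hC' w h1 (by simpa using h2)).trans ?_
      gcongr
      exact le_abs_self _
    · refine (hC w (abs_le.mpr ⟨by linarith, by linarith⟩)).trans ?_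
      exact (div_le_self hC0.le hy).trans (le_mul_of_one_le_right hC0.le hp)
  have hval : ∀ w : ℂ, w.re = 2 + 1 → tailTransform 2 ∅ w = regTransform 2 w + gaussSlope w := by
    intro w hw
    rw [tailTransform_eq hRH hR ∅ (by rintro rfl; norm_num at hw) (by linarith) (by rw [hw]; norm_num)]
    simp [poleSum]
  have hT := hF.lintegral_le_lineNorm (by norm_num) (f := errTail 2 ∅)
    (by
      have := integrable_errTail hRH hk ∅ (w := ((2 + 1 : ℝ) : ℂ)) (by norm_num)
      exact this)
    (continuousAt_errTail_ae (by norm_num) ∅) (fun t ↦ by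
      rw [← hval _ (by simp), ← integral_errTail hRH hk ∅ (by simp)])
  have hfin : lineNorm (fun w ↦ regTransform 2 w + gaussSlope w) (-1) < ⊤ := by
    refine (lineNorm_le_add (G := regTransform 2) (S := fun _ ↦ 0) (C := C) (σ := -1)
      (hG.continuous_line le_rfl (by norm_num)) fun w hw ↦ ?_).trans_lt ?_
    · rw [norm_zero, add_zero, add_comm (C / _)]
      refine (norm_add_le _ _).trans ?_
      gcongr
      exact hC w (by rw [hw]; norm_num)
    · refine ENNReal.mul_lt_top (by norm_num) ?_
      have h5 : lineNorm (fun _ ↦ 0) (-1) = 0 := by simp [lineNorm]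
      rw [h5, add_zero]
      exact ENNReal.add_lt_top.mpr ⟨ENNReal.ofReal_lt_top,
        (hB (-1) le_rfl (by norm_num)).trans_lt ENNReal.ofReal_lt_top⟩
  have htop := lintegral_M_sub_one_eq_top hk
  rw [← image_exp_Ioi (k := 2) (by omega), lintegral_image_eq_lintegral_abs_deriv_mul measurableSet_Ioi
    (fun y _ ↦ (hasDerivAt_exp_mul (2 : ℕ) y).hasDerivWithinAt) (injective_exp_mul (by omega)).injOn]
    at htop
  have hlt : ∫⁻ y in Set.Ioi (0 : ℝ), ENNReal.ofReal |((2 : ℕ) : ℝ) * Real.exp ((2 : ℕ) * y)| *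
      ENNReal.ofReal ((M 2 (Real.exp ((2 : ℕ) * y)) - 1) ^ 2 / Real.exp ((2 : ℕ) * y))
      ≤ 2 * lineNorm (fun w ↦ regTransform 2 w + gaussSlope w) (-1) := by
    calc _ ≤ ∫⁻ y in Set.Ioi (0 : ℝ), 2 * ‖errTail 2 ∅ y * cexp (-((-1 : ℝ) * y))‖ₑ ^ 2 := by
          refine setLIntegral_mono' measurableSet_Ioi fun y hy ↦ ?_
          rw [← ENNReal.ofReal_mul (by positivity), ← ofReal_norm, ← ENNReal.ofReal_pow (norm_nonneg _),
            ← ENNReal.ofReal_ofNat 2, ← ENNReal.ofReal_mul (by norm_num)]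
          refine ENNReal.ofReal_le_ofReal ?_
          have hy0 : (0 : ℝ) < y := hy
          have e1 : errTail 2 ∅ y = ((M 2 (Real.exp ((2 : ℕ) * y)) - 1 : ℝ) : ℂ) := by
            rw [errTail, Set.indicator_of_mem hy]
            simp
          rw [e1, norm_mul, norm_real, Real.norm_eq_abs, mul_pow, sq_abs, Complex.norm_exp,
            abs_of_pos (by positivity)]
          have e2 : 1 ≤ Real.exp ((-(((-1 : ℝ) : ℂ) * (y : ℂ))).re) := by
            rw [Real.one_le_exp_iff]
            simp
            exact hy0.le
          have e3 : 1 ≤ Real.exp ((-(((-1 : ℝ) : ℂ) * (y : ℂ))).re) ^ 2 := one_le_pow₀ e2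
          have e4 : 0 < Real.exp ((2 : ℕ) * y) := Real.exp_pos _
          have e5 : ((2 : ℕ) : ℝ) * Real.exp ((2 : ℕ) * y) *
              ((M 2 (Real.exp ((2 : ℕ) * y)) - 1) ^ 2 / Real.exp ((2 : ℕ) * y))
              = 2 * (M 2 (Real.exp ((2 : ℕ) * y)) - 1) ^ 2 := by
            rw [Nat.cast_ofNat] at e4 ⊢
            field_simp
          rw [e5]
          nlinarith [sq_nonneg (M 2 (Real.exp ((2 : ℕ) * y)) - 1)]
      _ ≤ ∫⁻ y : ℝ, 2 * ‖errTail 2 ∅ y * cexp (-((-1 : ℝ) * y))‖ₑ ^ 2 :=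
          setLIntegral_le_lintegral _ _
      _ = 2 * ∫⁻ y : ℝ, ‖errTail 2 ∅ y * cexp (-((-1 : ℝ) * y))‖ₑ ^ 2 :=
          lintegral_const_mul' _ _ (by norm_num)
      _ ≤ _ := by gcongr
  rw [htop] at hlt
  exact absurd (hlt.trans_lt (ENNReal.mul_lt_top (by norm_num) hfin)) (lt_irrefl _)

end KFree

/-! ### Approximation in mean square, and the asymptotics in `X`. -/

namespace KFree
open MeasureTheory Filter Topology Complex Metric
open scoped ENNReal Real ComplexConjugate

variable {k : ℕ}

/-- The normalised error term in logarithmic scale. -/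
noncomputable def normErr (k : ℕ) (y : ℝ) : ℝ := M k (Real.exp (k * y)) * Real.exp (-(y / 2))

/-- The trigonometric polynomial formed by the zeros in `A`. -/
noncomputable def zeroTrig (k : ℕ) (A : Finset zeros) (y : ℝ) : ℂ :=
  ∑ ρ ∈ A, zetaRes k ρ * cexp ((ρ : ℂ).im * I * y)

lemma continuous_zeroTrig (A : Finset zeros) : Continuous (zeroTrig k A) := by
  unfold zeroTrig
  fun_prop

lemma measurable_normErr (k : ℕ) : Measurable (normErr k) :=
  ((measurable_M k).comp (by fun_prop)).mul (by fun_prop)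

lemma exists_abs_normErr_le (k : ℕ) (Y : ℝ) : ∃ C : ℝ, ∀ y ∈ Set.uIoc 0 Y, |normErr k y| ≤ C := by
  obtain ⟨C, hC0, hC⟩ := exists_abs_M_le k
  refine ⟨C * Real.exp (k * |Y|) * Real.exp |Y|, fun y hy ↦ ?_⟩
  have hy' : |y| ≤ |Y| := by
    rcases le_total 0 Y with h | h
    · rw [Set.uIoc_of_le h] at hy
      rw [abs_of_pos hy.1, abs_of_nonneg h]
      exact hy.2
    · rw [Set.uIoc_of_ge h] at hy
      rw [abs_of_nonpos hy.2, abs_of_nonpos h]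
      linarith [hy.1]
  rw [normErr, abs_mul, abs_of_pos (Real.exp_pos (-(y / 2)))]
  gcongr
  · refine (hC _ (Real.exp_pos _).le).trans ?_
    gcongr
    exact (le_abs_self y).trans hy'
  · linarith [neg_le_abs y, abs_nonneg y]

lemma intervalIntegrable_normErr_sub_sq (k : ℕ) {g : ℝ → ℂ} (hg : Continuous g) (Y : ℝ) :
    IntervalIntegrable (fun y ↦ ‖(normErr k y : ℂ) - g y‖ ^ 2) volume 0 Y := by
  obtain ⟨C, hC⟩ := exists_abs_normErr_le k Y
  obtain ⟨B, hB⟩ := (isCompact_uIcc (a := (0 : ℝ)) (b := Y)).exists_bound_of_continuousOn hg.continuousOn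
  rw [intervalIntegrable_iff]
  refine Measure.integrableOn_of_bounded (M := (C + B) ^ 2) (by simp) ?_ ?_
  · exact (((measurable_ofReal.comp (measurable_normErr k)).sub hg.measurable).norm.pow_const 2
      ).aestronglyMeasurable
  · filter_upwards [ae_restrict_mem measurableSet_uIoc] with y hy
    rw [Real.norm_of_nonneg (by positivity)]
    gcongr
    refine (norm_sub_le _ _).trans (add_le_add ?_ (hB y (Set.uIoc_subset_uIcc hy)))
    rw [norm_real]
    exact hC y hy

lemma normErr_sub_zeroTrig (hRH : RiemannHypothesis) (A : Finset zeros) {y : ℝ} (hy : 0 < y) :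
    (normErr k y : ℂ) - zeroTrig k A y
      = errTail k A y * cexp (-((1 / 2 : ℝ) * y)) + cexp (-((1 / 2 : ℝ) * y)) := by
  rw [errTail, Set.indicator_of_mem (Set.mem_Ioi.mpr hy), sub_mul, sub_mul, Finset.sum_mul, normErr,
    zeroTrig]
  have h1 : ∑ ρ ∈ A, zetaRes k ρ * cexp (ρ * y) * cexp (-((1 / 2 : ℝ) * y))
      = ∑ ρ ∈ A, zetaRes k ρ * cexp ((ρ : ℂ).im * I * y) := by
    refine Finset.sum_congr rfl fun ρ _ ↦ ?_
    rw [mul_assoc, ← Complex.exp_add]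
    congr 2
    nth_rewrite 1 [← re_add_im (ρ : ℂ)]
    rw [re_of_mem_zeros hRH ρ.2]
    ring
  rw [h1]
  push_cast
  rw [show -((y : ℂ) / 2) = -(1 / 2 * y) by ring]
  ring

/-- Mean square approximation of the error term by trigonometric polynomials. -/
lemma integral_normErr_sub_zeroTrig_le (hRH : RiemannHypothesis)
    (hsimple : ∀ ρ ∈ upperZeros, deriv riemannZeta ρ ≠ 0) (hk : 2 ≤ k) {R₀ : ℝ}
    (hR : ∀ ρ : zeros, ‖zetaRes k ρ‖ ≤ R₀) {η : ℝ} (hη : 0 < η) (hη1 : η ≤ 1)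
    (hs : Summable fun ρ : zeros ↦ ‖zetaRes k ρ‖ ^ 2 * (1 + |(ρ : ℂ).im|) ^ η) :
    ∃ C : ℝ, 0 < C ∧ ∀ A : Finset zeros, ∃ B : ℝ, ∀ Y : ℝ, 1 ≤ Y →
      ∫ y in (0 : ℝ)..Y, ‖(normErr k y : ℂ) - zeroTrig k A y‖ ^ 2 ≤ B + C * Y *
        (∑' ρ : zeros, ‖zetaRes k ρ‖ ^ 2 * (1 + |(ρ : ℂ).im|) ^ η
        - ∑ ρ ∈ A, ‖zetaRes k ρ‖ ^ 2 * (1 + |(ρ : ℂ).im|) ^ η) := by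
  have hk' : (2 : ℝ) ≤ k := by exact_mod_cast hk
  obtain ⟨C, hC0, hC⟩ := exists_lineNorm_tailTransform_le hRH hsimple hk hR hη hη1 hs
  set E : ℝ := Real.exp 2 with hE
  refine ⟨2 * E * C, by positivity, fun A ↦ ?_⟩
  obtain ⟨B, hB0, hB⟩ := hC A
  refine ⟨2 * E * B + 2, fun Y hY ↦ ?_⟩
  set τ := ∑' ρ : zeros, ‖zetaRes k ρ‖ ^ 2 * (1 + |(ρ : ℂ).im|) ^ η
        - ∑ ρ ∈ A, ‖zetaRes k ρ‖ ^ 2 * (1 + |(ρ : ℂ).im|) ^ η with hτ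
  have hτ0 : 0 ≤ τ := (hasSum_tailRes A hs).nonneg fun ρ ↦ by positivity
  have hY0 : 0 < Y := by linarith
  have hYinv : Y⁻¹ ≤ 1 := inv_le_one_of_one_le₀ hY
  have hYinv0 : 0 < Y⁻¹ := by positivity
  -- On `[0, Y]` the weight `exp (-2σy)` is at least `exp (-2) exp (-y)`, while `1/(σ - 1/2) = Y` is
  -- the expected order of the integral.
  set σ : ℝ := 1 / 2 + Y⁻¹ with hσ
  have h1 := hB σ (by linarith) (by linarith)
  rw [show σ - 1 / 2 = Y⁻¹ by rw [hσ]; ring, div_inv_eq_mul] at h1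
  have hT := (stripFunction_tailTransform hRH hsimple hk hR A (a := σ) (by linarith)).lintegral_le_lineNorm
    (by linarith) (f := errTail k A)
    (by simpa using integrable_errTail hRH hk A (w := ((k + 1 : ℝ) : ℂ)) (by simp))
    (continuousAt_errTail_ae (by omega) A)
    (fun t ↦ integral_errTail hRH hk A (by simp))
  have hTB := hT.trans h1
  -- The term `2 exp (-y)` comes from the constant `1` that `errTail` subtracts, the residue at `0`;
  -- its integral is bounded.
  have hpt : ∀ y ∈ Set.Ioc 0 Y, ENNReal.ofReal (‖(normErr k y : ℂ) - zeroTrig k A y‖ ^ 2)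
      ≤ ENNReal.ofReal (2 * Real.exp (-y))
        + ENNReal.ofReal (2 * E) * ‖errTail k A y * cexp (-(σ * y))‖ₑ ^ 2 := by
    intro y hy
    rw [← ofReal_norm, ← ENNReal.ofReal_pow (norm_nonneg _), ← ENNReal.ofReal_mul (by positivity),
      ← ENNReal.ofReal_add (by positivity) (by positivity)]
    refine ENNReal.ofReal_le_ofReal ?_
    rw [normErr_sub_zeroTrig hRH A hy.1]
    have e1 := norm_add_sq_le one_pos (errTail k A y * cexp (-((1 / 2 : ℝ) * y)))
      (cexp (-((1 / 2 : ℝ) * y)))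
    have e2 : ∀ a : ℝ, ‖cexp (-(a * y))‖ ^ 2 = Real.exp (-(2 * a * y)) := by
      intro a
      rw [Complex.norm_exp, ← Real.exp_nat_mul]
      congr 1
      simp
      ring
    rw [norm_mul, mul_pow, e2] at e1
    rw [norm_mul, mul_pow, e2]
    have e3 : Real.exp (-(2 * (1 / 2) * y)) ≤ E * Real.exp (-(2 * σ * y)) := by
      rw [hE, ← Real.exp_add, Real.exp_le_exp, hσ]
      have : Y⁻¹ * y ≤ 1 := by
        rw [inv_mul_le_iff₀ hY0]
        linarith [hy.2]
      linarith
    have e4 : Real.exp (-(2 * (1 / 2) * y)) = Real.exp (-y) := by ring_nf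
    have e5 := mul_le_mul_of_nonneg_left e3 (sq_nonneg ‖errTail k A y‖)
    rw [inv_one] at e1
    linarith
  have hexp : ∫⁻ y in Set.Ioc 0 Y, ENNReal.ofReal (2 * Real.exp (-y)) ≤ ENNReal.ofReal 2 := by
    have hint : IntegrableOn (fun y : ℝ ↦ 2 * Real.exp (-y)) (Set.Ioi 0) :=
      (integrableOn_exp_neg_Ioi 0).const_mul 2
    calc _ ≤ ∫⁻ y in Set.Ioi (0 : ℝ), ENNReal.ofReal (2 * Real.exp (-y)) :=
          lintegral_mono_set Set.Ioc_subset_Ioi_self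
      _ = ENNReal.ofReal 2 := by
          rw [← ofReal_integral_eq_lintegral_ofReal hint (Eventually.of_forall fun y ↦ by positivity),
            integral_const_mul, integral_exp_neg_Ioi]
          simp
  have hint := intervalIntegrable_normErr_sub_sq k (continuous_zeroTrig (k := k) A) Y
  rw [intervalIntegrable_iff, Set.uIoc_of_le hY0.le] at hint
  rw [intervalIntegral.integral_of_le hY0.le, ← ENNReal.ofReal_le_ofReal_iff (by positivity),
    ofReal_integral_eq_lintegral_ofReal hint (Eventually.of_forall fun y ↦ by positivity)]
  calc ∫⁻ y in Set.Ioc 0 Y, ENNReal.ofReal (‖(normErr k y : ℂ) - zeroTrig k A y‖ ^ 2)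
      ≤ ∫⁻ y in Set.Ioc 0 Y, (ENNReal.ofReal (2 * Real.exp (-y))
        + ENNReal.ofReal (2 * E) * ‖errTail k A y * cexp (-(σ * y))‖ₑ ^ 2) :=
        setLIntegral_mono' measurableSet_Ioc hpt
    _ = (∫⁻ y in Set.Ioc 0 Y, ENNReal.ofReal (2 * Real.exp (-y)))
        + ENNReal.ofReal (2 * E) * ∫⁻ y in Set.Ioc 0 Y, ‖errTail k A y * cexp (-(σ * y))‖ₑ ^ 2 := by
        rw [lintegral_add_left (by fun_prop), lintegral_const_mul' _ _ ENNReal.ofReal_ne_top]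
    _ ≤ ENNReal.ofReal 2 + ENNReal.ofReal (2 * E) * ENNReal.ofReal (B + C * Y * τ) := by
        gcongr
        exact (setLIntegral_le_lintegral _ _).trans hTB
    _ = _ := by
        rw [← ENNReal.ofReal_mul (by positivity), ← ENNReal.ofReal_add (by positivity) (by positivity)]
        congr 1
        ring

lemma im_injective_zeros (hRH : RiemannHypothesis) : Function.Injective fun ρ : zeros ↦ (ρ : ℂ).im := by
  intro ρ ρ' h
  refine Subtype.ext (Complex.ext ?_ h)
  rw [re_of_mem_zeros hRH ρ.2, re_of_mem_zeros hRH ρ'.2]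

/-- The mean square of the normalised error term. -/
theorem tendsto_mean_normErr_sq (hRH : RiemannHypothesis)
    (hsimple : ∀ ρ ∈ upperZeros, deriv riemannZeta ρ ≠ 0)
    (hJ : ∀ ε : ℝ, 0 < ε → J =O[atTop] fun T : ℝ ↦ T ^ (1 + ε)) (hk : 2 ≤ k) :
    (Summable fun ρ : zeros ↦ ‖zetaRes k ρ‖ ^ 2) ∧
      Tendsto (fun Y : ℝ ↦ Y⁻¹ * ∫ y in (0 : ℝ)..Y, normErr k y ^ 2) atTop
        (𝓝 (∑' ρ : zeros, ‖zetaRes k ρ‖ ^ 2)) := by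
  obtain ⟨η, hη, hη1, hs⟩ := summable_zetaRes hRH hJ hk
  have hle : ∀ ρ : zeros, ‖zetaRes k ρ‖ ^ 2 ≤ ‖zetaRes k ρ‖ ^ 2 * (1 + |(ρ : ℂ).im|) ^ η := fun ρ ↦
    le_mul_of_one_le_right (by positivity)
      (Real.one_le_rpow (by linarith [abs_nonneg (ρ : ℂ).im]) hη.le)
  have hsum : Summable fun ρ : zeros ↦ ‖zetaRes k ρ‖ ^ 2 :=
    hs.of_nonneg_of_le (fun ρ ↦ by positivity) hle
  refine ⟨hsum, ?_⟩
  set b := ∑' ρ : zeros, ‖zetaRes k ρ‖ ^ 2 with hb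
  have hb0 : 0 ≤ b := tsum_nonneg fun ρ ↦ by positivity
  have hR : ∀ ρ : zeros, ‖zetaRes k ρ‖ ≤ b + 1 := fun ρ ↦ by
    have := hsum.le_tsum ρ fun _ _ ↦ by positivity
    nlinarith [sq_nonneg (‖zetaRes k ρ‖ - 1)]
  obtain ⟨C, hC0, hC⟩ := integral_normErr_sub_zeroTrig_le hRH hsimple hk hR hη hη1 hs
  refine tendsto_of_approx hb0 ?_ fun θ hθ0 hθ1 ↦ ?_
  · filter_upwards [eventually_gt_atTop 0] with Y hY
    exact mul_nonneg (by positivity) (intervalIntegral.integral_nonneg hY.le fun y _ ↦ sq_nonneg _)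
  -- A finite set of zeros is chosen that nearly exhausts both the sum `b` and the weighted sum
  -- `b'`. The second condition controls the approximation error, as `C` does not depend on the set.
  have hA1 : ∀ᶠ A : Finset zeros in atTop, |∑ ρ ∈ A, ‖zetaRes k ρ‖ ^ 2 - b| < θ / 2 := by
    have h : Tendsto (fun A : Finset zeros ↦ ∑ ρ ∈ A, ‖zetaRes k ρ‖ ^ 2) atTop (𝓝 b) := hsum.hasSum
    simpa only [Real.dist_eq] using Metric.tendsto_nhds.mp h (θ / 2) (by positivity)
  set b' := ∑' ρ : zeros, ‖zetaRes k ρ‖ ^ 2 * (1 + |(ρ : ℂ).im|) ^ η with hb'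
  have hA2 : ∀ᶠ A : Finset zeros in atTop,
      |∑ ρ ∈ A, ‖zetaRes k ρ‖ ^ 2 * (1 + |(ρ : ℂ).im|) ^ η - b'| < θ ^ 2 / (2 * C) := by
    have h : Tendsto (fun A : Finset zeros ↦ ∑ ρ ∈ A, ‖zetaRes k ρ‖ ^ 2 * (1 + |(ρ : ℂ).im|) ^ η)
      atTop (𝓝 b') := hs.hasSum
    simpa only [Real.dist_eq] using Metric.tendsto_nhds.mp h (θ ^ 2 / (2 * C)) (by positivity)
  obtain ⟨A, hA1, hA2⟩ := (hA1.and hA2).exists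
  obtain ⟨B, hB⟩ := hC A
  have hQ := tendsto_mean_sq_trig A (fun ρ ↦ zetaRes k ρ) (fun ρ ↦ (ρ : ℂ).im)
    (im_injective_zeros hRH).injOn
  have hBY : Tendsto (fun Y : ℝ ↦ |B| * Y⁻¹) atTop (𝓝 0) := by
    simpa using tendsto_inv_atTop_zero.const_mul |B|
  refine ⟨fun Y ↦ Y⁻¹ * ∫ y in (0 : ℝ)..Y, ‖zeroTrig k A y‖ ^ 2,
    fun Y ↦ Y⁻¹ * ∫ y in (0 : ℝ)..Y, ‖(normErr k y : ℂ) - zeroTrig k A y‖ ^ 2, ?_⟩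
  filter_upwards [Metric.tendsto_nhds.mp hQ (θ / 2) (by positivity),
    hBY.eventually_lt_const (show 0 < θ ^ 2 / 2 by positivity), eventually_ge_atTop 1] with Y h1 h2 hY
  have hY0 : 0 < Y := by linarith
  have i1 := intervalIntegrable_normErr_sub_sq k (continuous_zeroTrig (k := k) A) Y
  have i2 : IntervalIntegrable (fun y ↦ ‖zeroTrig k A y‖ ^ 2) volume 0 Y :=
    ((continuous_zeroTrig A).norm.pow 2).intervalIntegrable _ _
  have i3 : IntervalIntegrable (fun y ↦ normErr k y ^ 2) volume 0 Y := by
    simpa using intervalIntegrable_normErr_sub_sq k (continuous_const (y := (0 : ℂ))) Y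
  have hnorm : ∀ y, normErr k y ^ 2 = ‖(normErr k y : ℂ)‖ ^ 2 := fun y ↦ by simp
  refine ⟨?_, ?_, ?_, ?_⟩
  · rw [Real.dist_eq] at h1
    have := abs_sub_le (Y⁻¹ * ∫ y in (0 : ℝ)..Y, ‖zeroTrig k A y‖ ^ 2) (∑ ρ ∈ A, ‖zetaRes k ρ‖ ^ 2) b
    unfold zeroTrig at this ⊢
    linarith
  · have h3 := mul_le_mul_of_nonneg_left (hB Y hY) (inv_nonneg.mpr hY0.le)
    have h4 : b' - ∑ ρ ∈ A, ‖zetaRes k ρ‖ ^ 2 * (1 + |(ρ : ℂ).im|) ^ η ≤ θ ^ 2 / (2 * C) := by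
      linarith [(abs_lt.mp hA2).1]
    have h5 : Y⁻¹ * (B + C * Y * (b' - ∑ ρ ∈ A, ‖zetaRes k ρ‖ ^ 2 * (1 + |(ρ : ℂ).im|) ^ η))
        = B * Y⁻¹ + C * (b' - ∑ ρ ∈ A, ‖zetaRes k ρ‖ ^ 2 * (1 + |(ρ : ℂ).im|) ^ η) := by
      field_simp
    have h6 : C * (b' - ∑ ρ ∈ A, ‖zetaRes k ρ‖ ^ 2 * (1 + |(ρ : ℂ).im|) ^ η) ≤ θ ^ 2 / 2 := by
      calc _ ≤ C * (θ ^ 2 / (2 * C)) := by gcongr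
        _ = _ := by field_simp
    have h7 : B * Y⁻¹ ≤ |B| * Y⁻¹ := by
      gcongr
      exact le_abs_self B
    rw [h5] at h3
    linarith
  · rw [mul_left_comm (1 + θ), mul_left_comm (1 + θ⁻¹), ← mul_add,
      ← intervalIntegral.integral_const_mul (1 + θ), ← intervalIntegral.integral_const_mul (1 + θ⁻¹),
      ← intervalIntegral.integral_add (i2.const_mul _) (i1.const_mul _)]
    gcongr
    refine intervalIntegral.integral_mono_on hY0.le i3 ((i2.const_mul _).add (i1.const_mul _))
      fun y _ ↦ ?_
    rw [hnorm]
    have := norm_add_sq_le hθ0 (zeroTrig k A y) ((normErr k y : ℂ) - zeroTrig k A y)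
    rwa [add_sub_cancel] at this
  · rw [mul_left_comm (1 + θ), mul_left_comm (1 + θ⁻¹), ← mul_add,
      ← intervalIntegral.integral_const_mul (1 + θ), ← intervalIntegral.integral_const_mul (1 + θ⁻¹),
      ← intervalIntegral.integral_add (i3.const_mul _) (i1.const_mul _)]
    gcongr
    refine intervalIntegral.integral_mono_on hY0.le i2 ((i3.const_mul _).add (i1.const_mul _))
      fun y _ ↦ ?_
    rw [hnorm]
    have := norm_add_sq_le hθ0 (normErr k y : ℂ) (-((normErr k y : ℂ) - zeroTrig k A y))
    rwa [norm_neg, neg_sub, add_sub_cancel] at this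

lemma integral_M_eq (hk : 1 ≤ k) {X : ℝ} (hX : 1 ≤ X) :
    ∫ x in (1 : ℝ)..X, (M k x / x ^ (1 / (2 * (k : ℝ)))) ^ 2 / x
      = k * ∫ y in (0 : ℝ)..(Real.log X / k), normErr k y ^ 2 := by
  have hk' : (0 : ℝ) < k := by exact_mod_cast hk
  have hX0 : 0 < X := by linarith
  have himg : (fun y : ℝ ↦ Real.exp (k * y)) '' Set.Ioc 0 (Real.log X / k) = Set.Ioc 1 X := by
    ext x
    simp only [Set.mem_image, Set.mem_Ioc]
    constructor
    · rintro ⟨y, ⟨h1, h2⟩, rfl⟩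
      refine ⟨Real.one_lt_exp_iff.mpr (by positivity), ?_⟩
      rw [← Real.le_log_iff_exp_le hX0]
      rw [le_div_iff₀ hk'] at h2
      linarith
    · rintro ⟨h1, h2⟩
      have hx0 : 0 < x := by linarith
      refine ⟨Real.log x / k, ⟨div_pos (Real.log_pos h1) hk', ?_⟩, ?_⟩
      · gcongr
      · rw [mul_div_cancel₀ _ hk'.ne', Real.exp_log hx0]
  have hY : 0 ≤ Real.log X / k := div_nonneg (Real.log_nonneg hX) hk'.le
  rw [intervalIntegral.integral_of_le hX, intervalIntegral.integral_of_le hY, ← himg,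
    integral_image_eq_integral_abs_deriv_smul measurableSet_Ioc
    (fun y _ ↦ (hasDerivAt_exp_mul k y).hasDerivWithinAt) (injective_exp_mul hk).injOn,
    ← integral_const_mul]
  refine setIntegral_congr_fun measurableSet_Ioc fun y _ ↦ ?_
  simp only [smul_eq_mul]
  rw [abs_of_pos (by positivity), normErr, ← Real.exp_mul,
    show (k : ℝ) * y * (1 / (2 * k)) = y / 2 by field_simp, Real.exp_neg]
  have := Real.exp_pos (k * y)
  have := Real.exp_pos (y / 2)
  field_simp

/-- The point `ρ/k` is not real and has real part `1/(2k) ≠ 1/2`, so RH forbids a zero there. Hence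
no residue vanishes. -/
lemma riemannZeta_div_ne_zero (hRH : RiemannHypothesis) (hk : 2 ≤ k) {ρ : ℂ} (hρ : ρ ∈ zeros) :
    riemannZeta (ρ / k) ≠ 0 := by
  have hk' : (2 : ℝ) ≤ k := by exact_mod_cast hk
  intro h
  have h1 : ρ / k ∈ zeros := by
    refine ⟨h, ?_⟩
    rw [div_natCast_im]
    exact div_ne_zero hρ.2 (by linarith)
  have h2 := re_of_mem_zeros hRH h1
  rw [div_natCast_re, re_of_mem_zeros hRH hρ, div_eq_iff (by linarith)] at h2
  linarith

lemma summable_zetaRes_upperZeros (h : Summable fun ρ : zeros ↦ ‖zetaRes k ρ‖ ^ 2) :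
    Summable fun ρ : upperZeros ↦ ‖zetaRes k ρ‖ ^ 2 := by
  have hinj : Function.Injective (Set.inclusion fun ρ : ℂ ↦ mem_zeros_of_mem_upperZeros (ρ := ρ)) :=
    Set.inclusion_injective _
  exact (h.comp_injective hinj).congr fun ρ ↦ rfl

lemma tsum_zeros_eq_beta (h : Summable fun ρ : upperZeros ↦ ‖zetaRes k ρ‖ ^ 2) :
    ∑' ρ : zeros, ‖zetaRes k ρ‖ ^ 2 = beta k := by
  have h1 := (hasSum_zeros (f := fun ρ ↦ ‖zetaRes k ρ‖ ^ 2)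
    (fun ρ ↦ by rw [norm_zetaRes_conj]) h.hasSum).tsum_eq
  rw [h1, beta, ← tsum_mul_left]
  simp only [betaTerm_eq]

lemma zetaRes_ne_zero (hRH : RiemannHypothesis)
    (hsimple : ∀ ρ ∈ upperZeros, deriv riemannZeta ρ ≠ 0) (hk : 2 ≤ k) {ρ : ℂ} (hρ : ρ ∈ zeros) :
    zetaRes k ρ ≠ 0 := by
  have hρ0 : ρ ≠ 0 := by
    rintro rfl
    exact hρ.2 (by simp)
  exact div_ne_zero (riemannZeta_div_ne_zero hRH hk hρ)
    (mul_ne_zero hρ0 (deriv_riemannZeta_ne_zero hsimple hρ))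

/-- Asymptotic equivalence to `0` would mean eventual vanishing, so the limit must be shown
positive; one nontrivial zero suffices. -/
lemma tsum_zetaRes_pos (hRH : RiemannHypothesis)
    (hsimple : ∀ ρ ∈ upperZeros, deriv riemannZeta ρ ≠ 0) (hk : 2 ≤ k)
    (h : Summable fun ρ : zeros ↦ ‖zetaRes k ρ‖ ^ 2) : 0 < ∑' ρ : zeros, ‖zetaRes k ρ‖ ^ 2 := by
  obtain ⟨ρ, hρ⟩ := zeros_nonempty hRH
  have h0 := norm_pos_iff.mpr (zetaRes_ne_zero hRH hsimple hk hρ)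
  have h1 := h.le_tsum ⟨ρ, hρ⟩ fun _ _ ↦ by positivity
  exact lt_of_lt_of_le (pow_pos h0 2) h1

/-- The Jacobian `k` of `x = exp (k y)` cancels against the length `log X / k` of the range of `y`,
so no factor `k` survives. -/
lemma isEquivalent_integral_M (hk : 1 ≤ k) {b : ℝ} (hb : 0 < b)
    (h : Tendsto (fun Y : ℝ ↦ Y⁻¹ * ∫ y in (0 : ℝ)..Y, normErr k y ^ 2) atTop (𝓝 b)) :
    Asymptotics.IsEquivalent atTop
      (fun X : ℝ ↦ ∫ x in (1 : ℝ)..X, (M k x / x ^ (1 / (2 * (k : ℝ)))) ^ 2 / x)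
      (fun X : ℝ ↦ b * Real.log X) := by
  have hk' : (0 : ℝ) < k := by exact_mod_cast hk
  refine Asymptotics.isEquivalent_of_tendsto_one ?_
  have h2 : Tendsto (fun X : ℝ ↦ Real.log X / k) atTop atTop :=
    Real.tendsto_log_atTop.atTop_div_const hk'
  have h3 := (h.comp h2).div_const b
  rw [div_self hb.ne'] at h3
  refine h3.congr' ?_
  filter_upwards [eventually_gt_atTop 1] with X hX
  have hlog := Real.log_pos hX
  simp only [Function.comp_apply, Pi.div_apply]
  rw [integral_M_eq hk hX.le]
  generalize ∫ y in (0 : ℝ)..(Real.log X / k), normErr k y ^ 2 = v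
  field_simp

end KFree

theorem theorem2
    (hRH : RiemannHypothesis)
    (hsimple : ∀ ρ ∈ KFree.upperZeros, deriv riemannZeta ρ ≠ 0)
    (hJ : ∀ ε : ℝ, 0 < ε →
      Asymptotics.IsBigO Filter.atTop KFree.J (fun T : ℝ => T ^ (1 + ε)))
    (k : ℕ) (hk : 2 ≤ k) :
    Summable (fun ρ : KFree.upperZeros => KFree.betaTerm k ρ) ∧
      Asymptotics.IsEquivalent Filter.atTop
        (fun X : ℝ => ∫ x in (1 : ℝ)..X, (KFree.M k x / x ^ (1 / (2 * (k : ℝ)))) ^ 2 / x)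
        (fun X : ℝ => KFree.beta k * Real.log X) := by
  obtain ⟨hsum, hlim⟩ := KFree.tendsto_mean_normErr_sq hRH hsimple hJ hk
  have hup := KFree.summable_zetaRes_upperZeros hsum
  have hpos := KFree.tsum_zetaRes_pos hRH hsimple hk hsum
  rw [KFree.tsum_zeros_eq_beta hup] at hlim hpos
  refine ⟨?_, KFree.isEquivalent_integral_M (by omega) hpos hlim⟩
  simp only [KFree.betaTerm_eq]
  exact hup.mul_left 2
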